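/- **Setting.** Inner products are linear in the first argument. Let $H,\widehat H$ be finite-dimensional complex Hilbert spaces, $H_0=H\oplus\widehat H$, $\mathbb H=H_0\oplus H=H\oplus\widehat H\oplus H$, with orthogonal projections $P_H,P_{\widehat H}$ of $H_0$ onto $H,\widehat H$, and let $J(x_0,\hat x,x_1)=(-x_1,i\hat x,x_0)$ on $\mathbb H$. Let $\mathcal I=[a,b\rangle$, $-\infty<a<b\le\infty$ (a finite endpoint $b$ may or may not belong to $\mathcal I$), and let $B,\Delta$ be measurable operator functions on $\mathcal I$ with values in the operators on $\mathbb H$, integrable on each $[a,\beta]\subset\mathcal I$, with $B(t)=B(t)^*$ and $\Delta(t)\ge0$ a.e. Assume that the system is definite: if $y$ is locally absolutely continuous on $\mathcal I$ and for some $\lambda\in\mathbb C$ satisfies $Jy'-By=\lambda\Delta y$ and $\Delta y=0$ a.e. on $\mathcal I$, then $y=0$ on $\mathcal I$. Let $\mathcal L^2_\Delta$ be the space of Borel functions $f:\mathcal I\to\mathbb H$ with $\int_{\mathcal I}(\Delta f,f)\,dt<\infty$, $L^2_\Delta$ its quotient by the functions of seminorm zero, with inner product $\int_{\mathcal I}(\Delta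 f,g)\,dt$, and $\pi:\mathcal L^2_\Delta\to L^2_\Delta$ the quotient map. Let $t_{\max}$ be the set of pairs $\{y,f\}\in(\mathcal L^2_\Delta)^2$ with $y$ absolutely continuous on each $[a,\beta]\subset\mathcal I$ and $Jy'-By=\Delta f$ a.e., let $T_{\max}=(\pi\oplus\pi)t_{\max}$, and let $T_{\min}$ be the image under $\pi\oplus\pi$ of the pairs $\{y,f\}\in t_{\max}$ with $y(a)=0$ and $[y,z]_b:=\lim_{t\uparrow b}(Jy(t),z(t))=0$ for all $z\in\operatorname{dom}t_{\max}$. A linear relation is a subspace $A$ of $\mathfrak H\oplus\mathfrak H$, and $A^*=\{\{k,k'\}:(k',f)=(k,f')\ \forall\{f,f'\}\in A\}$. Each element of $T_{\max}$ is $\{\pi y,\pi f\}$ with $\{y,f\}\in t_{\max}$, and $y$ is uniquely determined on $\mathcal I$. Assume that the deficiency indices $n_\pm(T_{\min})=\dim\ker(T_{\min}^*\mp i)$ are equal. Let $\widetilde U$ be an operator on $\mathbb H$ with $\widetilde U^*J\widetilde U=J$, and write $\widetilde Uy(a)=(\Gamma_{0a}y,\widehat\Gamma_ay,\Gamma_{1a}y)\in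 H\oplus\widehat H\oplus H$. Let $\mathcal H_b$ be a finite-dimensional Hilbert space and let $\Gamma_b=(\Gamma_{0b},\widehat\Gamma_b,\Gamma_{1b}):\operatorname{dom}t_{\max}\to\mathcal H_b\oplus\widehat H\oplus\mathcal H_b$ be a surjective linear map with $$[y,z]_b=(\Gamma_{0b}y,\Gamma_{1b}z)-(\Gamma_{1b}y,\Gamma_{0b}z)+i(\widehat\Gamma_by,\widehat\Gamma_bz),\qquad y,z\in\operatorname{dom}t_{\max}.$$ Let $\tau=\{(C_0,C_1);\mathcal H_b\}$ be a self-adjoint pair: $C_0,C_1$ are operators on $\mathcal H_b$ with $\operatorname{Im}(C_1C_0^*)=0$ and $C_0\pm iC_1$ invertible. **Statement.** For every $\lambda\in\mathbb C\setminus\mathbb R$ there is a unique operator solution $v_\tau(\cdot,\lambda)$ on $\mathcal I$ of $Jy'-By=\lambda\Delta y$, with values in the operators from $H_0$ to $\mathbb H$, such that $v_\tau(\cdot,\lambda)h\in\mathcal L^2_\Delta$ for all $h\in H_0$ and $$\Gamma_{1a}v_\tau(\lambda)=-P_H,\qquad i(\widehat\Gamma_a-\widehat\Gamma_b)v_\tau(\lambda)=P_{\widehat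 H},\qquad C_0\Gamma_{0b}v_\tau(\lambda)+C_1\Gamma_{1b}v_\tau(\lambda)=0,$$ where $v_\tau(\lambda)h=v_\tau(\cdot,\lambda)h$. Put $m_\tau(\lambda)=(\Gamma_{0a}+\widehat\Gamma_a)v_\tau(\lambda)+\tfrac i2P_{\widehat H}$, an operator on $H_0$. Then: (1) The relation $$\widetilde T=\{\{\pi y,\pi f\}:\{y,f\}\in t_{\max},\ y(a)=0,\ \widehat\Gamma_by=0,\ C_0\Gamma_{0b}y+C_1\Gamma_{1b}y=0\}$$ is a closed symmetric extension of $T_{\min}$, and $$\widetilde T^*=\{\{\pi y,\pi f\}:\{y,f\}\in t_{\max},\ C_0\Gamma_{0b}y+C_1\Gamma_{1b}y=0\}.$$ (2) The equalities $$\widetilde\Gamma_0\{\pi y,\pi f\}=-\Gamma_{1a}y+i(\widehat\Gamma_a-\widehat\Gamma_b)y,\qquad\widetilde\Gamma_1\{\pi y,\pi f\}=\Gamma_{0a}y+\tfrac12(\widehat\Gamma_a+\widehat\Gamma_b)y$$ ($\{y,f\}\in t_{\max}$, $\{\pi y,\pi f\}\in\widetilde T^*$) give well-defined linear maps $\widetilde\Gamma_0,\widetilde\Gamma_1:\widetilde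 T^*\to H_0$, and $\{H_0,\widetilde\Gamma_0,\widetilde\Gamma_1\}$ is an ordinary boundary triplet for $\widetilde T^*$: $(\widetilde\Gamma_0,\widetilde\Gamma_1):\widetilde T^*\to H_0\oplus H_0$ is surjective, and $(f',g)-(f,g')=(\widetilde\Gamma_1\hat f,\widetilde\Gamma_0\hat g)-(\widetilde\Gamma_0\hat f,\widetilde\Gamma_1\hat g)$ for all $\hat f=\{f,f'\},\hat g=\{g,g'\}\in\widetilde T^*$. For every $\lambda\in\mathbb C\setminus\mathbb R$ its $\gamma$-field is $\widetilde\gamma(\lambda)=\pi v_\tau(\lambda)$ (that is, $\widetilde\Gamma_0$ maps $\{\{x,\lambda x\}\in\widetilde T^*\}$ bijectively onto $H_0$, with inverse $h\mapsto\{\widetilde\gamma(\lambda)h,\lambda\widetilde\gamma(\lambda)h\}$), and its Weyl function, defined by $\widetilde M(\lambda)h=\widetilde\Gamma_1\{\widetilde\gamma(\lambda)h,\lambda\widetilde\gamma(\lambda)h\}$, is $\widetilde M(\lambda)=m_\tau(\lambda)$. (3) For all $\mu,\lambda\in\mathbb C\setminus\mathbb R$ the following integral converges absolutely and $$m_\tau(\mu)-m_\tau^*(\lambda)=(\mu-\overline\lambda)\int_{\mathcal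 I}v_\tau^*(t,\lambda)\Delta(t)v_\tau(t,\mu)\,dt.$$ In particular $(\operatorname{Im}\lambda)^{-1}\operatorname{Im}m_\tau(\lambda)=\int_{\mathcal I}v_\tau^*(t,\lambda)\Delta(t)v_\tau(t,\lambda)\,dt$ for all $\lambda\in\mathbb C\setminus\mathbb R$, where $\operatorname{Im}m=\frac1{2i}(m-m^*)$. -/

import Mathlib

open MeasureTheory Filter Topology ComplexConjugate
open scoped InnerProductSpace

noncomputable section

/-! ### Linear relations and ordinary boundary triplets

A linear relation in `E` is a subspace of `E × E`; the adjoint relation is `Submodule.adjoint`.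
Mathlib's inner product `inner ℂ x y` is conjugate-linear in `x`, so that the inner product
`(x, y)` that is linear in the first argument is `inner ℂ y x`. -/

section Abstract

variable {E K : Type*} [NormedAddCommGroup E] [InnerProductSpace ℂ E]
  [NormedAddCommGroup K] [InnerProductSpace ℂ K]

/-- A linear relation `A` is symmetric if it is contained in its adjoint. -/
def IsSymmetricRelation (A : Submodule ℂ (E × E)) : Prop := A ≤ A.adjoint

/-- The defect subspace `ker (A* - z)`. -/
def defectSubspace (A : Submodule ℂ (E × E)) (z : ℂ) : Submodule ℂ E :=
  A.adjoint.comap (LinearMap.prod LinearMap.id (z • LinearMap.id))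

/-- The deficiency index `n₊(A)`, the dimension of `ker (A* - i)`. -/
def deficiencyIndexPlus (A : Submodule ℂ (E × E)) : Cardinal :=
  Module.rank ℂ (defectSubspace A Complex.I)

/-- The deficiency index `n₋(A)`, the dimension of `ker (A* + i)`. -/
def deficiencyIndexMinus (A : Submodule ℂ (E × E)) : Cardinal :=
  Module.rank ℂ (defectSubspace A (-Complex.I))

/-- `{K, G0, G1}` is an ordinary boundary triplet for `A*`, where `A` is a closed symmetric
relation: `(G0, G1)` maps `A*` onto `K × K`, and Green's identity
`(f', g) - (f, g') = (G1 f̂, G0 ĝ) - (G0 f̂, G1 ĝ)` holds for `f̂ = {f, f'}`, `ĝ = {g, g'}`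
in `A*`. -/
structure IsOrdinaryBoundaryTriplet (A : Submodule ℂ (E × E))
    (G0 G1 : A.adjoint →ₗ[ℂ] K) : Prop where
  isClosed : IsClosed (A : Set (E × E))
  symmetric : IsSymmetricRelation A
  surjective : Function.Surjective fun f : A.adjoint => (G0 f, G1 f)
  green : ∀ f g : A.adjoint,
    inner ℂ (g : E × E).1 (f : E × E).2 - inner ℂ (g : E × E).2 (f : E × E).1
      = inner ℂ (G0 g) (G1 f) - inner ℂ (G1 g) (G0 f)

/-- `γ` is the value at `z` of the `γ`-field: `G0` maps `N̂_z = {{x, z x} ∈ A*}` bijectively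
onto `K`, and `γ` is the inverse map followed by the projection onto the first component. -/
def IsGammaFieldAt (A : Submodule ℂ (E × E)) (G0 : A.adjoint →ₗ[ℂ] K) (z : ℂ)
    (γ : K →ₗ[ℂ] E) : Prop :=
  (∀ h : K, ∃ hm : (γ h, z • γ h) ∈ A.adjoint, G0 ⟨(γ h, z • γ h), hm⟩ = h) ∧
  ∀ (x : E) (hx : (x, z • x) ∈ A.adjoint), γ (G0 ⟨(x, z • x), hx⟩) = x

/-- `M` is the value at `z` of the Weyl function: `M h = G1 {γ h, z γ h}`, where `γ` is the value
at `z` of the `γ`-field. -/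
def IsWeylFunctionAt (A : Submodule ℂ (E × E)) (G0 G1 : A.adjoint →ₗ[ℂ] K) (z : ℂ)
    (M : K →ₗ[ℂ] K) : Prop :=
  ∃ γ : K →ₗ[ℂ] E, IsGammaFieldAt A G0 z γ ∧
    ∀ (h : K) (hm : (γ h, z • γ h) ∈ A.adjoint), G1 ⟨(γ h, z • γ h), hm⟩ = M h

end Abstract

/-! ### The spaces `H₀ = H ⊕ Ĥ` and `𝐇 = H₀ ⊕ H` and the operator `J` -/

/-- The Hilbert space `H₀ = H ⊕ Ĥ`. -/
abbrev SpaceH0 (H Hh : Type*) := WithLp 2 (H × Hh)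

/-- The Hilbert space `𝐇 = (H ⊕ Ĥ) ⊕ H`. -/
abbrev SpaceHH (H Hh : Type*) := WithLp 2 (SpaceH0 H Hh × H)

/-- Finite-dimensional complex normed spaces are complete. -/
instance completeSpace_of_finiteDimensional_complex {E : Type*} [NormedAddCommGroup E]
    [NormedSpace ℂ E] [FiniteDimensional ℂ E] : CompleteSpace E :=
  FiniteDimensional.complete ℂ E

section Spaces

variable (H Hh : Type*) [NormedAddCommGroup H] [InnerProductSpace ℂ H] [FiniteDimensional ℂ H]
  [NormedAddCommGroup Hh] [InnerProductSpace ℂ Hh] [FiniteDimensional ℂ Hh]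

/-- `J (x₀, x̂, x₁) = (-x₁, i x̂, x₀)`. -/
def operatorJ : SpaceHH H Hh →L[ℂ] SpaceHH H Hh :=
  LinearMap.toContinuousLinearMap
    { toFun := fun x =>
        WithLp.toLp 2 (WithLp.toLp 2 (-x.snd, Complex.I • x.fst.snd), x.fst.fst)
      map_add' := fun x y => WithLp.ofLp_injective 2 (Prod.ext
        (WithLp.ofLp_injective 2 (Prod.ext (by simp [add_comm]) (by simp))) (by simp))
      map_smul' := fun c x => WithLp.ofLp_injective 2 (Prod.ext
        (WithLp.ofLp_injective 2 (Prod.ext (by simp) (by simp [smul_comm c]))) (by simp)) }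

end Spaces

/-- A form of the Cauchy-Schwarz inequality for a non-negative operator. -/
theorem inner_pairing_bound {E : Type*} [NormedAddCommGroup E] [InnerProductSpace ℂ E]
    {T : E →L[ℂ] E} (hT : T.IsPositive) (x y : E) :
    ‖inner ℂ x (T y)‖ ≤ ‖inner ℂ x (T x)‖ + ‖inner ℂ y (T y)‖ := by
  have hx := hT.re_inner_nonneg_right x
  have hxle : RCLike.re (inner ℂ x (T x)) ≤ ‖inner ℂ x (T x)‖ := RCLike.re_le_norm _
  have hyle : RCLike.re (inner ℂ y (T y)) ≤ ‖inner ℂ y (T y)‖ := RCLike.re_le_norm _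
  obtain ⟨c, hc, hcz⟩ : ∃ c : ℂ, ‖c‖ = 1 ∧ c * inner ℂ x (T y) = -(‖inner ℂ x (T y)‖ : ℂ) := by
    obtain ⟨c, hc, h⟩ := RCLike.exists_norm_mul_eq_self (inner ℂ x (T y))
    refine ⟨-starRingEnd ℂ c, by simpa using hc, ?_⟩
    have hcc : starRingEnd ℂ c * c = 1 := by
      rw [RCLike.conj_mul]; simp [hc]
    rw [neg_mul]
    congr 1
    conv_lhs => rw [← h]
    rw [← mul_assoc, hcc, one_mul]
    rfl
  have h := hT.re_inner_nonneg_right (x + c • y)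
  have hsymm : inner ℂ y (T x) = starRingEnd ℂ (inner ℂ x (T y)) := by
    rw [inner_conj_symm]
    exact (hT.isSymmetric y x).symm
  have hexp : inner ℂ (x + c • y) (T (x + c • y)) =
      inner ℂ x (T x) + (c * inner ℂ x (T y) + starRingEnd ℂ (c * inner ℂ x (T y)))
        + (starRingEnd ℂ c * c) * inner ℂ y (T y) := by
    simp only [map_add, map_smul, inner_add_left, inner_add_right, inner_smul_left,
      inner_smul_right, hsymm, map_mul]
    ring
  have hcc : starRingEnd ℂ c * c = 1 := by
    rw [RCLike.conj_mul]; simp [hc]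
  rw [hexp, hcz, hcc] at h
  simp at h
  simp at hxle hyle
  have := norm_nonneg (inner ℂ x (T y))
  linarith

/-! ### Symmetric systems -/

/-- The coefficients of a first-order symmetric system `J y' - B y = Δ f` on an interval
`I = [a, b⟩` with `-∞ < a < b ≤ ∞`, where a finite endpoint `b` may or may not belong to `I`. -/
structure SymmetricSystem (H Hh : Type*)
    [NormedAddCommGroup H] [InnerProductSpace ℂ H] [FiniteDimensional ℂ H]
    [NormedAddCommGroup Hh] [InnerProductSpace ℂ Hh] [FiniteDimensional ℂ Hh] where
  a : ℝ
  b : EReal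
  a_lt_b : (a : EReal) < b
  I : Set ℝ
  I_eq : I = {t : ℝ | a ≤ t ∧ (t : EReal) < b} ∨ I = {t : ℝ | a ≤ t ∧ (t : EReal) ≤ b}
  B : ℝ → SpaceHH H Hh →L[ℂ] SpaceHH H Hh
  Δ : ℝ → SpaceHH H Hh →L[ℂ] SpaceHH H Hh
  B_meas : AEStronglyMeasurable B (volume.restrict I)
  Δ_meas : AEStronglyMeasurable Δ (volume.restrict I)
  B_int : ∀ β ∈ I, IntegrableOn B (Set.Icc a β)
  Δ_int : ∀ β ∈ I, IntegrableOn Δ (Set.Icc a β)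
  B_symm : ∀ᵐ t ∂volume.restrict I, (B t).IsSymmetric
  Δ_pos : ∀ᵐ t ∂volume.restrict I, (Δ t).IsPositive

namespace SymmetricSystem

variable {H Hh : Type*} [NormedAddCommGroup H] [InnerProductSpace ℂ H] [FiniteDimensional ℂ H]
  [NormedAddCommGroup Hh] [InnerProductSpace ℂ Hh] [FiniteDimensional ℂ Hh]

variable (S : SymmetricSystem H Hh)

/-- The filter `t ↑ b`. -/
def leftOfB : Filter ℝ := comap (fun t : ℝ => (t : EReal)) (𝓝[<] S.b)

/-- The function `y` is absolutely continuous on every segment `[a, β] ⊆ I` and satisfies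
`J y' - B y = g` a.e. on `I`. Functions on `I` are represented by functions on `ℝ` whose values
outside `I` are irrelevant. -/
def Solves (y g : ℝ → SpaceHH H Hh) : Prop :=
  (∀ β ∈ S.I, AbsolutelyContinuousOnInterval y S.a β) ∧
  ∀ᵐ t ∂volume.restrict S.I, ∃ d : SpaceHH H Hh,
    HasDerivAt y d t ∧ operatorJ H Hh d - S.B t (y t) = g t

/-- `y` is a solution of the homogeneous system `J y' - B y = z Δ y`. -/
def IsSolution (z : ℂ) (y : ℝ → SpaceHH H Hh) : Prop :=
  S.Solves y fun t => z • S.Δ t (y t)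

/-- The system is definite: a solution `y` of `J y' - B y = z Δ y` with `Δ y = 0` a.e. on `I`
vanishes on `I`. -/
def IsDefinite : Prop :=
  ∀ (z : ℂ) (y : ℝ → SpaceHH H Hh), S.IsSolution z y →
    (∀ᵐ t ∂volume.restrict S.I, S.Δ t (y t) = 0) → ∀ t ∈ S.I, y t = 0

/-! ### The semi-Hilbert space `𝓛²_Δ(I)` and the Hilbert space `L²_Δ(I)` -/

/-- `f` is Borel measurable on `I` and `∫_I (Δ f, f) dt < ∞`. -/
def MemL2 (f : ℝ → SpaceHH H Hh) : Prop :=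
  StronglyMeasurable (S.I.domRestrict f) ∧
  IntegrableOn (fun t => inner ℂ (f t) (S.Δ t (f t))) S.I

theorem measurableSet_I : MeasurableSet S.I := by
  rcases S.I_eq with h | h <;> rw [h]
  · exact measurableSet_Ici.inter
      (measurableSet_lt measurable_coe_real_ereal measurable_const)
  · exact measurableSet_Ici.inter
      (measurableSet_le measurable_coe_real_ereal measurable_const)

variable {S} in
theorem MemL2.aestronglyMeasurable {f : ℝ → SpaceHH H Hh} (hf : S.MemL2 f) :
    AEStronglyMeasurable f (volume.restrict S.I) := by
  let _ : MeasurableSpace (SpaceHH H Hh) := borel _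
  have : BorelSpace (SpaceHH H Hh) := ⟨rfl⟩
  have : ProperSpace (SpaceHH H Hh) := FiniteDimensional.proper_rclike ℂ _
  exact (aemeasurable_restrict_of_measurable_subtype S.measurableSet_I
    hf.1.measurable).aestronglyMeasurable

variable {S} in
theorem MemL2.integrableOn_inner {f g : ℝ → SpaceHH H Hh} (hf : S.MemL2 f) (hg : S.MemL2 g) :
    IntegrableOn (fun t => inner ℂ (f t) (S.Δ t (g t))) S.I := by
  refine Integrable.mono' (hf.2.norm.add hg.2.norm) ?_ ?_
  · exact hf.aestronglyMeasurable.inner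
      (isBoundedBilinearMap_apply.continuous.comp_aestronglyMeasurable₂
        S.Δ_meas hg.aestronglyMeasurable)
  · filter_upwards [S.Δ_pos] with t ht
    exact inner_pairing_bound ht _ _

/-- The linear space `𝓛²_Δ(I)`. -/
def l2 : Submodule ℂ (ℝ → SpaceHH H Hh) where
  carrier := {f | S.MemL2 f}
  zero_mem' := by
    refine ⟨?_, ?_⟩
    · exact stronglyMeasurable_zero
    · simp
  add_mem' := by
    intro f g hf hg
    refine ⟨hf.1.add hg.1, ?_⟩
    have h := ((hf.2.add (hf.integrableOn_inner hg)).add (hg.integrableOn_inner hf)).add hg.2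
    refine h.congr (Eventually.of_forall fun t => ?_)
    simp only [Pi.add_apply, map_add, inner_add_left, inner_add_right]
    ring
  smul_mem' := by
    intro c f hf
    refine ⟨hf.1.const_smul c, ?_⟩
    have h := hf.2.const_mul (starRingEnd ℂ c * c)
    refine h.congr (Eventually.of_forall fun t => ?_)
    simp only [Pi.smul_apply, map_smul, inner_smul_left, inner_smul_right]
    ring

/-- The type of elements of `𝓛²_Δ(I)`. -/
def L2Fun : Type _ := S.l2

instance : AddCommGroup S.L2Fun := inferInstanceAs (AddCommGroup S.l2)
instance : Module ℂ S.L2Fun := inferInstanceAs (Module ℂ S.l2)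

/-- The semi-definite inner product `(f, g)_Δ = ∫_I (Δ f, g) dt`. -/
@[reducible]
def l2Core : PreInnerProductSpace.Core ℂ S.L2Fun where
  inner f g := ∫ t in S.I, inner ℂ (f.1 t) (S.Δ t (g.1 t))
  conj_inner_symm f g := by
    rw [← integral_conj]
    refine integral_congr_ae ?_
    filter_upwards [S.Δ_pos] with t ht
    simp only [inner_conj_symm]
    exact ht.isSymmetric _ _
  re_inner_nonneg f := by
    rw [← integral_re (MemL2.integrableOn_inner f.2 f.2)]
    refine integral_nonneg_of_ae ?_
    filter_upwards [S.Δ_pos] with t ht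
    exact ht.re_inner_nonneg_right _
  add_left f g h := by
    rw [← integral_add (MemL2.integrableOn_inner f.2 h.2) (MemL2.integrableOn_inner g.2 h.2)]
    refine integral_congr_ae (Eventually.of_forall fun t => ?_)
    exact inner_add_left _ _ _
  smul_left f g c := by
    rw [← integral_const_mul]
    refine integral_congr_ae (Eventually.of_forall fun t => ?_)
    exact inner_smul_left _ _ _

instance : SeminormedAddCommGroup S.L2Fun :=
  InnerProductSpace.Core.toSeminormedAddCommGroup (𝕜 := ℂ) (c := S.l2Core)

instance : InnerProductSpace ℂ S.L2Fun := InnerProductSpace.ofCore S.l2Core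

/-- The Hilbert space `L²_Δ(I)`, the quotient of `𝓛²_Δ(I)` by `{f | ‖f‖_Δ = 0}`. -/
abbrev L2 : Type _ := SeparationQuotient S.L2Fun

/-- The quotient map `π : 𝓛²_Δ(I) → L²_Δ(I)`. -/
def quot : S.L2Fun →ₗ[ℂ] S.L2 := (SeparationQuotient.mkCLM ℂ S.L2Fun).toLinearMap

/-! ### Maximal and minimal relations -/

/-- The maximal relation in `𝓛²_Δ(I)`: pairs `{y, f}` with `y` locally absolutely continuous and
`J y' - B y = Δ f` a.e. on `I`. -/
def tmax : Submodule ℂ (S.L2Fun × S.L2Fun) where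
  carrier := {p | S.Solves p.1.1 fun t => S.Δ t (p.2.1 t)}
  zero_mem' := by
    refine ⟨fun β _ => ?_, Eventually.of_forall fun t => ⟨0, ?_, ?_⟩⟩
    · exact (LipschitzOnWith.absolutelyContinuousOnInterval
        (f := fun _ : ℝ => (0 : SpaceHH H Hh)) (K := 0) (a := S.a) (b := β)
        (LipschitzWith.const _).lipschitzOnWith)
    · exact hasDerivAt_const t (0 : SpaceHH H Hh)
    · change operatorJ H Hh 0 - S.B t 0 = S.Δ t 0
      simp
  add_mem' := by
    rintro p q ⟨hp, hp'⟩ ⟨hq, hq'⟩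
    refine ⟨fun β hβ => (hp β hβ).add (hq β hβ), ?_⟩
    filter_upwards [hp', hq'] with t ⟨d, hd, hd'⟩ ⟨e, he, he'⟩
    refine ⟨d + e, hd.add he, ?_⟩
    change operatorJ H Hh (d + e) - S.B t (p.1.1 t + q.1.1 t) = S.Δ t (p.2.1 t + q.2.1 t)
    rw [map_add, map_add, map_add, ← hd', ← he']
    abel
  smul_mem' := by
    rintro c p ⟨hp, hp'⟩
    refine ⟨fun β hβ => (hp β hβ).const_smul c, ?_⟩
    filter_upwards [hp'] with t ⟨d, hd, hd'⟩
    refine ⟨c • d, hd.const_smul c, ?_⟩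
    change operatorJ H Hh (c • d) - S.B t (c • p.1.1 t) = S.Δ t (c • p.2.1 t)
    rw [map_smul, map_smul, map_smul, ← hd', smul_sub]

/-- The domain of the maximal relation in `𝓛²_Δ(I)`. -/
def domMax : Submodule ℂ S.L2Fun := S.tmax.map (LinearMap.fst ℂ S.L2Fun S.L2Fun)

/-- The value of `y` in the domain of the maximal relation, as a function of `t`. -/
def val (y : S.domMax) (t : ℝ) : SpaceHH H Hh := y.1.1 t

/-- The first component of an element of the maximal relation, as an element of the domain. -/
def fstDom (p : S.L2Fun × S.L2Fun) (hp : p ∈ S.tmax) : S.domMax :=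
  ⟨p.1, Submodule.mem_map_of_mem (f := LinearMap.fst ℂ S.L2Fun S.L2Fun) hp⟩

/-- The linear map `y ↦ y(a)` on the domain of the maximal relation. -/
def evalA : S.domMax →ₗ[ℂ] SpaceHH H Hh where
  toFun y := S.val y S.a
  map_add' _ _ := rfl
  map_smul' _ _ := rfl

/-- The relation `{{π y, π f} | {y, f} ∈ t_max, y ∈ L}` in `L²_Δ(I)`, that is, the restriction of
the maximal relation by boundary conditions on `y` that single out the subspace `L`. -/
def relOn (L : Submodule ℂ S.domMax) : Submodule ℂ (S.L2 × S.L2) :=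
  (S.tmax ⊓ (L.map S.domMax.subtype).comap (LinearMap.fst ℂ S.L2Fun S.L2Fun)).map
    (S.quot.prodMap S.quot)

/-- The maximal relation `T_max` in `L²_Δ(I)`. -/
def Tmax : Submodule ℂ (S.L2 × S.L2) := S.tmax.map (S.quot.prodMap S.quot)

/-- The domain of the minimal relation in `𝓛²_Δ(I)`: all `y` with `y(a) = 0` and
`[y, z]_b = lim_{t ↑ b} (J y(t), z(t)) = 0` for all `z` in the domain of the maximal relation. -/
def domMin : Submodule ℂ S.domMax where
  carrier := {y | S.val y S.a = 0 ∧ ∀ z : S.domMax,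
    Tendsto (fun t => inner ℂ (S.val z t) (operatorJ H Hh (S.val y t))) S.leftOfB (𝓝 0)}
  zero_mem' := by
    refine ⟨rfl, fun z => ?_⟩
    have : (fun t => inner ℂ (S.val z t) (operatorJ H Hh (S.val 0 t))) = fun _ => (0 : ℂ) := by
      funext t
      change inner ℂ (S.val z t) (operatorJ H Hh 0) = 0
      simp
    rw [this]
    exact tendsto_const_nhds
  add_mem' := by
    rintro x y ⟨hx, hx'⟩ ⟨hy, hy'⟩
    refine ⟨?_, fun z => ?_⟩
    · change S.val x S.a + S.val y S.a = 0
      rw [hx, hy, add_zero]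
    · have h := (hx' z).add (hy' z)
      rw [add_zero] at h
      refine h.congr fun t => ?_
      change _ = inner ℂ (S.val z t) (operatorJ H Hh (S.val x t + S.val y t))
      rw [map_add, inner_add_right]
  smul_mem' := by
    rintro c y ⟨hy, hy'⟩
    refine ⟨?_, fun z => ?_⟩
    · change c • S.val y S.a = 0
      rw [hy, smul_zero]
    · have h := (hy' z).const_mul c
      rw [mul_zero] at h
      refine h.congr fun t => ?_
      change _ = inner ℂ (S.val z t) (operatorJ H Hh (c • S.val y t))
      rw [map_smul, inner_smul_right]

/-- The minimal relation `T_min` in `L²_Δ(I)`. -/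
def Tmin : Submodule ℂ (S.L2 × S.L2) := S.relOn S.domMin

/-! ### Boundary maps -/

/-- A surjective linear map `Γ_b = (Γ_{0b}, Γ̂_b, Γ_{1b})` from the domain of the maximal relation
onto `H_b ⊕ Ĥ ⊕ H_b` such that
`lim_{t ↑ b} (J y(t), z(t)) = (Γ_{0b} y, Γ_{1b} z) - (Γ_{1b} y, Γ_{0b} z) + i (Γ̂_b y, Γ̂_b z)`. -/
structure BoundaryMap (Hb : Type*) [NormedAddCommGroup Hb] [InnerProductSpace ℂ Hb] where
  Γ0 : S.domMax →ₗ[ℂ] Hb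
  Γhat : S.domMax →ₗ[ℂ] Hh
  Γ1 : S.domMax →ₗ[ℂ] Hb
  surjective : Function.Surjective fun y => (Γ0 y, Γhat y, Γ1 y)
  form_eq : ∀ y z : S.domMax,
    Tendsto (fun t => inner ℂ (S.val z t) (operatorJ H Hh (S.val y t))) S.leftOfB
      (𝓝 (inner ℂ (Γ1 z) (Γ0 y) - inner ℂ (Γ0 z) (Γ1 y)
        + Complex.I * inner ℂ (Γhat z) (Γhat y)))

section EndpointA

variable (U : SpaceHH H Hh →L[ℂ] SpaceHH H Hh)

/-- `Γ_{0a} y`, the first component of `Ũ y(a)` in `H ⊕ Ĥ ⊕ H`. -/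
def Γ0a : S.domMax →ₗ[ℂ] H :=
  (WithLp.fstL 2 ℂ H Hh ∘L WithLp.fstL 2 ℂ (SpaceH0 H Hh) H ∘L U).toLinearMap ∘ₗ S.evalA

/-- `Γ̂_a y`, the second component of `Ũ y(a)` in `H ⊕ Ĥ ⊕ H`. -/
def Γhata : S.domMax →ₗ[ℂ] Hh :=
  (WithLp.sndL 2 ℂ H Hh ∘L WithLp.fstL 2 ℂ (SpaceH0 H Hh) H ∘L U).toLinearMap ∘ₗ S.evalA

/-- `Γ_{1a} y`, the third component of `Ũ y(a)` in `H ⊕ Ĥ ⊕ H`. -/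
def Γ1a : S.domMax →ₗ[ℂ] H :=
  (WithLp.sndL 2 ℂ (SpaceH0 H Hh) H ∘L U).toLinearMap ∘ₗ S.evalA

end EndpointA

/-- `U` is `J`-unitary: `U* J U = J`. -/
def _root_.IsJUnitary (U : SpaceHH H Hh →L[ℂ] SpaceHH H Hh) : Prop :=
  ContinuousLinearMap.adjoint U ∘L operatorJ H Hh ∘L U = operatorJ H Hh

/-- The pair `(C₀, C₁)` is self-adjoint: `Im (C₁ C₀*) = 0`, and `C₀ + i C₁` and `C₀ - i C₁` are
invertible. -/
def _root_.IsSelfAdjointPair {Hb : Type*} [NormedAddCommGroup Hb] [InnerProductSpace ℂ Hb]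
    [FiniteDimensional ℂ Hb] (C0 C1 : Hb →L[ℂ] Hb) : Prop :=
  IsSelfAdjoint (C1 ∘L ContinuousLinearMap.adjoint C0) ∧
  IsUnit (C0 + Complex.I • C1) ∧ IsUnit (C0 - Complex.I • C1)

/-! ### Operator solutions -/

section OperatorSolutions

variable {K : Type*} [NormedAddCommGroup K] [InnerProductSpace ℂ K]

/-- `Y(·)` is an operator solution of `J y' - B y = z Δ y` that belongs to `𝓛²_Δ[K, 𝐇]`. -/
structure IsL2OperatorSolution (z : ℂ) (Y : ℝ → K →L[ℂ] SpaceHH H Hh) : Prop where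
  isSolution : ∀ h : K, S.IsSolution z fun t => Y t h
  memL2 : ∀ h : K, S.MemL2 fun t => Y t h

variable {S} in
/-- The linear map `h ↦ Y(·) h` from `K` into the domain of the maximal relation. -/
def IsL2OperatorSolution.toMap {z : ℂ} {Y : ℝ → K →L[ℂ] SpaceHH H Hh}
    (hY : S.IsL2OperatorSolution z Y) : K →ₗ[ℂ] S.domMax where
  toFun h := S.fstDom (⟨fun t => Y t h, hY.memL2 h⟩, z • ⟨fun t => Y t h, hY.memL2 h⟩) (by
    refine ⟨(hY.isSolution h).1, ?_⟩
    filter_upwards [(hY.isSolution h).2] with t ⟨d, hd, hd'⟩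
    refine ⟨d, hd, hd'.trans ?_⟩
    change z • S.Δ t (Y t h) = S.Δ t (z • Y t h)
    rw [map_smul])
  map_add' h k := by
    apply Subtype.ext
    apply Subtype.ext
    funext t
    exact map_add (Y t) h k
  map_smul' c h := by
    apply Subtype.ext
    apply Subtype.ext
    funext t
    exact map_smul (Y t) c h

variable {S} in
/-- The operator `π Y : K → L²_Δ(I)`, `h ↦ π (Y(·) h)`. -/
def IsL2OperatorSolution.toL2 {z : ℂ} {Y : ℝ → K →L[ℂ] SpaceHH H Hh}
    (hY : S.IsL2OperatorSolution z Y) : K →ₗ[ℂ] S.L2 :=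
  S.quot ∘ₗ S.domMax.subtype ∘ₗ hY.toMap

end OperatorSolutions

section Weyl

variable {Hb : Type*} [NormedAddCommGroup Hb] [InnerProductSpace ℂ Hb] [FiniteDimensional ℂ Hb]
variable (U : SpaceHH H Hh →L[ℂ] SpaceHH H Hh) (Γ : S.BoundaryMap Hb) (C0 C1 : Hb →L[ℂ] Hb)

/-- `v` is an operator solution `v_τ(·, z)`: it belongs to `𝓛²_Δ[H₀, 𝐇]` and
`Γ_{1a} v = -P_H`, `i (Γ̂_a - Γ̂_b) v = P_Ĥ`, `C₀ Γ_{0b} v + C₁ Γ_{1b} v = 0`. -/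
structure IsVTau (z : ℂ) (v : ℝ → SpaceH0 H Hh →L[ℂ] SpaceHH H Hh) : Prop where
  sol : S.IsL2OperatorSolution z v
  Γ1a_eq : ∀ h : SpaceH0 H Hh, S.Γ1a U (sol.toMap h) = -h.fst
  hat_eq : ∀ h : SpaceH0 H Hh,
    Complex.I • (S.Γhata U (sol.toMap h) - Γ.Γhat (sol.toMap h)) = h.snd
  tau_eq : ∀ h : SpaceH0 H Hh, C0 (Γ.Γ0 (sol.toMap h)) + C1 (Γ.Γ1 (sol.toMap h)) = 0

variable {S U Γ C0 C1} in
/-- `m_τ(z) = (Γ_{0a} + Γ̂_a) v_τ(z) + (i/2) P_Ĥ`, an operator in `H₀ = H ⊕ Ĥ`. -/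
def IsVTau.m {z : ℂ} {v : ℝ → SpaceH0 H Hh →L[ℂ] SpaceHH H Hh}
    (hv : S.IsVTau U Γ C0 C1 z v) : SpaceH0 H Hh →L[ℂ] SpaceH0 H Hh :=
  LinearMap.toContinuousLinearMap
    { toFun := fun h => WithLp.toLp 2
        (S.Γ0a U (hv.sol.toMap h), S.Γhata U (hv.sol.toMap h) + (Complex.I / 2) • h.snd)
      map_add' := fun h k => WithLp.ofLp_injective 2 (Prod.ext (by simp)
        (by simp [smul_add]; abel))
      map_smul' := fun c h => WithLp.ofLp_injective 2 (Prod.ext (by simp)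
        (by simp [smul_add, smul_comm c])) }

/-- The subspace of all `y` with `C₀ Γ_{0b} y + C₁ Γ_{1b} y = 0`. -/
def domTau : Submodule ℂ S.domMax :=
  LinearMap.ker (C0.toLinearMap ∘ₗ Γ.Γ0 + C1.toLinearMap ∘ₗ Γ.Γ1)

/-- The relation `T̃`: the restriction of `T_max` by `y(a) = 0`, `Γ̂_b y = 0` and
`C₀ Γ_{0b} y + C₁ Γ_{1b} y = 0`. -/
def Ttilde : Submodule ℂ (S.L2 × S.L2) :=
  S.relOn (LinearMap.ker S.evalA ⊓ LinearMap.ker Γ.Γhat ⊓ S.domTau Γ C0 C1)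

/-- `Γ̃₀ = -Γ_{1a} + i (Γ̂_a - Γ̂_b)`, with values in `H₀ = H ⊕ Ĥ`. -/
def Γtilde0 (y : S.domMax) : SpaceH0 H Hh :=
  WithLp.toLp 2 (-S.Γ1a U y, Complex.I • (S.Γhata U y - Γ.Γhat y))

/-- `Γ̃₁ = Γ_{0a} + (1/2) (Γ̂_a + Γ̂_b)`, with values in `H₀ = H ⊕ Ĥ`. -/
def Γtilde1 (y : S.domMax) : SpaceH0 H Hh :=
  WithLp.toLp 2 (S.Γ0a U y, (1 / 2 : ℂ) • (S.Γhata U y + Γ.Γhat y))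

end Weyl

end SymmetricSystem

end

/-!
The proof rests on Green's identity: for `{y, f}` and `{z, g}` in `t_max`
`(f, z) - (y, g) = [y, z]_b - (J y(a), z(a))`, where both boundary terms are sesquilinear in
the finitely many boundary values of `y` and `z`. By `BoundaryMap.exists_boundary_values` the value
`y(a)` and the values `Γ_b y` can be prescribed independently; this uses definiteness. Thus, once an
adjoint is known to be a restriction of `T_max`, finding it is linear algebra of boundary values.

That adjoints are restrictions of `T_max` is `adjoint_Tmin_le`. A function `f` that vanishes near
`b` is the right-hand side of an element `{y, f}` of `t_max` with `y` vanishing near `b` and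
`y(a) = ∫ J Y* Δ f`, where `Y` is the fundamental solution, which is `J`-unitary. If `{k, k'}` is in
the adjoint of `T_min` and `z` solves `J z' - B z = Δ k'`, the functional `f ↦ (f, k - z)` vanishes
whenever `y(a) = 0`, so it factors through the finite-dimensional `y(a)`. Hence `k` differs from `z`
by a solution of the homogeneous system, up to a function annihilated by `Δ`.

The boundary condition given by `τ` is self-adjoint (`IsSelfAdjointPair`), so `adjoint_Ttilde`
follows, `T̃` is closed as an adjoint, and Green's identity rewritten in `Γ̃₀`, `Γ̃₁` gives the
boundary triplet (`isOrdinaryBoundaryTriplet`). The space `L²_Δ` is complete, so the self-adjoint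
relation `ker Γ̃₀` has full range after subtraction of a non-real `z`, and `Γ̃₀` maps
`{{x, z x} ∈ T̃*}` bijectively onto `H₀`. By definiteness each such `x` is the class of exactly one
solution of the homogeneous system. The solution operator `v_τ` is therefore the inverse of `Γ̃₀`,
which gives its existence and uniqueness, the `γ`-field and the Weyl function. The integral formula
for `m_τ` is Green's identity of the triplet evaluated on the `γ`-field.
-/

noncomputable section

/-! ### Absolutely continuous functions -/

section AbsolutelyContinuous

theorem AbsolutelyContinuousOnInterval.of_dist_le {X Y : Type*} [PseudoMetricSpace X]
    [PseudoMetricSpace Y] {f : ℝ → X} {g : ℝ → Y} {a b K : ℝ}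
    (hf : AbsolutelyContinuousOnInterval f a b)
    (h : ∀ s ∈ Set.uIcc a b, ∀ t ∈ Set.uIcc a b, dist (g s) (g t) ≤ K * dist (f s) (f t)) :
    AbsolutelyContinuousOnInterval g a b := by
  unfold AbsolutelyContinuousOnInterval at hf ⊢
  refine squeeze_zero' ?_ ?_ (by simpa using hf.const_mul K)
  · exact Eventually.of_forall fun _ => Finset.sum_nonneg fun _ _ => dist_nonneg
  · rw [eventually_inf_principal]
    refine Eventually.of_forall fun p hp => ?_
    rw [Finset.mul_sum]
    exact Finset.sum_le_sum fun i hi => h _ (hp.1 i hi).1 _ (hp.1 i hi).2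

theorem IsBoundedBilinearMap.absolutelyContinuousOnInterval {E F G : Type*}
    [NormedAddCommGroup E] [NormedSpace ℝ E] [NormedAddCommGroup F] [NormedSpace ℝ F]
    [NormedAddCommGroup G] [NormedSpace ℝ G] {m : E × F → G} (hm : IsBoundedBilinearMap ℝ m)
    {f : ℝ → E} {g : ℝ → F} {a b : ℝ} (hf : AbsolutelyContinuousOnInterval f a b)
    (hg : AbsolutelyContinuousOnInterval g a b) :
    AbsolutelyContinuousOnInterval (fun t => m (f t, g t)) a b := by
  obtain ⟨C, hC⟩ := hf.exists_bound
  obtain ⟨D, hD⟩ := hg.exists_bound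
  obtain ⟨M, hM, hb⟩ := hm.bound
  unfold AbsolutelyContinuousOnInterval at hf hg ⊢
  refine squeeze_zero' ?_ ?_ (by simpa using (hg.const_mul (M * C)).add (hf.const_mul (M * D)))
  · exact Eventually.of_forall fun _ => Finset.sum_nonneg fun _ _ => dist_nonneg
  · rw [eventually_inf_principal]
    refine Eventually.of_forall fun p hp => ?_
    rw [Finset.mul_sum, Finset.mul_sum, ← Finset.sum_add_distrib]
    refine Finset.sum_le_sum fun i hi => ?_
    obtain ⟨h1, h2⟩ := hp.1 i hi
    generalize (p.2 i).1 = s at h1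
    generalize (p.2 i).2 = t at h2
    have e : m (f s, g s) - m (f t, g t) = m (f s, g s - g t) + m (f s - f t, g t) := by
      rw [hm.map_sub_right, hm.map_sub_left]; abel
    rw [dist_eq_norm, e, dist_eq_norm, dist_eq_norm]
    refine (norm_add_le _ _).trans (add_le_add ((hb _ _).trans ?_) ((hb _ _).trans ?_))
    · have := hC s h1
      gcongr
    · have := hD t h2
      rw [mul_right_comm]
      gcongr

theorem IntervalIntegrable.absolutelyContinuousOnInterval_primitive {E : Type*}
    [NormedAddCommGroup E] [NormedSpace ℝ E] {f : ℝ → E} {a b : ℝ}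
    (hf : IntervalIntegrable f volume a b) :
    AbsolutelyContinuousOnInterval (fun t => ∫ s in a..t, f s) a b := by
  refine (hf.norm.absolutelyContinuousOnInterval_intervalIntegral
    (c := a) (by simp)).of_dist_le (K := 1) fun s hs t ht => ?_
  have hsub : ∀ r ∈ Set.uIcc a b, IntervalIntegrable f volume a r := fun r hr =>
    hf.mono_set (Set.uIcc_subset_uIcc_left hr)
  rw [dist_eq_norm, dist_eq_norm, one_mul,
    intervalIntegral.integral_interval_sub_left (hsub s hs) (hsub t ht),
    intervalIntegral.integral_interval_sub_left (hsub s hs).norm (hsub t ht).norm]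
  exact intervalIntegral.norm_integral_le_abs_integral_norm

theorem AbsolutelyContinuousOnInterval.intervalIntegrable_and_integral_eq {f f' : ℝ → ℂ}
    {a b : ℝ} (hab : a ≤ b) (hf : AbsolutelyContinuousOnInterval f a b)
    (hd : ∀ᵐ t ∂volume.restrict (Set.Icc a b), HasDerivAt f (f' t) t) :
    IntervalIntegrable f' volume a b ∧ ∫ t in a..b, f' t = f b - f a := by
  have hre : AbsolutelyContinuousOnInterval (fun t => (f t).re) a b :=
    hf.of_dist_le (K := 1) fun s _ t _ => by
      rw [dist_eq_norm, dist_eq_norm, one_mul, ← Complex.sub_re]; exact Complex.abs_re_le_norm _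
  have him : AbsolutelyContinuousOnInterval (fun t => (f t).im) a b :=
    hf.of_dist_le (K := 1) fun s _ t _ => by
      rw [dist_eq_norm, dist_eq_norm, one_mul, ← Complex.sub_im]; exact Complex.abs_im_le_norm _
  have hd' : ∀ᵐ t ∂volume.restrict (Set.uIoc a b), HasDerivAt f (f' t) t := by
    rw [Set.uIoc_of_le hab]
    exact ae_mono (Measure.restrict_mono_set _ Set.Ioc_subset_Icc_self) hd
  have e : (fun t => ((deriv (fun t => (f t).re) t : ℝ) : ℂ)
      + ((deriv (fun t => (f t).im) t : ℝ) : ℂ) * Complex.I)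
      =ᵐ[volume.restrict (Set.uIoc a b)] f' := by
    filter_upwards [hd'] with t ht
    have h1 : HasDerivAt (fun t => (f t).re) (f' t).re t :=
      Complex.reCLM.hasFDerivAt.comp_hasDerivAt t ht
    have h2 : HasDerivAt (fun t => (f t).im) (f' t).im t :=
      Complex.imCLM.hasFDerivAt.comp_hasDerivAt t ht
    rw [h1.deriv, h2.deriv, Complex.re_add_im]
  have i1 : IntervalIntegrable (fun t => ((deriv (fun t => (f t).re) t : ℝ) : ℂ)) volume a b :=
    ⟨hre.intervalIntegrable_deriv.1.ofReal, hre.intervalIntegrable_deriv.2.ofReal⟩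
  have i2 : IntervalIntegrable (fun t => ((deriv (fun t => (f t).im) t : ℝ) : ℂ) * Complex.I)
      volume a b := IntervalIntegrable.mul_const
    ⟨him.intervalIntegrable_deriv.1.ofReal, him.intervalIntegrable_deriv.2.ofReal⟩ _
  refine ⟨(i1.add i2).congr_ae e, ?_⟩
  rw [intervalIntegral.integral_congr_ae_restrict e.symm, intervalIntegral.integral_add i1 i2,
    intervalIntegral.integral_mul_const, intervalIntegral.integral_ofReal,
    intervalIntegral.integral_ofReal, hre.integral_deriv_eq_sub, him.integral_deriv_eq_sub]
  apply Complex.ext <;> simp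

/-- The powers of a primitive of an integrable function satisfy the fundamental theorem of
calculus, since they are absolutely continuous. -/
theorem integral_primitive_pow_mul {f : ℝ → ℝ} {a b : ℝ} (hf : IntervalIntegrable f volume a b)
    (n : ℕ) :
    ∫ t in a..b, (∫ s in a..t, f s) ^ n * f t = (∫ s in a..b, f s) ^ (n + 1) / (n + 1) := by
  have hac : ∀ n : ℕ,
      AbsolutelyContinuousOnInterval (fun t => (∫ s in a..t, f s) ^ (n + 1)) a b := by
    intro n
    induction n with
    | zero => simpa using hf.absolutelyContinuousOnInterval_primitive
    | succ n ih =>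
      have := ih.mul hf.absolutelyContinuousOnInterval_primitive
      refine this.of_dist_le (K := 1) fun s _ t _ => ?_
      simp only [Pi.mul_apply, one_mul, ← pow_succ, le_refl]
  have h := (hac n).integral_deriv_eq_sub
  have e : ∫ t in a..b, deriv (fun t => (∫ s in a..t, f s) ^ (n + 1)) t
      = ∫ t in a..b, ((n : ℝ) + 1) * ((∫ s in a..t, f s) ^ n * f t) := by
    refine intervalIntegral.integral_congr_ae ?_
    filter_upwards [hf.ae_hasDerivAt_integral] with t ht htab
    have := ((ht (Set.uIoc_subset_uIcc htab) a (by simp)).fun_pow (n + 1)).deriv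
    rw [this]
    push_cast
    ring_nf
  rw [e, intervalIntegral.integral_const_mul] at h
  have hn : (n : ℝ) + 1 ≠ 0 := by positivity
  rw [eq_div_iff hn, mul_comm, h]
  simp

end AbsolutelyContinuous

/-- An almost everywhere property on an interval with left endpoint `a` can be checked on its
compact subintervals `[a, β]`. -/
theorem ae_restrict_of_forall_Icc {a : ℝ} {I : Set ℝ} (hI : ∀ t ∈ I, a ≤ t)
    (hI' : ∀ t ∈ I, Set.Icc a t ⊆ I) {p : ℝ → Prop}
    (h : ∀ β ∈ I, ∀ᵐ t ∂volume.restrict (Set.Icc a β), p t) :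
    ∀ᵐ t ∂volume.restrict I, p t := by
  have hsub : I ⊆ (⋃ q ∈ {q : ℚ | (q : ℝ) ∈ I}, Set.Icc a (q : ℝ)) ∪
      {t | t ∈ I ∧ ∀ s ∈ I, s ≤ t} := by
    intro t ht
    by_cases hm : ∀ s ∈ I, s ≤ t
    · exact Or.inr ⟨ht, hm⟩
    · push Not at hm
      obtain ⟨s, hs, hts⟩ := hm
      obtain ⟨q, hq, hq'⟩ := exists_rat_btwn hts
      refine Or.inl (Set.mem_biUnion (x := q) ?_ ⟨hI t ht, hq.le⟩)
      exact hI' s hs ⟨(hI t ht).trans hq.le, hq'.le⟩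
  have hnull : volume {t | t ∈ I ∧ ∀ s ∈ I, s ≤ t} = 0 := by
    refine Set.Subsingleton.measure_zero (fun x hx y hy => ?_) _
    exact le_antisymm (hy.2 x hx.1) (hx.2 y hy.1)
  suffices h' : ∀ᵐ t ∂volume.restrict ((⋃ q ∈ {q : ℚ | (q : ℝ) ∈ I}, Set.Icc a (q : ℝ)) ∪
      {t | t ∈ I ∧ ∀ s ∈ I, s ≤ t}), p t from ae_mono (Measure.restrict_mono_set _ hsub) h'
  rw [ae_restrict_union_iff, ae_restrict_biUnion_iff _ (Set.to_countable _)]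
  refine ⟨fun q hq => h q hq, ?_⟩
  rw [Measure.restrict_eq_zero.2 hnull]
  simp

/-! ### Linear differential equations with integrable coefficients -/

section LinearODE

variable {E : Type*} [NormedAddCommGroup E] [NormedSpace ℂ E]

/-- The Picard iterates of `Y = 1 + ∫_a^t A Y`. -/
def picardIterate (A : ℝ → E →L[ℂ] E) (a : ℝ) : ℕ → ℝ → E →L[ℂ] E
  | 0 => fun _ => 1
  | n + 1 => fun t => ∫ s in a..t, A s * picardIterate A a n s

variable {A : ℝ → E →L[ℂ] E} {a : ℝ}

theorem picardIterate_bound {β : ℝ} (hab : a ≤ β) (hA : IntervalIntegrable A volume a β) (n : ℕ) :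
    ContinuousOn (picardIterate A a n) (Set.Icc a β) ∧
      ∀ t ∈ Set.Icc a β, ‖picardIterate A a n t‖ ≤ (∫ s in a..t, ‖A s‖) ^ n / n.factorial := by
  have hsub : ∀ t ∈ Set.Icc a β, IntervalIntegrable A volume a t := fun t ht =>
    hA.mono_set (Set.uIcc_subset_uIcc_left (Set.uIcc_of_le hab ▸ ht))
  induction n with
  | zero =>
    refine ⟨continuousOn_const, fun t _ => ?_⟩
    simp only [picardIterate, pow_zero, Nat.factorial_zero, Nat.cast_one, div_one]
    exact ContinuousLinearMap.norm_id_le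
  | succ n ih =>
    have hint : IntervalIntegrable (fun s => A s * picardIterate A a n s) volume a β :=
      hA.mul_continuousOn (by rw [Set.uIcc_of_le hab]; exact ih.1)
    refine ⟨?_, fun t ht => ?_⟩
    · have := hint.absolutelyContinuousOnInterval_primitive.continuousOn
      rwa [Set.uIcc_of_le hab] at this
    · have hα : IntervalIntegrable (fun s => ‖A s‖) volume a t := (hsub t ht).norm
      have hαc : ContinuousOn (fun s => (∫ r in a..s, ‖A r‖) ^ n) (Set.uIcc a t) :=
        hα.absolutelyContinuousOnInterval_primitive.continuousOn.pow n
      have hb : ‖picardIterate A a (n + 1) t‖ ≤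
          ∫ s in a..t, ((n.factorial : ℝ)⁻¹ * ((∫ r in a..s, ‖A r‖) ^ n * ‖A s‖)) := by
        refine intervalIntegral.norm_integral_le_of_norm_le ht.1 (Eventually.of_forall ?_) ?_
        · intro s hs
          refine (norm_mul_le _ _).trans ?_
          have := ih.2 s ⟨hs.1.le, hs.2.trans ht.2⟩
          calc ‖A s‖ * ‖picardIterate A a n s‖
              ≤ ‖A s‖ * ((∫ r in a..s, ‖A r‖) ^ n / n.factorial) := by gcongr
            _ = _ := by ring
        · exact ((hα.continuousOn_mul hαc)).const_mul _
      refine hb.trans (le_of_eq ?_)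
      rw [intervalIntegral.integral_const_mul, integral_primitive_pow_mul hα, Nat.factorial_succ]
      push_cast
      field_simp

/-- A fundamental solution `Y` of `Y' = A Y`, `Y(a) = 1`, in integrated form. It is the sum of the
Picard iterates, which converges since the `n`-th iterate is at most `(∫ ‖A‖)ⁿ / n!`. -/
theorem exists_fundamental_solution [CompleteSpace E] {I : Set ℝ} (hI : ∀ t ∈ I, a ≤ t)
    (hA : ∀ β ∈ I, IntervalIntegrable A volume a β) :
    ∃ Y : ℝ → E →L[ℂ] E, Y a = 1 ∧ ∀ β ∈ I,
      IntervalIntegrable (fun s => A s * Y s) volume a β ∧ Y β = 1 + ∫ s in a..β, A s * Y s := by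
  refine ⟨fun t => ∑' n, picardIterate A a n t, ?_, fun β hβ => ?_⟩
  · beta_reduce
    rw [tsum_eq_single 0]
    · rfl
    · intro n hn
      obtain ⟨m, rfl⟩ := Nat.exists_eq_succ_of_ne_zero hn
      exact intervalIntegral.integral_same
  have hab := hI β hβ
  have hAβ := hA β hβ
  set C := ∫ s in a..β, ‖A s‖ with hC
  have hb : ∀ n, ∀ t ∈ Set.Icc a β, ‖picardIterate A a n t‖ ≤ C ^ n / n.factorial := by
    intro n t ht
    refine ((picardIterate_bound hab hAβ n).2 t ht).trans ?_
    have h0 : 0 ≤ ∫ s in a..t, ‖A s‖ :=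
      intervalIntegral.integral_nonneg ht.1 fun _ _ => norm_nonneg _
    have h1 : ∫ s in a..t, ‖A s‖ ≤ C :=
      intervalIntegral.integral_mono_interval le_rfl ht.1 ht.2
        (Eventually.of_forall fun _ => norm_nonneg _) hAβ.norm
    gcongr
  have hsC : Summable fun n : ℕ => C ^ n / n.factorial := Real.summable_pow_div_factorial C
  have hsum : ∀ t ∈ Set.Icc a β, HasSum (fun n => picardIterate A a n t)
      (∑' n, picardIterate A a n t) := fun t ht =>
    (Summable.of_norm_bounded hsC fun n => hb n t ht).hasSum
  have hint : ∀ n, IntervalIntegrable (fun s => A s * picardIterate A a n s) volume a β :=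
    fun n => hAβ.mul_continuousOn
      (by rw [Set.uIcc_of_le hab]; exact (picardIterate_bound hab hAβ n).1)
  have huIoc : Set.uIoc a β ⊆ Set.Icc a β := by
    rw [Set.uIoc_of_le hab]; exact Set.Ioc_subset_Icc_self
  have hbd : ∀ n, ∀ t ∈ Set.uIoc a β,
      ‖A t * picardIterate A a n t‖ ≤ ‖A t‖ * (C ^ n / n.factorial) := fun n t ht =>
    (norm_mul_le _ _).trans (by have := hb n t (huIoc ht); gcongr)
  have hs2 : ∀ t ∈ Set.uIoc a β, HasSum (fun n => A t * picardIterate A a n t)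
      (A t * ∑' n, picardIterate A a n t) := fun t ht => (hsum t (huIoc ht)).mul_left _
  have key := intervalIntegral.hasSum_integral_of_dominated_convergence (μ := volume) (a := a)
    (b := β) (F := fun n s => A s * picardIterate A a n s)
    (f := fun s => A s * ∑' n, picardIterate A a n s)
    (fun n t => ‖A t‖ * (C ^ n / n.factorial))
    (fun n => (hint n).aestronglyMeasurable_restrict_uIoc)
    (fun n => Eventually.of_forall fun t ht => hbd n t ht)
    (Eventually.of_forall fun t _ => hsC.mul_left _)
    (by simp only [tsum_mul_left]; exact hAβ.norm.mul_const _)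
    (Eventually.of_forall fun t ht => hs2 t ht)
  refine ⟨?_, ?_⟩
  · rw [intervalIntegrable_iff]
    have hdom : IntegrableOn (fun t => ‖A t‖ * ∑' n : ℕ, C ^ n / n.factorial) (Set.uIoc a β) :=
      intervalIntegrable_iff.1 (hAβ.norm.mul_const _)
    refine Integrable.mono' hdom ?_ ?_
    · refine aestronglyMeasurable_of_tendsto_ae atTop
        (f := fun (m : ℕ) s => ∑ n ∈ Finset.range m, A s * picardIterate A a n s) (fun m => ?_) ?_
      · exact Finset.aestronglyMeasurable_fun_sum _ fun n _ =>
          (hint n).aestronglyMeasurable_restrict_uIoc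
      · exact (ae_restrict_iff' measurableSet_uIoc).2
          (Eventually.of_forall fun t ht => (hs2 t ht).tendsto_sum_nat)
    · refine (ae_restrict_iff' measurableSet_uIoc).2 (Eventually.of_forall fun t ht => ?_)
      rw [← (hs2 t ht).tsum_eq, ← tsum_mul_left]
      exact tsum_of_norm_bounded (hsC.mul_left _).hasSum fun n => hbd n t ht
  · have h1 : HasSum (fun n => picardIterate A a (n + 1) β)
        (∫ s in a..β, A s * ∑' n, picardIterate A a n s) := key
    have h2 := (hasSum_nat_add_iff' 1).2 (hsum β ⟨hab, le_rfl⟩)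
    have h3 := h1.unique h2
    rw [h3]
    simp [picardIterate]

end LinearODE

/-! ### Positive operators in finite dimensions -/

section Positive

variable {E : Type*} [NormedAddCommGroup E] [InnerProductSpace ℂ E]

namespace ContinuousLinearMap.IsPositive

variable {T : E →L[ℂ] E}

theorem inner_self_eq_ofReal (hT : T.IsPositive) (x : E) :
    inner ℂ x (T x) = ((RCLike.re (inner ℂ x (T x)) : ℝ) : ℂ) := by
  have h : conj (inner ℂ x (T x)) = inner ℂ x (T x) := by
    rw [inner_conj_symm]; exact hT.isSymmetric x x
  exact (RCLike.conj_eq_iff_re.1 h).symm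

/-- Positivity of the form at `x - c T x` with `c = (1 + ‖T‖)⁻¹` bounds `‖T x‖²` by the form
at `x`. -/
theorem norm_apply_sq_le (hT : T.IsPositive) (x : E) :
    (1 + ‖T‖)⁻¹ * ‖T x‖ ^ 2 ≤ RCLike.re (inner ℂ x (T x)) := by
  set c : ℝ := (1 + ‖T‖)⁻¹ with hc
  have hpos : 0 < 1 + ‖T‖ := by positivity
  have hc0 : 0 < c := by positivity
  have hc1 : c * (1 + ‖T‖) = 1 := inv_mul_cancel₀ hpos.ne'
  have h := hT.re_inner_nonneg_right (x - (c : ℂ) • T x)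
  have h1 : inner ℂ x (T (T x)) = (‖T x‖ : ℂ) ^ 2 := by
    exact (hT.isSymmetric x (T x)).symm.trans (inner_self_eq_norm_sq_to_K (𝕜 := ℂ) (T x))
  have h2 : RCLike.re (inner ℂ (T x) (T (T x))) ≤ ‖T‖ * ‖T x‖ ^ 2 := by
    calc RCLike.re (inner ℂ (T x) (T (T x))) ≤ ‖T x‖ * ‖T (T x)‖ :=
          (RCLike.re_le_norm _).trans (norm_inner_le_norm _ _)
      _ ≤ ‖T x‖ * (‖T‖ * ‖T x‖) := by gcongr; exact T.le_opNorm _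
      _ = _ := by ring
  have hexp : inner ℂ (x - (c : ℂ) • T x) (T (x - (c : ℂ) • T x)) =
      inner ℂ x (T x) - ((2 * c * ‖T x‖ ^ 2 : ℝ) : ℂ)
        + ((c ^ 2 : ℝ) : ℂ) * inner ℂ (T x) (T (T x)) := by
    simp only [map_sub, map_smul, inner_sub_left, inner_sub_right, inner_smul_left,
      inner_smul_right, h1, inner_self_eq_norm_sq_to_K, Complex.conj_ofReal]
    push_cast
    simp only [Complex.coe_algebraMap]
    ring
  rw [hexp] at h
  simp only [map_add, map_sub, RCLike.re_to_complex, Complex.re_ofReal_mul, Complex.ofReal_re]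
    at h h2 ⊢
  have h3 : c ^ 2 * (inner ℂ (T x) (T (T x))).re ≤ c ^ 2 * (‖T‖ * ‖T x‖ ^ 2) := by gcongr
  have h4 : c * (c * ‖T‖) * ‖T x‖ ^ 2 ≤ c * 1 * ‖T x‖ ^ 2 := by
    gcongr
    nlinarith
  nlinarith

variable [FiniteDimensional ℂ E]

theorem apply_starProjection (T : E →L[ℂ] E) (x : E) :
    T ((LinearMap.ker T.toLinearMap)ᗮ.starProjection x) = T x := by
  have h := Submodule.sub_starProjection_mem_orthogonal (K := (LinearMap.ker T.toLinearMap)ᗮ) x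
  rw [Submodule.orthogonal_orthogonal] at h
  have h' : T (x - (LinearMap.ker T.toLinearMap)ᗮ.starProjection x) = 0 := h
  rw [map_sub, sub_eq_zero] at h'
  exact h'.symm

/-- On the orthogonal complement of its kernel, a positive operator is bounded from below. -/
theorem exists_norm_starProjection_sq_le (hT : T.IsPositive) :
    ∃ C : ℝ, 1 ≤ C ∧ ∀ x, ‖(LinearMap.ker T.toLinearMap)ᗮ.starProjection x‖ ^ 2 ≤
      C * RCLike.re (inner ℂ x (T x)) := by
  set K := (LinearMap.ker T.toLinearMap)ᗮ with hK
  have hinj : LinearMap.ker (T.toLinearMap ∘ₗ K.subtype) = ⊥ := by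
    rw [LinearMap.ker_eq_bot']
    intro x hx
    have h1 : (x : E) ∈ LinearMap.ker T.toLinearMap := hx
    have h2 := Submodule.inner_right_of_mem_orthogonal h1 x.2
    exact Subtype.ext (inner_self_eq_zero.1 h2)
  obtain ⟨M, -, hM⟩ := LinearMap.exists_antilipschitzWith _ hinj
  refine ⟨max 1 ((M : ℝ) ^ 2 * (1 + ‖T‖)), le_max_left _ _, fun x => ?_⟩
  have h1 : ‖K.starProjection x‖ ≤ M * ‖T x‖ := by
    have := hM.le_mul_dist (⟨K.starProjection x, Submodule.starProjection_apply_mem K x⟩ : K) 0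
    simp only [dist_zero_right, map_zero] at this
    refine this.trans (le_of_eq ?_)
    congr 2
    exact apply_starProjection T x
  have h2 := hT.norm_apply_sq_le x
  have h0 := hT.re_inner_nonneg_right x
  have hpos : 0 < 1 + ‖T‖ := by positivity
  rw [inv_mul_le_iff₀ hpos] at h2
  calc ‖K.starProjection x‖ ^ 2 ≤ (M * ‖T x‖) ^ 2 := by gcongr
    _ = (M : ℝ) ^ 2 * ‖T x‖ ^ 2 := by ring
    _ ≤ (M : ℝ) ^ 2 * ((1 + ‖T‖) * RCLike.re (inner ℂ x (T x))) := by gcongr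
    _ = (M : ℝ) ^ 2 * (1 + ‖T‖) * RCLike.re (inner ℂ x (T x)) := by ring
    _ ≤ _ := by gcongr; exact le_max_right _ _

/-- The iterates of `1 - c T` with `c = (1 + ‖T‖)⁻¹` converge to the orthogonal projection onto
the kernel of `T`. This exhibits the projection as a measurable function of `T`. -/
theorem tendsto_iterate (hT : T.IsPositive) (x : E) :
    Tendsto (fun m : ℕ => x - ((1 - (((1 + ‖T‖)⁻¹ : ℝ) : ℂ) • T) ^ m) x) atTop
      (𝓝 ((LinearMap.ker T.toLinearMap)ᗮ.starProjection x)) := by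
  obtain ⟨C, hC1, hC⟩ := hT.exists_norm_starProjection_sq_le
  set K := (LinearMap.ker T.toLinearMap)ᗮ with hK
  set c : ℝ := (1 + ‖T‖)⁻¹ with hc
  set R := 1 - (c : ℂ) • T with hR
  have hc0 : 0 < c := by positivity
  have hc1 : c ≤ 1 := inv_le_one_of_one_le₀ (by linarith [norm_nonneg T])
  have hCpos : 0 < C := by linarith
  set ρ := 1 - c / C with hρ
  have hcC : 0 < c / C := by positivity
  have hcC1 : c / C ≤ 1 := (div_le_one hCpos).2 (hc1.trans hC1)
  have hker : ∀ y, T y = 0 → R y = y := fun y hy => by simp [hR, hy]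
  have hmem : ∀ y ∈ K, R y ∈ K := by
    intro y hy
    refine K.sub_mem hy (K.smul_mem _ ?_)
    rw [hK, Submodule.mem_orthogonal]
    intro z hz
    have hz' : T z = 0 := hz
    refine (hT.isSymmetric z y).symm.trans ?_
    change inner ℂ (T z) y = 0
    rw [hz', inner_zero_left]
  have hcontr : ∀ y ∈ K, ‖R y‖ ^ 2 ≤ ρ * ‖y‖ ^ 2 := by
    intro y hy
    have h1 := hC y
    rw [Submodule.starProjection_eq_self_iff.2 hy] at h1
    have h2 := hT.norm_apply_sq_le y
    have h3 : ‖R y‖ ^ 2 = ‖y‖ ^ 2 - 2 * (c * RCLike.re (inner ℂ y (T y))) + c ^ 2 * ‖T y‖ ^ 2 := by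
      change ‖y - (c : ℂ) • T y‖ ^ 2 = _
      rw [@norm_sub_sq ℂ, inner_smul_right, norm_smul]
      simp only [RCLike.re_to_complex, Complex.re_ofReal_mul, Complex.norm_real,
        Real.norm_eq_abs, mul_pow, sq_abs]
    have h4 : c * (c * ‖T y‖ ^ 2) ≤ c * RCLike.re (inner ℂ y (T y)) := by gcongr
    have h5 : c / C * ‖y‖ ^ 2 ≤ c * RCLike.re (inner ℂ y (T y)) := by
      rw [div_mul_eq_mul_div, div_le_iff₀ hCpos]
      nlinarith
    rw [h3, hρ]
    nlinarith
  set y := K.starProjection x with hy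
  have hyK : y ∈ K := Submodule.starProjection_apply_mem K x
  have hpow : ∀ m : ℕ, (R ^ m) y ∈ K ∧ ‖(R ^ m) y‖ ^ 2 ≤ ρ ^ m * ‖y‖ ^ 2 := by
    intro m
    induction m with
    | zero => simpa using hyK
    | succ m ih =>
      rw [pow_succ']
      refine ⟨hmem _ ih.1, (hcontr _ ih.1).trans ?_⟩
      rw [pow_succ' ρ, mul_assoc]
      have : 0 ≤ ρ := by rw [hρ]; linarith
      exact mul_le_mul_of_nonneg_left ih.2 this
  have hfix : ∀ m : ℕ, (R ^ m) (x - y) = x - y := by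
    intro m
    induction m with
    | zero => simp
    | succ m ih =>
      rw [pow_succ']
      change R ((R ^ m) (x - y)) = _
      rw [ih]
      refine hker _ ?_
      rw [map_sub, sub_eq_zero]
      exact (apply_starProjection T x).symm
  have h0 : Tendsto (fun m : ℕ => (R ^ m) y) atTop (𝓝 0) := by
    rw [tendsto_zero_iff_norm_tendsto_zero]
    have hlim : Tendsto (fun m : ℕ => ρ ^ m * ‖y‖ ^ 2) atTop (𝓝 0) := by
      simpa using (tendsto_pow_atTop_nhds_zero_of_lt_one (by rw [hρ]; linarith)
        (by rw [hρ]; linarith)).mul_const (‖y‖ ^ 2)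
    have := squeeze_zero (fun m => by positivity) (fun m => (hpow m).2) hlim
    simpa using this.sqrt
  have := (tendsto_const_nhds (x := y)).sub h0
  rw [sub_zero] at this
  refine this.congr fun m => ?_
  have e : (R ^ m) x = (R ^ m) (x - y) + (R ^ m) y := by rw [← map_add, sub_add_cancel]
  rw [e, hfix]
  abel

end ContinuousLinearMap.IsPositive

end Positive

/-! ### Completeness of the space `L²_Δ` -/

namespace SymmetricSystem

variable {H Hh : Type*} [NormedAddCommGroup H] [InnerProductSpace ℂ H] [FiniteDimensional ℂ H]
  [NormedAddCommGroup Hh] [InnerProductSpace ℂ Hh] [FiniteDimensional ℂ Hh]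
variable (S : SymmetricSystem H Hh)

variable {S} in
/-- The element of `𝓛²_Δ` given by a function. -/
def L2Fun.mk (f : ℝ → SpaceHH H Hh) (hf : S.MemL2 f) : S.L2Fun := ⟨f, hf⟩

theorem L2Fun.inner_def (f g : S.L2Fun) :
    inner ℂ f g = ∫ t in S.I, inner ℂ (f.1 t) (S.Δ t (g.1 t)) := rfl

theorem L2Fun.lintegral_energy (f : S.L2Fun) :
    ∫⁻ t in S.I, ENNReal.ofReal (RCLike.re (inner ℂ (f.1 t) (S.Δ t (f.1 t)))) =
      ENNReal.ofReal (‖f‖ ^ 2) := by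
  have hint := MemL2.integrableOn_inner f.2 f.2
  rw [@norm_sq_eq_re_inner ℂ, L2Fun.inner_def, ← integral_re hint,
    ofReal_integral_eq_lintegral_ofReal hint.re]
  filter_upwards [S.Δ_pos] with t ht
  exact ht.re_inner_nonneg_right _

variable {S} in
theorem aestronglyMeasurable_Δ_apply {f : ℝ → SpaceHH H Hh}
    (hf : AEStronglyMeasurable f (volume.restrict S.I)) :
    AEStronglyMeasurable (fun t => S.Δ t (f t)) (volume.restrict S.I) :=
  isBoundedBilinearMap_apply.continuous.comp_aestronglyMeasurable₂ S.Δ_meas hf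

variable {S} in
theorem memL2_of_lintegral_lt_top {f : ℝ → SpaceHH H Hh}
    (hf : StronglyMeasurable (S.I.domRestrict f))
    (hf' : AEStronglyMeasurable f (volume.restrict S.I))
    (h : ∫⁻ t in S.I, ENNReal.ofReal (RCLike.re (inner ℂ (f t) (S.Δ t (f t)))) < ⊤) :
    S.MemL2 f := by
  refine ⟨hf, hf'.inner (aestronglyMeasurable_Δ_apply hf'), ?_⟩
  refine lt_of_le_of_lt (lintegral_mono_ae ?_) h
  filter_upwards [S.Δ_pos] with t ht
  have h0 := ht.re_inner_nonneg_right (f t)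
  rw [← ofReal_norm]
  conv_lhs => rw [ht.inner_self_eq_ofReal, Complex.norm_real, Real.norm_of_nonneg h0]

/-- The orthogonal projections onto the ranges of `Δ(t)` preserve measurability. -/
theorem aestronglyMeasurable_starProjection {f : ℝ → SpaceHH H Hh}
    (hf : AEStronglyMeasurable f (volume.restrict S.I)) :
    AEStronglyMeasurable (fun t => (LinearMap.ker (S.Δ t).toLinearMap)ᗮ.starProjection (f t))
      (volume.restrict S.I) := by
  have hpow : ∀ m : ℕ, AEStronglyMeasurable
      (fun t => ((1 - (((1 + ‖S.Δ t‖)⁻¹ : ℝ) : ℂ) • S.Δ t) ^ m) (f t)) (volume.restrict S.I) := by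
    intro m
    induction m with
    | zero => simpa using hf
    | succ m ih =>
      have hc : AEStronglyMeasurable (fun t => (((1 + ‖S.Δ t‖)⁻¹ : ℝ) : ℂ))
          (volume.restrict S.I) :=
        Complex.continuous_ofReal.comp_aestronglyMeasurable
          ((S.Δ_meas.norm.const_add 1).aemeasurable.inv.aestronglyMeasurable)
      refine (ih.sub (hc.smul (aestronglyMeasurable_Δ_apply ih))).congr
        (Eventually.of_forall fun t => ?_)
      simp only [pow_succ']
      rfl
  refine aestronglyMeasurable_of_tendsto_ae atTop (fun m => hf.sub (hpow m)) ?_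
  filter_upwards [S.Δ_pos] with t ht
  exact ht.tendsto_iterate (f t)

/-- The semi-Hilbert space `𝓛²_Δ` is complete. For a rapidly Cauchy sequence the projections of the
values onto the ranges of `Δ(t)` converge almost everywhere, and Fatou's lemma shows that their
limit is the limit of the sequence. -/
instance : CompleteSpace S.L2Fun := by
  refine Metric.complete_of_convergent_controlled_sequences (fun n => (1 / 2 : ℝ) ^ n)
    (fun n => by positivity) fun u hu => ?_
  let e : ℝ → SpaceHH H Hh → ℝ := fun t x => RCLike.re (inner ℂ x (S.Δ t x))
  let P : ℝ → SpaceHH H Hh →L[ℂ] SpaceHH H Hh := fun t =>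
    (LinearMap.ker (S.Δ t).toLinearMap)ᗮ.starProjection
  have hm : ∀ n, AEStronglyMeasurable (u n).1 (volume.restrict S.I) := fun n =>
    MemL2.aestronglyMeasurable (u n).2
  have hme : ∀ f : ℝ → SpaceHH H Hh, AEStronglyMeasurable f (volume.restrict S.I) →
      AEMeasurable (fun t => ENNReal.ofReal (e t (f t))) (volume.restrict S.I) := fun f hf =>
    (Complex.continuous_re.comp_aestronglyMeasurable
      (hf.inner (aestronglyMeasurable_Δ_apply hf))).aemeasurable.ennreal_ofReal
  have hlint : ∀ N n, N ≤ n → ∫⁻ t in S.I, ENNReal.ofReal (e t ((u n).1 t - (u N).1 t)) ≤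
      ENNReal.ofReal ((1 / 4 : ℝ) ^ N) := by
    intro N n hn
    refine (L2Fun.lintegral_energy S (u n - u N)).le.trans (ENNReal.ofReal_le_ofReal ?_)
    have := (hu N n N hn le_rfl).le
    rw [dist_eq_norm] at this
    calc ‖u n - u N‖ ^ 2 ≤ ((1 / 2 : ℝ) ^ N) ^ 2 := by gcongr
      _ = (1 / 4 : ℝ) ^ N := by rw [← pow_mul, mul_comm, pow_mul]; norm_num
  -- almost everywhere the energies of the increments are `O(2⁻ⁿ)`
  have hsum : ∀ᵐ t ∂volume.restrict S.I, ∃ D : ℝ, ∀ n,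
      e t ((u (n + 1)).1 t - (u n).1 t) ≤ D * (1 / 2 : ℝ) ^ n := by
    have hms : ∀ n : ℕ, AEMeasurable (fun t => ENNReal.ofReal ((2 : ℝ) ^ n) *
        ENNReal.ofReal (e t ((u (n + 1)).1 t - (u n).1 t))) (volume.restrict S.I) := fun n =>
      (hme _ ((hm (n + 1)).sub (hm n))).const_mul _
    have hfin : ∫⁻ t in S.I, ∑' n : ℕ, ENNReal.ofReal ((2 : ℝ) ^ n) *
        ENNReal.ofReal (e t ((u (n + 1)).1 t - (u n).1 t)) ≠ ⊤ := by
      rw [lintegral_tsum hms]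
      have hle : ∀ n : ℕ, ∫⁻ t in S.I, ENNReal.ofReal ((2 : ℝ) ^ n) *
          ENNReal.ofReal (e t ((u (n + 1)).1 t - (u n).1 t)) ≤
          ENNReal.ofReal ((1 / 2 : ℝ) ^ n) := by
        intro n
        refine (lintegral_const_mul'' _ (hme _ ((hm (n + 1)).sub (hm n)))).le.trans ?_
        calc _ ≤ ENNReal.ofReal ((2 : ℝ) ^ n) * ENNReal.ofReal ((1 / 4 : ℝ) ^ n) := by
              gcongr; exact hlint n (n + 1) (Nat.le_succ n)
          _ = _ := by
              rw [← ENNReal.ofReal_mul (by positivity), ← mul_pow]; norm_num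
      refine ne_top_of_le_ne_top ?_ (ENNReal.tsum_le_tsum hle)
      rw [← ENNReal.ofReal_tsum_of_nonneg (fun n => by positivity)
        (summable_geometric_of_lt_one (by norm_num) (by norm_num))]
      exact ENNReal.ofReal_ne_top
    filter_upwards [ae_lt_top' (AEMeasurable.tsum hms) hfin] with t ht
    refine ⟨(∑' n : ℕ, ENNReal.ofReal ((2 : ℝ) ^ n) *
        ENNReal.ofReal (e t ((u (n + 1)).1 t - (u n).1 t))).toReal, fun n => ?_⟩
    have h1 := ENNReal.toReal_mono ht.ne (ENNReal.le_tsum (f := fun n : ℕ =>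
      ENNReal.ofReal ((2 : ℝ) ^ n) * ENNReal.ofReal (e t ((u (n + 1)).1 t - (u n).1 t))) n)
    rw [ENNReal.toReal_mul, ENNReal.toReal_ofReal (by positivity)] at h1
    have h2 : e t ((u (n + 1)).1 t - (u n).1 t) ≤
        (ENNReal.ofReal (e t ((u (n + 1)).1 t - (u n).1 t))).toReal := by
      rw [ENNReal.toReal_ofReal']; exact le_max_left _ _
    rw [div_pow, one_pow, mul_one_div, le_div_iff₀ (by positivity)]
    nlinarith [pow_pos (show (0 : ℝ) < 2 by norm_num) n]
  have hconv : ∀ᵐ t ∂volume.restrict S.I, ∃ l, Tendsto (fun n => P t ((u n).1 t)) atTop (𝓝 l) := by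
    filter_upwards [hsum, S.Δ_pos] with t ⟨D, hD⟩ ht
    obtain ⟨C, hC1, hC⟩ := ht.exists_norm_starProjection_sq_le
    have hC0 : 0 ≤ C := by linarith
    have hr : √(1 / 2 : ℝ) < 1 := by
      rw [Real.sqrt_lt' one_pos]; norm_num
    refine cauchySeq_tendsto_of_complete
      (cauchySeq_of_le_geometric (√(1 / 2 : ℝ)) (√(C * D)) hr fun n => ?_)
    rw [dist_comm, dist_eq_norm, ← map_sub]
    refine Real.le_sqrt_of_sq_le ?_ |>.trans (le_of_eq ?_) (b := √((C * D) * (1 / 2) ^ n))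
    · refine (hC _).trans ?_
      rw [mul_assoc]
      exact mul_le_mul_of_nonneg_left (hD n) hC0
    · rw [Real.sqrt_mul' _ (by positivity), Real.sqrt_eq_rpow, Real.sqrt_eq_rpow,
        Real.sqrt_eq_rpow, ← Real.rpow_natCast, ← Real.rpow_natCast, ← Real.rpow_mul (by norm_num),
        ← Real.rpow_mul (by norm_num), mul_comm (n : ℝ)]
  obtain ⟨f, hf, hlim⟩ := exists_stronglyMeasurable_limit_of_tendsto_ae
    (fun n => S.aestronglyMeasurable_starProjection (hm n)) hconv
  -- Fatou's lemma
  have hfatou : ∀ N, ∫⁻ t in S.I, ENNReal.ofReal (e t (f t - (u N).1 t)) ≤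
      ENNReal.ofReal ((1 / 4 : ℝ) ^ N) := by
    intro N
    have h1 : ∫⁻ t in S.I, ENNReal.ofReal (e t (f t - (u N).1 t)) ≤
        ∫⁻ t in S.I, liminf (fun n => ENNReal.ofReal (e t ((u n).1 t - (u N).1 t))) atTop := by
      refine lintegral_mono_ae ?_
      filter_upwards [hlim, S.Δ_pos] with t ht hpos
      refine le_of_eq (Tendsto.liminf_eq ?_).symm
      refine ENNReal.tendsto_ofReal ?_
      have hPe : ∀ x y, e t (P t x - y) = e t (x - y) := by
        intro x y
        have hT : S.Δ t (P t x - y) = S.Δ t (x - y) := by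
          rw [map_sub, map_sub]
          congr 1
          exact ContinuousLinearMap.IsPositive.apply_starProjection (S.Δ t) x
        change RCLike.re (inner ℂ (P t x - y) (S.Δ t (P t x - y))) =
          RCLike.re (inner ℂ (x - y) (S.Δ t (x - y)))
        rw [hT]
        congr 1
        rw [← show inner ℂ (S.Δ t (P t x - y)) (x - y) = inner ℂ (P t x - y) (S.Δ t (x - y)) from
          hpos.isSymmetric _ _, hT]
        exact hpos.isSymmetric _ _
      have hc : Continuous (e t) := by
        exact Complex.continuous_re.comp (continuous_id.inner (S.Δ t).continuous)
      have := (hc.tendsto _).comp (ht.sub_const ((u N).1 t))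
      refine this.congr fun n => ?_
      exact hPe _ _
    refine h1.trans ((lintegral_liminf_le' fun n => hme _ ((hm n).sub (hm N))).trans ?_)
    refine liminf_le_of_le (by isBoundedDefault) fun b hb => ?_
    obtain ⟨n, hn⟩ := (hb.and (eventually_ge_atTop N)).exists
    exact hn.1.trans (hlint N n hn.2)
  have hsub : ∀ N, S.MemL2 (f - (u N).1) := fun N => by
    refine memL2_of_lintegral_lt_top ?_ (hf.aestronglyMeasurable.sub (hm N))
      (lt_of_le_of_lt (hfatou N) ENNReal.ofReal_lt_top)
    exact (hf.comp_measurable measurable_subtype_coe).sub (u N).2.1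
  have hfm : S.MemL2 f := by
    have := S.l2.add_mem (hsub 0) (u 0).2
    rwa [sub_add_cancel] at this
  refine ⟨L2Fun.mk f hfm, tendsto_iff_norm_sub_tendsto_zero.2 ?_⟩
  refine squeeze_zero (fun _ => norm_nonneg _) (g := fun n => (1 / 2 : ℝ) ^ n) (fun N => ?_)
    (tendsto_pow_atTop_nhds_zero_of_lt_one (by norm_num) (by norm_num))
  have h := (L2Fun.lintegral_energy S (L2Fun.mk f hfm - u N)).symm.le.trans (hfatou N)
  rw [ENNReal.ofReal_le_ofReal_iff (by positivity)] at h
  rw [norm_sub_rev]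
  refine le_of_sq_le_sq ?_ (by positivity)
  refine h.trans (le_of_eq ?_)
  rw [← pow_mul, mul_comm, pow_mul]
  norm_num

end SymmetricSystem

/-! ### Boundary triplets in a Hilbert space -/

section BoundaryTriplet

variable {E K : Type*} [NormedAddCommGroup E] [InnerProductSpace ℂ E]
  [NormedAddCommGroup K] [InnerProductSpace ℂ K]

theorem Submodule.isClosed_adjoint (A : Submodule ℂ (E × E)) :
    IsClosed (A.adjoint : Set (E × E)) := by
  have e : (A.adjoint : Set (E × E)) =
      ⋂ p ∈ A, {x : E × E | inner ℂ p.2 x.1 - inner ℂ p.1 x.2 = 0} := by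
    ext x
    simp only [SetLike.mem_coe, Submodule.mem_adjoint_iff, Set.mem_iInter, Prod.forall]
    rfl
  rw [e]
  refine isClosed_biInter fun p _ => isClosed_eq ?_ continuous_const
  fun_prop

theorem Submodule.adjoint_anti {A B : Submodule ℂ (E × E)} (h : A ≤ B) :
    B.adjoint ≤ A.adjoint := by
  intro x hx
  rw [Submodule.mem_adjoint_iff] at hx ⊢
  exact fun a b hab => hx a b (h hab)

/-- A symmetric relation satisfies `|Im z| ‖f‖ ≤ ‖f' - z f‖`. -/
theorem IsSymmetricRelation.norm_le {A : Submodule ℂ (E × E)} (hA : IsSymmetricRelation A)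
    (z : ℂ) {p : E × E} (hp : p ∈ A) : |z.im| * ‖p.1‖ ≤ ‖p.2 - z • p.1‖ := by
  have h := (Submodule.mem_adjoint_iff _ _).1 (hA hp) p.1 p.2 hp
  have h1 : (inner ℂ p.1 p.2).im = 0 := by
    have := inner_conj_symm (𝕜 := ℂ) p.2 p.1
    rw [← sub_eq_zero.1 h] at this
    have h2 := congrArg Complex.im this
    rw [← inner_conj_symm, sub_eq_zero.1 h, Complex.conj_im]
    rw [sub_eq_zero.1 h, Complex.conj_im] at h2
    linarith
  have h2 : (inner ℂ p.1 (p.2 - z • p.1)).im = -(z.im * ‖p.1‖ ^ 2) := by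
    rw [inner_sub_right, inner_smul_right, inner_self_eq_norm_sq_to_K, Complex.sub_im, h1]
    simp only [Complex.coe_algebraMap, ← Complex.ofReal_pow, Complex.im_mul_ofReal]
    ring
  have h3 : |z.im| * ‖p.1‖ ^ 2 ≤ ‖p.1‖ * ‖p.2 - z • p.1‖ := by
    calc |z.im| * ‖p.1‖ ^ 2 = |(inner ℂ p.1 (p.2 - z • p.1)).im| := by
          rw [h2, abs_neg, abs_mul, abs_of_nonneg (sq_nonneg ‖p.1‖)]
      _ ≤ _ := (Complex.abs_im_le_norm _).trans (norm_inner_le_norm _ _)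
  rcases (norm_nonneg p.1).eq_or_lt with h0 | h0
  · rw [← h0, mul_zero]; exact norm_nonneg _
  · refine le_of_mul_le_mul_left ?_ h0
    linarith

variable {A : Submodule ℂ (E × E)} {G0 G1 : A.adjoint →ₗ[ℂ] K}

/-- The restriction `ker Γ₀` of `A*` is a self-adjoint relation. -/
theorem IsOrdinaryBoundaryTriplet.adjoint_ker (hA : IsOrdinaryBoundaryTriplet A G0 G1) :
    ((LinearMap.ker G0).map A.adjoint.subtype).adjoint =
      (LinearMap.ker G0).map A.adjoint.subtype := by
  set A0 := (LinearMap.ker G0).map A.adjoint.subtype with hA0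
  have hmem : ∀ (f : A.adjoint), G0 f = 0 → (f : E × E) ∈ A0 := fun f hf => ⟨f, hf, rfl⟩
  have hle : A ≤ A0 := by
    intro f hf
    obtain ⟨g, hg⟩ := hA.surjective (0, G0 ⟨f, hA.symmetric hf⟩)
    obtain ⟨hg0, hg1⟩ := Prod.ext_iff.1 hg
    have h := hA.green ⟨f, hA.symmetric hf⟩ g
    simp only at hg0 hg1
    have h2 := (Submodule.mem_adjoint_iff _ _).1 g.2 f.1 f.2 hf
    rw [hg0, hg1, inner_zero_left, zero_sub] at h
    have h3 : inner ℂ (g : E × E).1 f.2 - inner ℂ (g : E × E).2 f.1 = 0 := by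
      rw [← inner_conj_symm, ← inner_conj_symm (g : E × E).2, ← map_sub, h2, map_zero]
    exact hmem _ (inner_self_eq_zero.1 (neg_eq_zero.1 (h.symm.trans h3)))
  refine le_antisymm (fun k hk => ?_) ?_
  · have hkA := Submodule.adjoint_anti hle hk
    obtain ⟨f, hf⟩ := hA.surjective (0, G0 ⟨k, hkA⟩)
    obtain ⟨hf0, hf1⟩ := Prod.ext_iff.1 hf
    simp only at hf0 hf1
    have h := hA.green ⟨k, hkA⟩ f
    have h2 := (Submodule.mem_adjoint_iff _ _).1 hk _ _ (hmem f hf0)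
    rw [hf0, hf1, inner_zero_left, zero_sub, ← neg_sub, neg_inj] at h
    exact hmem ⟨k, hkA⟩ (inner_self_eq_zero.1 (h.symm.trans h2))
  · rintro _ ⟨f, hf, rfl⟩
    rw [Submodule.mem_adjoint_iff]
    rintro a b ⟨g, hg, hgab⟩
    have h := hA.green f g
    rw [show G0 f = 0 from hf, show G0 g = 0 from hg, inner_zero_left, inner_zero_right] at h
    rw [show (g : E × E) = (a, b) from hgab] at h
    rw [← neg_sub, sub_self] at h
    exact (neg_eq_zero.1 h)

/-- In a Hilbert space `Γ₀` maps `{{x, z x} ∈ A*}` onto the boundary space for every non-real `z`,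
since the self-adjoint relation `ker Γ₀` has full range after subtraction of `z`. -/
theorem IsOrdinaryBoundaryTriplet.exists_eigenvector [CompleteSpace E]
    (hA : IsOrdinaryBoundaryTriplet A G0 G1) {z : ℂ} (hz : z.im ≠ 0) (h : K) :
    ∃ (x : E) (hx : (x, z • x) ∈ A.adjoint), G0 ⟨(x, z • x), hx⟩ = h := by
  have hself := hA.adjoint_ker
  set A0 := (LinearMap.ker G0).map A.adjoint.subtype with hA0
  have hsymm : IsSymmetricRelation A0 := hself.ge
  have hclosed : IsClosed (A0 : Set (E × E)) := hself ▸ Submodule.isClosed_adjoint A0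
  have : CompleteSpace A0 := hclosed.completeSpace_coe
  let φ : A0 →L[ℂ] E :=
    (ContinuousLinearMap.snd ℂ E E - z • ContinuousLinearMap.fst ℂ E E) ∘L A0.subtypeL
  have hφ : ∀ p : A0, φ p = (p : E × E).2 - z • (p : E × E).1 := fun _ => rfl
  have hzpos : 0 < |z.im| := abs_pos.2 hz
  have hanti : AntilipschitzWith (Real.toNNReal (1 + (1 + ‖z‖) * |z.im|⁻¹)) φ := by
    refine AddMonoidHomClass.antilipschitz_of_bound φ fun p => ?_
    rw [Real.coe_toNNReal _ (by positivity)]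
    have h1 : ‖(p : E × E).1‖ ≤ |z.im|⁻¹ * ‖φ p‖ := by
      rw [le_inv_mul_iff₀ hzpos]; exact hsymm.norm_le z p.2
    have h2 : ‖(p : E × E).2‖ ≤ ‖φ p‖ + ‖z‖ * ‖(p : E × E).1‖ := by
      calc ‖(p : E × E).2‖ = ‖φ p + z • (p : E × E).1‖ := by rw [hφ, sub_add_cancel]
        _ ≤ _ := (norm_add_le _ _).trans (by rw [norm_smul])
    have h3 : ‖z‖ * ‖(p : E × E).1‖ ≤ ‖z‖ * (|z.im|⁻¹ * ‖φ p‖) := by gcongr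
    change max ‖(p : E × E).1‖ ‖(p : E × E).2‖ ≤ _
    have h4 : 0 ≤ |z.im|⁻¹ * ‖φ p‖ := by positivity
    have h5 : 0 ≤ ‖z‖ * (|z.im|⁻¹ * ‖φ p‖) := by positivity
    have h6 := norm_nonneg (φ p)
    refine max_le ?_ ?_ <;> nlinarith
  have hrange : IsClosed (LinearMap.range φ.toLinearMap : Set E) :=
    hanti.isClosed_range φ.uniformContinuous
  have : CompleteSpace (LinearMap.range φ.toLinearMap) := hrange.completeSpace_coe
  have htop : LinearMap.range φ.toLinearMap = ⊤ := by
    rw [← Submodule.orthogonal_eq_bot_iff, Submodule.eq_bot_iff]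
    intro k hk
    have hk' : (k, conj z • k) ∈ A0 := by
      rw [← hself, Submodule.mem_adjoint_iff]
      intro a b hab
      have := (Submodule.mem_orthogonal _ _).1 hk _ ⟨⟨(a, b), hab⟩, rfl⟩
      change inner ℂ (b - z • a) k = 0 at this
      rw [inner_sub_left, inner_smul_left] at this
      rw [inner_smul_right]
      exact this
    have := hsymm.norm_le (conj z) hk'
    simp only [sub_self, norm_zero, Complex.conj_im, abs_neg] at this
    have h0 : ‖k‖ ≤ 0 := nonpos_of_mul_nonpos_right this hzpos
    exact norm_le_zero_iff.1 h0
  obtain ⟨f, hf⟩ := hA.surjective (h, 0)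
  have hf0 : G0 f = h := (Prod.ext_iff.1 hf).1
  obtain ⟨⟨_, w, hw, rfl⟩, hwf⟩ :
      (f : E × E).2 - z • (f : E × E).1 ∈ LinearMap.range φ.toLinearMap := htop ▸ Submodule.mem_top
  have hwf' : (w : E × E).2 - z • (w : E × E).1 = (f : E × E).2 - z • (f : E × E).1 := hwf
  have heq : ((f - w : A.adjoint) : E × E) =
      ((f : E × E).1 - (w : E × E).1, z • ((f : E × E).1 - (w : E × E).1)) := by
    refine Prod.ext rfl ?_
    change (f : E × E).2 - (w : E × E).2 = _
    rw [smul_sub, sub_eq_sub_iff_sub_eq_sub, ← hwf']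
  refine ⟨(f : E × E).1 - (w : E × E).1, heq ▸ (f - w).2, ?_⟩
  have : (⟨_, heq ▸ (f - w).2⟩ : A.adjoint) = f - w := Subtype.ext heq.symm
  rw [this, map_sub, hf0, show G0 w = 0 from hw, sub_zero]

end BoundaryTriplet

/-! ### Self-adjoint pairs -/

namespace IsSelfAdjointPair

variable {Hb : Type*} [NormedAddCommGroup Hb] [InnerProductSpace ℂ Hb] [FiniteDimensional ℂ Hb]
  {C0 C1 : Hb →L[ℂ] Hb}

theorem mul_star_comm (h : IsSelfAdjointPair C0 C1) : C0 * star C1 = C1 * star C0 := by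
  have h1 : star (C1 * star C0) = C1 * star C0 := h.1
  rwa [star_mul, star_star] at h1

/-- The relation `{(x, x') | C₀ x + C₁ x' = 0}` is parametrized by `(-C₁* w, C₀* w)`. -/
theorem exists_parameter (h : IsSelfAdjointPair C0 C1) {x x' : Hb} (hx : C0 x + C1 x' = 0) :
    ∃ w, x = -(star C1) w ∧ x' = (star C0) w := by
  set P := C0 + Complex.I • C1 with hP
  set N := C0 - Complex.I • C1 with hN
  have hI : star Complex.I = -Complex.I := Complex.conj_I
  have hPs : star P = star C0 - Complex.I • star C1 := by
    rw [hP, star_add, star_smul, hI, neg_smul, ← sub_eq_add_neg]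
  have hNs : star N = star C0 + Complex.I • star C1 := by
    rw [hN, star_sub, star_smul, hI, neg_smul, sub_neg_eq_add]
  have hPN : P * star P = N * star N := by
    rw [hPs, hNs, hP, hN]
    simp only [mul_add, add_mul, mul_sub, sub_mul, smul_mul_assoc, mul_smul_comm, h.mul_star_comm,
      smul_add, smul_sub]
    abel
  obtain ⟨V, hV⟩ := h.2.2.star
  obtain ⟨Q, hQ⟩ := h.2.1
  have hV' : (V : Hb →L[ℂ] Hb) * ↑V⁻¹ = 1 := V.mul_inv
  set w := (↑V⁻¹ : Hb →L[ℂ] Hb) (x' - Complex.I • x) with hw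
  have hNw : (star N) w = x' - Complex.I • x := by
    rw [← hV, hw]
    change ((V : Hb →L[ℂ] Hb) * ↑V⁻¹) _ = _
    rw [hV']; rfl
  have hPw : (star P) w = x' + Complex.I • x := by
    have h1 : P ((star P) w) = P (x' + Complex.I • x) := by
      change (P * star P) w = _
      rw [hPN]
      change N ((star N) w) = _
      rw [hNw, hP, hN]
      have hx' : C0 x = -C1 x' := eq_neg_of_add_eq_zero_left hx
      simp only [_root_.sub_apply, _root_.add_apply,
        _root_.smul_apply, map_sub, map_add, map_smul, hx', smul_sub, smul_add,
        smul_neg, smul_smul, Complex.I_mul_I, neg_smul, one_smul]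
      abel
    have h2 := congrArg (↑Q⁻¹ : Hb →L[ℂ] Hb) h1
    have h3 : ∀ y, (↑Q⁻¹ : Hb →L[ℂ] Hb) (P y) = y := fun y => by
      rw [hP, ← hQ]
      change ((↑Q⁻¹ : Hb →L[ℂ] Hb) * Q) y = y
      rw [Q.inv_mul]; rfl
    rwa [h3, h3] at h2
  rw [hNs] at hNw
  rw [hPs] at hPw
  simp only [_root_.sub_apply, _root_.add_apply,
    _root_.smul_apply] at hNw hPw
  have hsum : (2 : ℂ) • (star C0) w = (2 : ℂ) • x' := by
    rw [two_smul, two_smul]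
    linear_combination (norm := module) hNw + hPw
  have hdiff : (2 * Complex.I) • (star C1) w = (2 * Complex.I) • (-x) := by
    rw [mul_smul, mul_smul, two_smul, two_smul, smul_neg]
    linear_combination (norm := module) hNw - hPw
  refine ⟨w, ?_, ?_⟩
  · rw [smul_right_injective Hb (by simp : (2 * Complex.I) ≠ 0) hdiff, neg_neg]
  · exact (smul_right_injective Hb (two_ne_zero : (2 : ℂ) ≠ 0) hsum).symm

/-- The relation `{(x, x') | C₀ x + C₁ x' = 0}` is symmetric. -/
theorem inner_sub_inner_eq_zero (h : IsSelfAdjointPair C0 C1) {x x' z z' : Hb}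
    (hx : C0 x + C1 x' = 0) (hz : C0 z + C1 z' = 0) : inner ℂ z' x - inner ℂ z x' = 0 := by
  obtain ⟨w, rfl, rfl⟩ := h.exists_parameter hx
  have e : inner ℂ z' (-(star C1) w) - inner ℂ z ((star C0) w) = -inner ℂ (C0 z + C1 z') w := by
    rw [ContinuousLinearMap.star_eq_adjoint, ContinuousLinearMap.star_eq_adjoint, inner_neg_right,
      ContinuousLinearMap.adjoint_inner_right, ContinuousLinearMap.adjoint_inner_right,
      inner_add_left]
    ring
  rw [e, hz, inner_zero_left, neg_zero]

/-- The relation `{(x, x') | C₀ x + C₁ x' = 0}` contains its adjoint. -/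
theorem of_forall_inner_sub_inner_eq_zero (h : IsSelfAdjointPair C0 C1) {z z' : Hb}
    (hz : ∀ x x', C0 x + C1 x' = 0 → inner ℂ z' x - inner ℂ z x' = 0) : C0 z + C1 z' = 0 := by
  rw [← inner_self_eq_zero (𝕜 := ℂ)]
  set w := C0 z + C1 z' with hw
  have h1 := hz (-(star C1) w) ((star C0) w) (by
    rw [map_neg]
    change -(C0 * star C1) w + (C1 * star C0) w = 0
    rw [h.mul_star_comm, neg_add_cancel])
  rw [ContinuousLinearMap.star_eq_adjoint, ContinuousLinearMap.star_eq_adjoint, inner_neg_right,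
    ContinuousLinearMap.adjoint_inner_right, ContinuousLinearMap.adjoint_inner_right] at h1
  calc inner ℂ w w = inner ℂ (C0 z) w + inner ℂ (C1 z') w := by
        conv_lhs => rw [hw, inner_add_left]
    _ = 0 := by linear_combination -h1

end IsSelfAdjointPair

/-! ### Fundamental solutions and variation of constants -/

section FundamentalSolution

variable {E : Type*} [NormedAddCommGroup E] [NormedSpace ℂ E]

theorem isBoundedBilinearMap_apply_complex :
    IsBoundedBilinearMap ℝ fun p : (E →L[ℂ] E) × E => p.1 p.2 where
  add_left _ _ _ := rfl
  smul_left _ _ _ := rfl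
  add_right T x y := map_add T x y
  smul_right r T x := T.map_smul_of_tower r x
  bound := ⟨1, one_pos, fun T x => by rw [one_mul]; exact T.le_opNorm x⟩

theorem HasDerivAt.clm_apply_complex {Y : ℝ → E →L[ℂ] E} {Y' : E →L[ℂ] E} {c : ℝ → E} {c' : E}
    {t : ℝ} (hY : HasDerivAt Y Y' t) (hc : HasDerivAt c c' t) :
    HasDerivAt (fun s => Y s (c s)) (Y t c' + Y' (c t)) t :=
  ((isBoundedBilinearMap_apply_complex (E := E)).hasFDerivAt (Y t, c t)).comp_hasDerivAt
    (f := fun s => (Y s, c s)) t (hY.prodMk hc)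

theorem AbsolutelyContinuousOnInterval.clm_apply_complex {Y : ℝ → E →L[ℂ] E} {c : ℝ → E}
    {a b : ℝ} (hY : AbsolutelyContinuousOnInterval Y a b)
    (hc : AbsolutelyContinuousOnInterval c a b) :
    AbsolutelyContinuousOnInterval (fun s => Y s (c s)) a b :=
  (isBoundedBilinearMap_apply_complex (E := E)).absolutelyContinuousOnInterval hY hc

/-- A locally absolutely continuous fundamental solution of `Y' = A Y`. -/
theorem exists_absolutelyContinuous_fundamental_solution [CompleteSpace E] {a : ℝ} {I : Set ℝ}
    (hI : ∀ t ∈ I, a ≤ t) (hI' : ∀ t ∈ I, Set.Icc a t ⊆ I) {A : ℝ → E →L[ℂ] E}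
    (hA : ∀ β ∈ I, IntegrableOn A (Set.Icc a β)) :
    ∃ Y : ℝ → E →L[ℂ] E, Y a = 1 ∧ (∀ β ∈ I, AbsolutelyContinuousOnInterval Y a β) ∧
      ∀ᵐ t ∂volume.restrict I, HasDerivAt Y (A t * Y t) t := by
  obtain ⟨Y, hYa, hY⟩ := exists_fundamental_solution hI fun β hβ =>
    (intervalIntegrable_iff_integrableOn_Icc_of_le (hI β hβ)).2 (hA β hβ)
  refine ⟨Y, hYa, fun β hβ => ?_, ae_restrict_of_forall_Icc hI hI' fun β hβ => ?_⟩
  · refine (hY β hβ).1.absolutelyContinuousOnInterval_primitive.of_dist_le (K := 1)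
      fun s hs t ht => ?_
    rw [Set.uIcc_of_le (hI β hβ)] at hs ht
    rw [(hY s (hI' β hβ hs)).2, (hY t (hI' β hβ ht)).2, dist_add_left, one_mul]
  · rw [ae_restrict_iff' measurableSet_Icc]
    have h1 : ∀ᵐ t : ℝ, t ≠ a := by simp [ae_iff, measure_singleton]
    have h2 : ∀ᵐ t : ℝ, t ≠ β := by simp [ae_iff, measure_singleton]
    filter_upwards [(hY β hβ).1.ae_hasDerivAt_integral, h1, h2] with t ht hta htβ htm
    have hd := (ht (Set.uIcc_of_le (hI β hβ) ▸ htm) a (by simp)).const_add (1 : E →L[ℂ] E)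
    refine hd.congr_of_eventuallyEq ?_
    filter_upwards [Ioo_mem_nhds (lt_of_le_of_ne htm.1 hta.symm) (lt_of_le_of_ne htm.2 htβ)]
      with s hs
    exact (hY s (hI' β hβ ⟨hs.1.le, hs.2.le⟩)).2

end FundamentalSolution

namespace SymmetricSystem

variable {H Hh : Type*} [NormedAddCommGroup H] [InnerProductSpace ℂ H] [FiniteDimensional ℂ H]
  [NormedAddCommGroup Hh] [InnerProductSpace ℂ Hh] [FiniteDimensional ℂ Hh]

theorem operatorJ_apply (x : SpaceHH H Hh) : operatorJ H Hh x =
    WithLp.toLp 2 (WithLp.toLp 2 (-x.snd, Complex.I • x.fst.snd), x.fst.fst) := rfl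

theorem operatorJ_operatorJ (x : SpaceHH H Hh) : operatorJ H Hh (operatorJ H Hh x) = -x := by
  refine WithLp.ofLp_injective 2 (Prod.ext (WithLp.ofLp_injective 2 (Prod.ext ?_ ?_)) ?_)
  · simp [operatorJ_apply]
  · simp [operatorJ_apply, smul_smul]
  · simp [operatorJ_apply]

theorem inner_operatorJ (x y : SpaceHH H Hh) : inner ℂ x (operatorJ H Hh y) =
    inner ℂ x.snd y.fst.fst - inner ℂ x.fst.fst y.snd
      + Complex.I * inner ℂ x.fst.snd y.fst.snd := by
  have h : inner ℂ x (operatorJ H Hh y) = inner ℂ x.fst.fst (-y.snd)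
      + inner ℂ x.fst.snd (Complex.I • y.fst.snd) + inner ℂ x.snd y.fst.fst := rfl
  rw [h, inner_neg_right, inner_smul_right]
  ring

theorem inner_operatorJ_left (x y : SpaceHH H Hh) :
    inner ℂ (operatorJ H Hh x) y = -inner ℂ x (operatorJ H Hh y) := by
  rw [← inner_conj_symm, inner_operatorJ, inner_operatorJ]
  simp only [map_add, map_sub, map_mul, inner_conj_symm, Complex.conj_I]
  ring

variable (S : SymmetricSystem H Hh)

theorem a_mem_I : S.a ∈ S.I := by
  rcases S.I_eq with h | h <;> rw [h]
  · exact ⟨le_rfl, S.a_lt_b⟩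
  · exact ⟨le_rfl, S.a_lt_b.le⟩

theorem a_le {t : ℝ} (ht : t ∈ S.I) : S.a ≤ t := by
  rcases S.I_eq with h | h <;> rw [h] at ht <;> exact ht.1

theorem Icc_subset_I {t : ℝ} (ht : t ∈ S.I) : Set.Icc S.a t ⊆ S.I := by
  intro s hs
  have hst : (s : EReal) ≤ t := EReal.coe_le_coe_iff.2 hs.2
  rcases S.I_eq with h | h <;> rw [h] at ht ⊢
  · exact ⟨hs.1, hst.trans_lt ht.2⟩
  · exact ⟨hs.1, hst.trans ht.2⟩

theorem mem_I_of_lt {t : ℝ} (ht : S.a ≤ t) (ht' : (t : EReal) < S.b) : t ∈ S.I := by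
  rcases S.I_eq with h | h <;> rw [h]
  · exact ⟨ht, ht'⟩
  · exact ⟨ht, ht'.le⟩

/-- An almost everywhere property on `I` can be checked on the segments `[a, β]` with `β < b`. -/
theorem ae_restrict_I_of_forall_lt {p : ℝ → Prop}
    (h : ∀ β, S.a ≤ β → (β : EReal) < S.b → ∀ᵐ t ∂volume.restrict (Set.Icc S.a β), p t) :
    ∀ᵐ t ∂volume.restrict S.I, p t := by
  have h1 : ∀ᵐ t ∂volume.restrict {t : ℝ | S.a ≤ t ∧ (t : EReal) < S.b}, p t :=
    ae_restrict_of_forall_Icc (a := S.a) (fun t ht => ht.1)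
      (fun t ht s hs => And.intro hs.1 ((EReal.coe_le_coe_iff.2 hs.2).trans_lt ht.2))
      fun β hβ => h β hβ.1 hβ.2
  have hsub : S.I ⊆ {t : ℝ | S.a ≤ t ∧ (t : EReal) < S.b} ∪ {t : ℝ | (t : EReal) = S.b} := by
    intro t ht
    have ha := S.a_le ht
    have hb : (t : EReal) ≤ S.b := by
      rcases S.I_eq with h | h <;> rw [h] at ht
      · exact ht.2.le
      · exact ht.2
    rcases hb.lt_or_eq with h | h
    · exact Or.inl ⟨ha, h⟩
    · exact Or.inr h
  have hnull : volume {t : ℝ | (t : EReal) = S.b} = 0 := by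
    refine Set.Subsingleton.measure_zero (fun x hx y hy => ?_) _
    exact EReal.coe_injective (hx.trans hy.symm)
  refine ae_mono (Measure.restrict_mono_set _ hsub) ?_
  change ∀ᵐ t ∂volume.restrict ({t : ℝ | S.a ≤ t ∧ (t : EReal) < S.b} ∪
    {t : ℝ | (t : EReal) = S.b}), p t
  rw [ae_restrict_union_iff]
  refine ⟨h1, ?_⟩
  rw [Measure.restrict_eq_zero.2 hnull]
  simp

variable {S}

theorem ae_Icc_of_ae {β : ℝ} (hβ : β ∈ S.I) {p : ℝ → Prop}
    (h : ∀ᵐ t ∂volume.restrict S.I, p t) : ∀ᵐ t ∂volume.restrict (Set.Icc S.a β), p t :=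
  ae_mono (Measure.restrict_mono_set _ (S.Icc_subset_I hβ)) h

theorem continuousOn_of_absolutelyContinuous {F : Type*} [NormedAddCommGroup F] {y : ℝ → F}
    (hy : ∀ β ∈ S.I, AbsolutelyContinuousOnInterval y S.a β) : ContinuousOn y S.I := by
  intro t ht
  by_cases hm : ∃ s ∈ S.I, t < s
  · obtain ⟨s, hs, hts⟩ := hm
    have hc := (hy s hs).continuousOn
    rw [Set.uIcc_of_le (S.a_le hs)] at hc
    refine (hc t ⟨S.a_le ht, hts.le⟩).mono_of_mem_nhdsWithin ?_
    filter_upwards [self_mem_nhdsWithin, mem_nhdsWithin_of_mem_nhds (Iio_mem_nhds hts)]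
      with r hr hr'
    exact ⟨S.a_le hr, le_of_lt hr'⟩
  · push Not at hm
    have hc := (hy t ht).continuousOn
    rw [Set.uIcc_of_le (S.a_le ht)] at hc
    exact (hc t ⟨S.a_le ht, le_rfl⟩).mono fun r hr => ⟨S.a_le hr, hm r hr⟩

theorem stronglyMeasurable_of_continuousOn {y : ℝ → SpaceHH H Hh} (hy : ContinuousOn y S.I) :
    StronglyMeasurable (S.I.domRestrict y) :=
  (continuousOn_iff_continuous_domRestrict.1 hy).stronglyMeasurable

theorem Solves.continuousOn {y g : ℝ → SpaceHH H Hh} (hy : S.Solves y g) : ContinuousOn y S.I :=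
  continuousOn_of_absolutelyContinuous hy.1

theorem Solves.sub {y g z h : ℝ → SpaceHH H Hh} (hy : S.Solves y g) (hz : S.Solves z h) :
    S.Solves (fun t => y t - z t) (fun t => g t - h t) := by
  refine ⟨fun β hβ => (hy.1 β hβ).sub (hz.1 β hβ), ?_⟩
  filter_upwards [hy.2, hz.2] with t ⟨d, hd, hd'⟩ ⟨e, he, he'⟩
  refine ⟨d - e, hd.sub he, ?_⟩
  rw [map_sub, map_sub, ← hd', ← he']
  abel

theorem Solves.congr {y g h : ℝ → SpaceHH H Hh} (hy : S.Solves y g)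
    (hgh : g =ᵐ[volume.restrict S.I] h) : S.Solves y h := by
  refine ⟨hy.1, ?_⟩
  filter_upwards [hy.2, hgh] with t ⟨d, hd, hd'⟩ ht
  exact ⟨d, hd, hd'.trans ht⟩

/-- Green's identity on `[a, β]`. -/
theorem Solves.green {y g z h : ℝ → SpaceHH H Hh} (hy : S.Solves y g) (hz : S.Solves z h)
    {β : ℝ} (hβ : β ∈ S.I) :
    IntervalIntegrable (fun t => inner ℂ (z t) (g t) - inner ℂ (h t) (y t)) volume S.a β ∧
    ∫ t in S.a..β, (inner ℂ (z t) (g t) - inner ℂ (h t) (y t)) =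
      inner ℂ (z β) (operatorJ H Hh (y β)) - inner ℂ (z S.a) (operatorJ H Hh (y S.a)) := by
  have hJ : AbsolutelyContinuousOnInterval (fun t => operatorJ H Hh (y t)) S.a β :=
    (hy.1 β hβ).of_dist_le (K := ‖operatorJ H Hh‖) fun s _ t _ =>
      (operatorJ H Hh).dist_le_opNorm _ _
  have hac : AbsolutelyContinuousOnInterval
      (fun t => inner ℂ (z t) (operatorJ H Hh (y t))) S.a β :=
    (isBoundedBilinearMap_inner (𝕜 := ℂ)).absolutelyContinuousOnInterval (hz.1 β hβ) hJ
  refine hac.intervalIntegrable_and_integral_eq (S.a_le hβ) ?_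
  filter_upwards [ae_Icc_of_ae hβ hy.2, ae_Icc_of_ae hβ hz.2, ae_Icc_of_ae hβ S.B_symm]
    with t ⟨d, hd, hd'⟩ ⟨e, he, he'⟩ hB
  have h1 : HasDerivAt (fun t => operatorJ H Hh (y t)) (operatorJ H Hh d) t :=
    (((operatorJ H Hh).restrictScalars ℝ).hasFDerivAt).comp_hasDerivAt t hd
  have h2 := he.inner ℂ h1
  refine h2.congr_deriv ?_
  rw [← hd', ← he', inner_sub_right, inner_sub_left, inner_operatorJ_left,
    show inner ℂ (S.B t (z t)) (y t) = inner ℂ (z t) (S.B t (y t)) from hB _ _]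
  ring

variable (S) in
/-- A `J`-unitary fundamental solution of `J Y' = B Y`. -/
theorem exists_fundamental : ∃ Y : ℝ → SpaceHH H Hh →L[ℂ] SpaceHH H Hh, Y S.a = 1 ∧
    (∀ β ∈ S.I, AbsolutelyContinuousOnInterval Y S.a β) ∧
    (∀ᵐ t ∂volume.restrict S.I, HasDerivAt Y (-(operatorJ H Hh * S.B t) * Y t) t) ∧
    (∀ c, S.Solves (fun t => Y t c) fun _ => 0) ∧
    ∀ t ∈ S.I, ∀ x, Y t (operatorJ H Hh (ContinuousLinearMap.adjoint (Y t) x)) =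
      operatorJ H Hh x := by
  obtain ⟨Y, hYa, hYac, hYd⟩ := exists_absolutelyContinuous_fundamental_solution
    (fun t ht => S.a_le ht) (fun t ht => S.Icc_subset_I ht)
    (A := fun t => -(operatorJ H Hh * S.B t)) fun β hβ => ((S.B_int β hβ).const_mul _).neg
  have hsol : ∀ c, S.Solves (fun t => Y t c) fun _ => 0 := by
    intro c
    refine ⟨fun β hβ => ?_, ?_⟩
    · refine (hYac β hβ).of_dist_le (K := ‖c‖) fun s _ t _ => ?_
      rw [dist_eq_norm, dist_eq_norm, ← _root_.sub_apply, mul_comm]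
      exact ContinuousLinearMap.le_opNorm _ _
    · filter_upwards [hYd] with t ht
      refine ⟨_, ht.clm_apply_complex (hasDerivAt_const t c), ?_⟩
      rw [map_zero, zero_add]
      change operatorJ H Hh (-operatorJ H Hh (S.B t (Y t c))) - S.B t (Y t c) = 0
      rw [map_neg, operatorJ_operatorJ, neg_neg, sub_self]
  refine ⟨Y, hYa, hYac, hYd, hsol, fun t ht => ?_⟩
  have hJu : ∀ c d, inner ℂ (Y t c) (operatorJ H Hh (Y t d)) = inner ℂ c (operatorJ H Hh d) := by
    intro c d
    have := ((hsol d).green (hsol c) ht).2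
    simp only [inner_zero_left, inner_zero_right, sub_zero, intervalIntegral.integral_zero, hYa]
      at this
    exact (sub_eq_zero.1 this.symm)
  have hadj : ∀ d, ContinuousLinearMap.adjoint (Y t) (operatorJ H Hh (Y t d)) =
      operatorJ H Hh d := fun d => ext_inner_left ℂ fun c => by
    rw [ContinuousLinearMap.adjoint_inner_right, hJu]
  have hinj : Function.Injective (Y t).toLinearMap := by
    rw [← LinearMap.ker_eq_bot, LinearMap.ker_eq_bot']
    intro d hd
    have h1 := hadj d
    rw [show Y t d = 0 from hd, map_zero, map_zero] at h1
    rw [← neg_neg d, ← operatorJ_operatorJ d, ← h1, map_zero, neg_zero]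
  have hsurj := LinearMap.injective_iff_surjective.1 hinj
  intro x
  obtain ⟨d, hd⟩ := hsurj (-operatorJ H Hh x)
  have hd' : Y t d = -operatorJ H Hh x := hd
  have hx : x = operatorJ H Hh (Y t d) := by
    rw [hd', map_neg, operatorJ_operatorJ, neg_neg]
  conv_lhs => rw [hx]
  rw [hadj, operatorJ_operatorJ, map_neg, hd', neg_neg]

/-- Variation of constants: a solution of `J z' - B z = g` with `z(a) = c`. -/
theorem solves_variation_of_constants {Y : ℝ → SpaceHH H Hh →L[ℂ] SpaceHH H Hh}
    (hYac : ∀ β ∈ S.I, AbsolutelyContinuousOnInterval Y S.a β)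
    (hYd : ∀ᵐ t ∂volume.restrict S.I, HasDerivAt Y (-(operatorJ H Hh * S.B t) * Y t) t)
    (hYJ : ∀ t ∈ S.I, ∀ x, Y t (operatorJ H Hh (ContinuousLinearMap.adjoint (Y t) x)) =
      operatorJ H Hh x) {g : ℝ → SpaceHH H Hh}
    (hg : ∀ β ∈ S.I, IntegrableOn
      (fun t => operatorJ H Hh (ContinuousLinearMap.adjoint (Y t) (g t))) (Set.Icc S.a β))
    (c : SpaceHH H Hh) :
    S.Solves (fun t => Y t (c - ∫ s in S.a..t,
      operatorJ H Hh (ContinuousLinearMap.adjoint (Y s) (g s)))) g := by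
  set w := fun s => operatorJ H Hh (ContinuousLinearMap.adjoint (Y s) (g s)) with hw
  have hint : ∀ β ∈ S.I, IntervalIntegrable w volume S.a β := fun β hβ =>
    (intervalIntegrable_iff_integrableOn_Icc_of_le (S.a_le hβ)).2 (hg β hβ)
  refine ⟨fun β hβ => ?_, ?_⟩
  · refine (hYac β hβ).clm_apply_complex
      ((hint β hβ).absolutelyContinuousOnInterval_primitive.of_dist_le (K := 1) fun s _ t _ => ?_)
    rw [dist_sub_left, one_mul]
  · have hd : ∀ᵐ t ∂volume.restrict S.I,
        HasDerivAt (fun t => c - ∫ s in S.a..t, w s) (-w t) t := by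
      refine ae_restrict_of_forall_Icc (fun t ht => S.a_le ht) (fun t ht => S.Icc_subset_I ht)
        fun β hβ => ?_
      rw [ae_restrict_iff' measurableSet_Icc]
      filter_upwards [(hint β hβ).ae_hasDerivAt_integral] with t ht htm
      exact (ht (Set.uIcc_of_le (S.a_le hβ) ▸ htm) S.a (by simp)).const_sub c
    filter_upwards [hd, hYd, ae_restrict_mem S.measurableSet_I] with t ht hYt htI
    refine ⟨_, hYt.clm_apply_complex ht, ?_⟩
    rw [map_add, map_neg, hw]
    simp only
    rw [hYJ t htI, map_neg, operatorJ_operatorJ, neg_neg]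
    set u := c - ∫ s in S.a..t, operatorJ H Hh (ContinuousLinearMap.adjoint (Y s) (g s))
    change g t + operatorJ H Hh (-operatorJ H Hh (S.B t (Y t u))) - S.B t (Y t u) = g t
    rw [map_neg, operatorJ_operatorJ, neg_neg, add_sub_cancel_right]

end SymmetricSystem

/-! ### Compactly supported elements of the maximal relation -/

namespace SymmetricSystem

variable {H Hh : Type*} [NormedAddCommGroup H] [InnerProductSpace ℂ H] [FiniteDimensional ℂ H]
  [NormedAddCommGroup Hh] [InnerProductSpace ℂ Hh] [FiniteDimensional ℂ Hh]
variable (S : SymmetricSystem H Hh)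

/-- The functions whose restrictions to the segments `[a, β] ⊆ I` belong to `𝓛²_Δ(I)` after
extension by zero. -/
def LocMemL2 (w : ℝ → SpaceHH H Hh) : Prop :=
  ∀ β ∈ S.I, S.MemL2 ((Set.Icc S.a β).indicator w)

/-- The functions in `𝓛²_Δ(I)` that vanish near the endpoint `b`. -/
def vanishingNearB : Submodule ℂ S.L2Fun where
  carrier := {f | ∃ β, S.a ≤ β ∧ (β : EReal) < S.b ∧ ∀ t ∈ S.I, β < t → f.1 t = 0}
  zero_mem' := ⟨S.a, le_rfl, S.a_lt_b, fun _ _ _ => rfl⟩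
  add_mem' := by
    rintro f g ⟨β, h1, h2, h3⟩ ⟨γ, k1, k2, k3⟩
    refine ⟨max β γ, h1.trans (le_max_left _ _), ?_, fun t ht hlt => ?_⟩
    · rcases max_choice β γ with h | h <;> rw [h] <;> assumption
    · change f.1 t + g.1 t = 0
      rw [h3 t ht ((le_max_left _ _).trans_lt hlt), k3 t ht ((le_max_right _ _).trans_lt hlt),
        add_zero]
  smul_mem' := by
    rintro c f ⟨β, h1, h2, h3⟩
    refine ⟨β, h1, h2, fun t ht hlt => ?_⟩
    change c • f.1 t = 0
    rw [h3 t ht hlt, smul_zero]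

variable {S}

theorem stronglyMeasurable_indicator {w : ℝ → SpaceHH H Hh}
    (hw : StronglyMeasurable (S.I.domRestrict w)) (β : ℝ) :
    StronglyMeasurable (S.I.domRestrict ((Set.Icc S.a β).indicator w)) :=
  hw.indicator (s := ((↑) : S.I → ℝ) ⁻¹' Set.Icc S.a β)
    (measurable_subtype_coe measurableSet_Icc)

theorem inner_Δ_indicator (w : ℝ → SpaceHH H Hh) (β : ℝ) :
    (fun t => inner ℂ ((Set.Icc S.a β).indicator w t) (S.Δ t ((Set.Icc S.a β).indicator w t))) =
      (Set.Icc S.a β).indicator fun t => inner ℂ (w t) (S.Δ t (w t)) := by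
  funext t
  by_cases ht : t ∈ Set.Icc S.a β
  · simp only [Set.indicator_of_mem ht]
  · simp only [Set.indicator_of_notMem ht, map_zero, inner_zero_right]

theorem LocMemL2.of_integrableOn {w : ℝ → SpaceHH H Hh}
    (hw : StronglyMeasurable (S.I.domRestrict w))
    (h : ∀ β ∈ S.I, IntegrableOn (fun t => inner ℂ (w t) (S.Δ t (w t))) (Set.Icc S.a β)) :
    S.LocMemL2 w := by
  refine fun β hβ => ⟨stronglyMeasurable_indicator hw β, ?_⟩
  rw [inner_Δ_indicator, integrableOn_indicator_iff measurableSet_Icc]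
  exact (h β hβ).mono_set Set.inter_subset_left

theorem MemL2.locMemL2 {w : ℝ → SpaceHH H Hh} (hw : S.MemL2 w) : S.LocMemL2 w :=
  LocMemL2.of_integrableOn hw.1 fun _ hβ => hw.2.mono_set (S.Icc_subset_I hβ)

theorem locMemL2_of_continuousOn {w : ℝ → SpaceHH H Hh} (hw : ContinuousOn w S.I) :
    S.LocMemL2 w := by
  refine LocMemL2.of_integrableOn (stronglyMeasurable_of_continuousOn hw) fun β hβ => ?_
  have hc := hw.mono (S.Icc_subset_I hβ)
  obtain ⟨C, hC⟩ := isCompact_Icc.exists_bound_of_continuousOn hc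
  have hm : AEStronglyMeasurable w (volume.restrict (Set.Icc S.a β)) :=
    hc.aestronglyMeasurable measurableSet_Icc
  refine Integrable.mono' (((S.Δ_int β hβ).norm.mul_const C).const_mul C) ?_ ?_
  · exact hm.inner (isBoundedBilinearMap_apply.continuous.comp_aestronglyMeasurable₂
      (S.Δ_int β hβ).aestronglyMeasurable hm)
  · refine (ae_restrict_iff' measurableSet_Icc).2 (Eventually.of_forall fun t ht => ?_)
    have h1 := hC t ht
    have h2 : 0 ≤ C := (norm_nonneg _).trans h1
    calc ‖inner ℂ (w t) (S.Δ t (w t))‖ ≤ ‖w t‖ * ‖S.Δ t (w t)‖ := norm_inner_le_norm _ _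
      _ ≤ C * (‖S.Δ t‖ * C) := by
          gcongr
          exact ((S.Δ t).le_opNorm _).trans (by gcongr)

theorem LocMemL2.add {v w : ℝ → SpaceHH H Hh} (hv : S.LocMemL2 v) (hw : S.LocMemL2 w) :
    S.LocMemL2 (v + w) := by
  intro β hβ
  rw [Set.indicator_add']
  exact S.l2.add_mem (hv β hβ) (hw β hβ)

theorem LocMemL2.sub {v w : ℝ → SpaceHH H Hh} (hv : S.LocMemL2 v) (hw : S.LocMemL2 w) :
    S.LocMemL2 (v - w) := by
  intro β hβ
  rw [Set.indicator_sub']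
  exact S.l2.sub_mem (hv β hβ) (hw β hβ)

theorem inner_indicator_eq {f : ℝ → SpaceHH H Hh} {β : ℝ} (hf : ∀ t ∈ S.I, β < t → f t = 0)
    (w : ℝ → SpaceHH H Hh) {t : ℝ} (ht : t ∈ S.I) :
    inner ℂ ((Set.Icc S.a β).indicator w t) (S.Δ t (f t)) = inner ℂ (w t) (S.Δ t (f t)) := by
  by_cases h : t ∈ Set.Icc S.a β
  · rw [Set.indicator_of_mem h]
  · rw [hf t ht (by by_contra h'; exact h ⟨S.a_le ht, not_lt.1 h'⟩), map_zero, inner_zero_right,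
      inner_zero_right]

theorem LocMemL2.integrableOn_inner {w : ℝ → SpaceHH H Hh} (hw : S.LocMemL2 w) {f : S.L2Fun}
    (hf : f ∈ S.vanishingNearB) : IntegrableOn (fun t => inner ℂ (w t) (S.Δ t (f.1 t))) S.I := by
  obtain ⟨β, h1, h2, h3⟩ := hf
  refine ((hw β (S.mem_I_of_lt h1 h2)).integrableOn_inner f.2).congr ?_
  filter_upwards [ae_restrict_mem S.measurableSet_I] with t ht
  exact inner_indicator_eq h3 w ht

/-- An element of `𝓛²_Δ(I)` of seminorm zero is annihilated by `Δ`. -/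
theorem L2Fun.ae_Δ_eq_zero {f : S.L2Fun} (h : inner ℂ f f = 0) :
    ∀ᵐ t ∂volume.restrict S.I, S.Δ t (f.1 t) = 0 := by
  have hint := MemL2.integrableOn_inner f.2 f.2
  have hre : ∫ t in S.I, RCLike.re (inner ℂ (f.1 t) (S.Δ t (f.1 t))) = 0 := by
    rw [integral_re hint, ← L2Fun.inner_def, h, map_zero]
  have hnn : 0 ≤ᵐ[volume.restrict S.I] fun t => RCLike.re (inner ℂ (f.1 t) (S.Δ t (f.1 t))) := by
    filter_upwards [S.Δ_pos] with t ht
    exact ht.re_inner_nonneg_right _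
  rw [integral_eq_zero_iff_of_nonneg_ae hnn hint.re] at hre
  filter_upwards [hre, S.Δ_pos] with t h1 h2
  have h4 := h2.norm_apply_sq_le (f.1 t)
  rw [show RCLike.re (inner ℂ (f.1 t) (S.Δ t (f.1 t))) = 0 from h1] at h4
  have h5 : ‖S.Δ t (f.1 t)‖ ^ 2 ≤ 0 :=
    nonpos_of_mul_nonpos_right h4 (inv_pos.2 (by positivity))
  rw [← norm_eq_zero]
  exact pow_eq_zero_iff two_ne_zero |>.1 (le_antisymm h5 (by positivity))

/-- A function orthogonal to all functions in `𝓛²_Δ(I)` that vanish near `b` is annihilated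
by `Δ`. -/
theorem LocMemL2.ae_eq_zero {w : ℝ → SpaceHH H Hh} (hw : S.LocMemL2 w)
    (h : ∀ f ∈ S.vanishingNearB, ∫ t in S.I, inner ℂ (w t) (S.Δ t (f.1 t)) = 0) :
    ∀ᵐ t ∂volume.restrict S.I, S.Δ t (w t) = 0 := by
  refine S.ae_restrict_I_of_forall_lt fun β hβ hβb => ?_
  have hβI := S.mem_I_of_lt hβ hβb
  have hvan : ∀ t ∈ S.I, β < t → (Set.Icc S.a β).indicator w t = 0 := fun t _ hlt =>
    Set.indicator_of_notMem (fun h' => (not_le.2 hlt) h'.2) _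
  set f := L2Fun.mk _ (hw β hβI) with hfdef
  have hf : f ∈ S.vanishingNearB := ⟨β, hβ, hβb, hvan⟩
  have h0 : inner ℂ f f = 0 := by
    rw [L2Fun.inner_def, ← h f hf]
    refine integral_congr_ae ?_
    filter_upwards [ae_restrict_mem S.measurableSet_I] with t ht
    exact inner_indicator_eq hvan w ht
  filter_upwards [ae_Icc_of_ae hβI (L2Fun.ae_Δ_eq_zero h0), ae_restrict_mem measurableSet_Icc]
    with t h6 h3
  have h7 : f.1 t = w t := Set.indicator_of_mem h3 _
  rwa [h7] at h6

/-- By the Cauchy-Schwarz inequality `Δ f` is locally integrable for `f` in `𝓛²_Δ(I)`. -/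
theorem MemL2.integrableOn_Δ {f : ℝ → SpaceHH H Hh} (hf : S.MemL2 f) {β : ℝ} (hβ : β ∈ S.I) :
    IntegrableOn (fun t => S.Δ t (f t)) (Set.Icc S.a β) := by
  have hsub := S.Icc_subset_I hβ
  refine Integrable.mono' (g := fun t => (1 + ‖S.Δ t‖) + ‖inner ℂ (f t) (S.Δ t (f t))‖) ?_ ?_ ?_
  · refine Integrable.add (Integrable.add ?_ (S.Δ_int β hβ).norm) (hf.2.mono_set hsub).norm
    exact integrable_const _
  · exact (aestronglyMeasurable_Δ_apply hf.aestronglyMeasurable).mono_measure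
      (Measure.restrict_mono_set _ hsub)
  · filter_upwards [ae_Icc_of_ae hβ S.Δ_pos] with t ht
    have h1 := ht.norm_apply_sq_le (f t)
    have h2 : RCLike.re (inner ℂ (f t) (S.Δ t (f t))) ≤ ‖inner ℂ (f t) (S.Δ t (f t))‖ :=
      RCLike.re_le_norm _
    have hpos : 0 < 1 + ‖S.Δ t‖ := by positivity
    rw [inv_mul_le_iff₀ hpos] at h1
    have h3 := norm_nonneg (inner ℂ (f t) (S.Δ t (f t)))
    have h4 := norm_nonneg (S.Δ t (f t))
    nlinarith

/-- The integrand in the formula for the variation of constants is locally integrable. -/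
theorem integrableOn_kernel {Y : ℝ → SpaceHH H Hh →L[ℂ] SpaceHH H Hh}
    (hYac : ∀ β ∈ S.I, AbsolutelyContinuousOnInterval Y S.a β) {β : ℝ} (hβ : β ∈ S.I)
    {f : ℝ → SpaceHH H Hh} (hf : S.MemL2 f) :
    IntegrableOn (fun t => operatorJ H Hh (ContinuousLinearMap.adjoint (Y t) (S.Δ t (f t))))
      (Set.Icc S.a β) := by
  have hΔ := hf.integrableOn_Δ hβ
  have hc := (continuousOn_of_absolutelyContinuous hYac).mono (S.Icc_subset_I hβ)
  obtain ⟨C, hC⟩ := isCompact_Icc.exists_bound_of_continuousOn hc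
  have hm : AEStronglyMeasurable (fun t => ContinuousLinearMap.adjoint (Y t))
      (volume.restrict (Set.Icc S.a β)) :=
    ContinuousLinearMap.adjoint.continuous.comp_aestronglyMeasurable
      (hc.aestronglyMeasurable measurableSet_Icc)
  refine Integrable.mono' ((hΔ.norm.const_mul C).const_mul ‖operatorJ H Hh‖) ?_ ?_
  · exact (operatorJ H Hh).continuous.comp_aestronglyMeasurable
      (isBoundedBilinearMap_apply.continuous.comp_aestronglyMeasurable₂ hm hΔ.aestronglyMeasurable)
  · refine (ae_restrict_iff' measurableSet_Icc).2 (Eventually.of_forall fun t ht => ?_)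
    refine ((operatorJ H Hh).le_opNorm _).trans ?_
    gcongr
    refine (ContinuousLinearMap.le_opNorm _ _).trans ?_
    gcongr
    rw [LinearIsometryEquiv.norm_map]
    exact hC t ht

theorem integrableOn_I_of_vanishing {w : ℝ → SpaceHH H Hh} {β : ℝ}
    (hw : IntegrableOn w (Set.Icc S.a β)) (h0 : ∀ t ∈ S.I, β < t → w t = 0) :
    IntegrableOn w S.I := by
  refine Integrable.congr (f := (Set.Icc S.a β).indicator w) ?_ ?_
  · exact ((integrable_indicator_iff measurableSet_Icc).2 hw).integrableOn
  · filter_upwards [ae_restrict_mem S.measurableSet_I] with t ht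
    by_cases h : t ∈ Set.Icc S.a β
    · exact Set.indicator_of_mem h _
    · rw [Set.indicator_of_notMem h, h0 t ht]
      by_contra h'; exact h ⟨S.a_le ht, not_lt.1 h'⟩

theorem setIntegral_I_eq_of_vanishing {F : Type*} [NormedAddCommGroup F] [NormedSpace ℝ F]
    {w : ℝ → F} {β t : ℝ} (ht : t ∈ S.I) (hβt : β ≤ t)
    (h0 : ∀ s ∈ S.I, β < s → w s = 0) : ∫ s in S.I, w s = ∫ s in S.a..t, w s := by
  rw [intervalIntegral.integral_of_le (S.a_le ht), ← integral_Icc_eq_integral_Ioc]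
  refine (setIntegral_eq_of_subset_of_forall_sdiff_eq_zero S.measurableSet_I
    (S.Icc_subset_I ht) fun s hs => h0 s hs.1 ?_)
  by_contra h
  exact hs.2 ⟨S.a_le hs.1, (not_lt.1 h).trans hβt⟩

/-- The functional `f ↦ ∫_I J Y* Δ f dt` on the functions vanishing near `b`. -/
def kernelIntegral (Y : ℝ → SpaceHH H Hh →L[ℂ] SpaceHH H Hh)
    (hYac : ∀ β ∈ S.I, AbsolutelyContinuousOnInterval Y S.a β) :
    S.vanishingNearB →ₗ[ℂ] SpaceHH H Hh :=
  have hint : ∀ f : S.vanishingNearB, IntegrableOn (fun t =>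
      operatorJ H Hh (ContinuousLinearMap.adjoint (Y t) (S.Δ t (f.1.1 t)))) S.I := by
    rintro ⟨f, β, h1, h2, h3⟩
    refine integrableOn_I_of_vanishing
      (integrableOn_kernel hYac (S.mem_I_of_lt h1 h2) f.2) fun t ht hlt => ?_
    rw [h3 t ht hlt, map_zero, map_zero, map_zero]
  { toFun := fun f => ∫ t in S.I,
      operatorJ H Hh (ContinuousLinearMap.adjoint (Y t) (S.Δ t (f.1.1 t)))
    map_add' := fun f g => by
      rw [← integral_add (hint f) (hint g)]
      refine integral_congr_ae (Eventually.of_forall fun t => ?_)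
      simp only [← map_add]
      rfl
    map_smul' := fun c f => by
      rw [RingHom.id_apply, ← integral_smul]
      refine integral_congr_ae (Eventually.of_forall fun t => ?_)
      simp only [← map_smul]
      rfl }

theorem inner_kernelIntegral {Y : ℝ → SpaceHH H Hh →L[ℂ] SpaceHH H Hh}
    (hYac : ∀ β ∈ S.I, AbsolutelyContinuousOnInterval Y S.a β) (f : S.vanishingNearB)
    (c : SpaceHH H Hh) : inner ℂ c (kernelIntegral Y hYac f) =
      -∫ t in S.I, inner ℂ (Y t (operatorJ H Hh c)) (S.Δ t (f.1.1 t)) := by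
  obtain ⟨f, β, h1, h2, h3⟩ := f
  have hint : IntegrableOn (fun t =>
      operatorJ H Hh (ContinuousLinearMap.adjoint (Y t) (S.Δ t (f.1 t)))) S.I :=
    integrableOn_I_of_vanishing
      (integrableOn_kernel hYac (S.mem_I_of_lt h1 h2) f.2) fun t ht hlt => by
        rw [h3 t ht hlt, map_zero, map_zero, map_zero]
  change inner ℂ c (∫ t in S.I,
    operatorJ H Hh (ContinuousLinearMap.adjoint (Y t) (S.Δ t (f.1 t)))) = _
  rw [← integral_inner hint, ← integral_neg]
  refine integral_congr_ae (Eventually.of_forall fun t => ?_)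
  simp only
  rw [← ContinuousLinearMap.adjoint_inner_right, inner_operatorJ_left, neg_neg]

/-- A function `f` vanishing near `b` is the right-hand side of an element of the maximal relation
whose first component vanishes near `b` as well. -/
theorem exists_solution_vanishing {Y : ℝ → SpaceHH H Hh →L[ℂ] SpaceHH H Hh} (hYa : Y S.a = 1)
    (hYac : ∀ β ∈ S.I, AbsolutelyContinuousOnInterval Y S.a β)
    (hYd : ∀ᵐ t ∂volume.restrict S.I, HasDerivAt Y (-(operatorJ H Hh * S.B t) * Y t) t)
    (hYJ : ∀ t ∈ S.I, ∀ x, Y t (operatorJ H Hh (ContinuousLinearMap.adjoint (Y t) x)) =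
      operatorJ H Hh x) (f : S.vanishingNearB) :
    ∃ y ∈ S.vanishingNearB, (y, f.1) ∈ S.tmax ∧ y.1 S.a = kernelIntegral Y hYac f := by
  obtain ⟨f, β, h1, h2, h3⟩ := f
  have hβ := S.mem_I_of_lt h1 h2
  set Φ := kernelIntegral Y hYac ⟨f, β, h1, h2, h3⟩ with hΦ
  have hsol := solves_variation_of_constants hYac hYd hYJ
    (fun β hβ => integrableOn_kernel hYac hβ f.2) Φ
  set y := fun t => Y t (Φ - ∫ s in S.a..t,
    operatorJ H Hh (ContinuousLinearMap.adjoint (Y s) (S.Δ s (f.1 s)))) with hy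
  have hvan : ∀ t ∈ S.I, β < t → y t = 0 := by
    intro t ht hlt
    have : Φ = ∫ s in S.a..t,
        operatorJ H Hh (ContinuousLinearMap.adjoint (Y s) (S.Δ s (f.1 s))) :=
      setIntegral_I_eq_of_vanishing ht hlt.le fun s hs hlt => by
        rw [h3 s hs hlt, map_zero, map_zero, map_zero]
    rw [hy]
    simp only
    rw [← this, sub_self, map_zero]
  have hyL2 : S.MemL2 y := by
    refine ⟨stronglyMeasurable_of_continuousOn hsol.continuousOn, ?_⟩
    refine (locMemL2_of_continuousOn hsol.continuousOn β hβ).2.congr ?_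
    filter_upwards [ae_restrict_mem S.measurableSet_I] with t ht
    by_cases h : t ∈ Set.Icc S.a β
    · rw [Set.indicator_of_mem h]
    · rw [Set.indicator_of_notMem h, hvan t ht (by
        by_contra h'; exact h ⟨S.a_le ht, not_lt.1 h'⟩)]
  refine ⟨L2Fun.mk y hyL2, ⟨β, h1, h2, hvan⟩, hsol, ?_⟩
  change y S.a = Φ
  rw [hy]
  simp only [intervalIntegral.integral_same, sub_zero, hYa]
  rfl

/-- For a definite system the functional `f ↦ ∫_I J Y* Δ f dt` is onto: a vector orthogonal to its
range gives a solution of the homogeneous system annihilated by `Δ`. -/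
theorem kernelIntegral_surjective (hS : S.IsDefinite) {Y : ℝ → SpaceHH H Hh →L[ℂ] SpaceHH H Hh}
    (hYa : Y S.a = 1) (hYac : ∀ β ∈ S.I, AbsolutelyContinuousOnInterval Y S.a β)
    (hYs : ∀ c, S.Solves (fun t => Y t c) fun _ => 0) :
    Function.Surjective (kernelIntegral Y hYac) := by
  rw [← LinearMap.range_eq_top, ← Submodule.orthogonal_eq_bot_iff, Submodule.eq_bot_iff]
  intro c hc
  have hw := hYs (operatorJ H Hh c)
  have hz : ∀ᵐ t ∂volume.restrict S.I, S.Δ t (Y t (operatorJ H Hh c)) = 0 := by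
    refine (locMemL2_of_continuousOn hw.continuousOn).ae_eq_zero fun f hf => ?_
    have h1 := (Submodule.mem_orthogonal' _ _).1 hc _
      (LinearMap.mem_range_self (kernelIntegral Y hYac) ⟨f, hf⟩)
    rw [inner_kernelIntegral] at h1
    exact neg_eq_zero.1 h1
  have hsol : S.IsSolution 0 fun t => Y t (operatorJ H Hh c) := by
    refine hw.congr (Eventually.of_forall fun t => ?_)
    simp only [zero_smul]
  have h0 := hS 0 _ hsol hz S.a S.a_mem_I
  simp only [hYa] at h0
  have h1 : operatorJ H Hh c = 0 := h0
  rw [← neg_neg c, ← operatorJ_operatorJ c, h1, map_zero, neg_zero]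

variable (S)

/-- In a definite system every vector is the initial value of an element of the domain of the
maximal relation that vanishes near `b`. -/
theorem exists_initial_value (hS : S.IsDefinite) (α : SpaceHH H Hh) :
    ∃ y ∈ S.domMax, y ∈ S.vanishingNearB ∧ y.1 S.a = α := by
  obtain ⟨Y, hYa, hYac, hYd, hYs, hYJ⟩ := S.exists_fundamental
  obtain ⟨f, hf⟩ := kernelIntegral_surjective hS hYa hYac hYs α
  obtain ⟨y, hy, hyf, hya⟩ := exists_solution_vanishing hYa hYac hYd hYJ f
  exact ⟨y, ⟨(y, f.1), hyf, rfl⟩, hy, hya.trans hf⟩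

theorem leftOfB_eventually {β : ℝ} (hβ : S.a ≤ β) (hβ' : (β : EReal) < S.b) :
    ∀ᶠ t in S.leftOfB, t ∈ S.I ∧ β < t := by
  have : ∀ᶠ x : EReal in 𝓝[<] S.b, (β : EReal) < x ∧ x < S.b :=
    Ioo_mem_nhdsLT hβ'
  filter_upwards [this.comap (fun t : ℝ => (t : EReal))] with t ht
  have h1 : β < t := EReal.coe_lt_coe_iff.1 ht.1
  exact ⟨S.mem_I_of_lt (hβ.trans h1.le) ht.2, h1⟩

theorem tendsto_form_of_vanishing {y : S.domMax} (hy : (y : S.L2Fun) ∈ S.vanishingNearB)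
    (z : S.domMax) :
    Tendsto (fun t => inner ℂ (S.val z t) (operatorJ H Hh (S.val y t))) S.leftOfB (𝓝 0) := by
  obtain ⟨β, h1, h2, h3⟩ := hy
  refine tendsto_const_nhds.congr' ?_
  filter_upwards [S.leftOfB_eventually h1 h2] with t ht
  rw [show S.val y t = 0 from h3 t ht.1 ht.2, map_zero, inner_zero_right]

theorem mem_relOn {L : Submodule ℂ S.domMax} {q : S.L2 × S.L2} : q ∈ S.relOn L ↔
    ∃ (p : S.L2Fun × S.L2Fun) (hp : p ∈ S.tmax), S.fstDom p hp ∈ L ∧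
      (S.quot p.1, S.quot p.2) = q := by
  constructor
  · rintro ⟨p, ⟨hp, ⟨y, hy, hyp⟩⟩, rfl⟩
    refine ⟨p, hp, ?_, rfl⟩
    have : S.fstDom p hp = y := Subtype.ext hyp.symm
    rwa [this]
  · rintro ⟨p, hp, hL, rfl⟩
    exact ⟨p, ⟨hp, ⟨_, hL, rfl⟩⟩, rfl⟩

theorem inner_quot (f g : S.L2Fun) : inner ℂ (S.quot f) (S.quot g) =
    ∫ t in S.I, inner ℂ (f.1 t) (S.Δ t (g.1 t)) := rfl

theorem quot_surjective : Function.Surjective S.quot := SeparationQuotient.surjective_mk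

theorem quot_eq_iff (f g : S.L2Fun) :
    S.quot f = S.quot g ↔ ∀ᵐ t ∂volume.restrict S.I, S.Δ t (f.1 t) = S.Δ t (g.1 t) := by
  rw [← sub_eq_zero, ← map_sub, ← inner_self_eq_zero (𝕜 := ℂ), inner_quot]
  constructor
  · intro h
    filter_upwards [L2Fun.ae_Δ_eq_zero (f := f - g) h] with t h6
    have h7 : S.Δ t (f.1 t - g.1 t) = 0 := h6
    rwa [map_sub, sub_eq_zero] at h7
  · intro h
    rw [← integral_zero ℝ ℂ (μ := volume.restrict S.I)]
    refine integral_congr_ae ?_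
    filter_upwards [h] with t ht
    change inner ℂ (f.1 t - g.1 t) (S.Δ t (f.1 t - g.1 t)) = 0
    rw [map_sub, ht, sub_self, inner_zero_right]

/-- The adjoint of the minimal relation is contained in the maximal relation. If `{k, k'}` belongs
to the adjoint and `J z' - B z = Δ k'`, then the functional `f ↦ (f, k - z)` vanishes on those `f`
with support away from `b` for which the solution of `J y' - B y = Δ f`, `y = 0` near `b`, has
`y(a) = 0`. Hence it is a combination of the components of `∫_I J Y* Δ f`, so that `k - z`
coincides with a solution of the homogeneous system up to the kernel of `Δ`. -/
theorem adjoint_Tmin_le : S.Tmin.adjoint ≤ S.Tmax := by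
  rintro ⟨q, q'⟩ hq
  obtain ⟨k, rfl⟩ := S.quot_surjective q
  obtain ⟨k', rfl⟩ := S.quot_surjective q'
  obtain ⟨Y, hYa, hYac, hYd, hYs, hYJ⟩ := S.exists_fundamental
  have hz := solves_variation_of_constants hYac hYd hYJ
    (fun β hβ => integrableOn_kernel hYac hβ k'.2) 0
  set z := fun t => Y t (0 - ∫ s in S.a..t,
    operatorJ H Hh (ContinuousLinearMap.adjoint (Y s) (S.Δ s (k'.1 s)))) with hzdef
  have hzloc := locMemL2_of_continuousOn hz.continuousOn
  have hloc : S.LocMemL2 (k.1 - z) := (MemL2.locMemL2 k.2).sub hzloc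
  let ℓ : S.vanishingNearB →ₗ[ℂ] ℂ :=
    { toFun := fun f => ∫ t in S.I, inner ℂ ((k.1 - z) t) (S.Δ t (f.1.1 t))
      map_add' := fun f g => by
        rw [← integral_add (hloc.integrableOn_inner f.2) (hloc.integrableOn_inner g.2)]
        refine integral_congr_ae (Eventually.of_forall fun t => ?_)
        simp only [← inner_add_right, ← map_add]
        rfl
      map_smul' := fun c f => by
        rw [RingHom.id_apply, smul_eq_mul, ← integral_const_mul]
        refine integral_congr_ae (Eventually.of_forall fun t => ?_)
        simp only [← inner_smul_right, ← map_smul]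
        rfl }
  have hker : LinearMap.ker (kernelIntegral Y hYac) ≤ LinearMap.ker ℓ := by
    intro f hf
    obtain ⟨y, hyv, hyf, hya⟩ := exists_solution_vanishing hYa hYac hYd hYJ f
    rw [show kernelIntegral Y hYac f = 0 from hf] at hya
    have hmin : (S.quot y, S.quot f.1) ∈ S.Tmin := by
      refine S.mem_relOn.2 ⟨(y, f.1), hyf, ⟨hya, fun w => ?_⟩, rfl⟩
      exact S.tendsto_form_of_vanishing (y := S.fstDom (y, f.1) hyf) hyv w
    have h1 := (Submodule.mem_adjoint_iff _ _).1 hq _ _ hmin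
    have h2 : inner ℂ (S.quot k) (S.quot f.1) = inner ℂ (S.quot k') (S.quot y) := by
      rw [← inner_conj_symm, ← inner_conj_symm (S.quot k'), sub_eq_zero.1 h1]
    rw [inner_quot, inner_quot] at h2
    obtain ⟨β₁, hβ₁, hβ₁b, hv₁⟩ := hyv
    obtain ⟨β₂, hβ₂, hβ₂b, hv₂⟩ := f.2
    have hmax : ((max β₁ β₂ : ℝ) : EReal) < S.b := by
      rcases max_choice β₁ β₂ with h | h <;> rw [h] <;> assumption
    -- beyond `max β₁ β₂` both `y` and `f` vanish
    obtain ⟨β, hβ, hβb⟩ := EReal.lt_iff_exists_real_btwn.1 hmax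
    have hβ' : max β₁ β₂ < β := EReal.coe_lt_coe_iff.1 hβ
    have hβI : β ∈ S.I := S.mem_I_of_lt (hβ₁.trans ((le_max_left _ _).trans hβ'.le)) hβb
    have hgreen := (Solves.green (show S.Solves y.1 _ from hyf) hz hβI).2
    rw [hv₁ β hβI ((le_max_left _ _).trans_lt hβ'), hya, map_zero, inner_zero_right,
      inner_zero_right, sub_zero, ← setIntegral_I_eq_of_vanishing hβI hβ'.le
        (fun s hs hlt => by
          rw [hv₁ s hs ((le_max_left _ _).trans_lt hlt), hv₂ s hs ((le_max_right _ _).trans_lt hlt),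
            map_zero, inner_zero_right, inner_zero_right, sub_zero])] at hgreen
    have hi1 := hzloc.integrableOn_inner f.2
    have hi2 := (MemL2.locMemL2 k.2).integrableOn_inner f.2
    have hi3 := MemL2.integrableOn_inner k'.2 y.2
    have e1 : ∫ t in S.I, (inner ℂ (z t) (S.Δ t (f.1.1 t)) - inner ℂ (S.Δ t (k'.1 t)) (y.1 t)) =
        (∫ t in S.I, inner ℂ (z t) (S.Δ t (f.1.1 t))) -
          ∫ t in S.I, inner ℂ (k'.1 t) (S.Δ t (y.1 t)) := by
      rw [← integral_sub hi1 hi3]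
      refine integral_congr_ae ?_
      filter_upwards [S.Δ_pos] with t ht
      rw [show inner ℂ (S.Δ t (k'.1 t)) (y.1 t) = inner ℂ (k'.1 t) (S.Δ t (y.1 t)) from
        ht.isSymmetric _ _]
    have e2 : ℓ f = (∫ t in S.I, inner ℂ (k.1 t) (S.Δ t (f.1.1 t))) -
        ∫ t in S.I, inner ℂ (z t) (S.Δ t (f.1.1 t)) := by
      rw [← integral_sub hi2 hi1]
      refine integral_congr_ae (Eventually.of_forall fun t => ?_)
      exact inner_sub_left _ _ _
    rw [LinearMap.mem_ker, e2, h2, sub_eq_zero, eq_comm, ← sub_eq_zero, ← e1]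
    exact hgreen
  obtain ⟨φ, hφ⟩ : ℓ ∈ LinearMap.range (kernelIntegral Y hYac).dualMap := by
    rw [LinearMap.range_dualMap_eq_dualAnnihilator_ker, Submodule.mem_dualAnnihilator]
    exact fun f hf => hker hf
  set c := (InnerProductSpace.toDual ℂ (SpaceHH H Hh)).symm (LinearMap.toContinuousLinearMap φ)
    with hc
  have hℓ : ∀ f, ℓ f = inner ℂ c (kernelIntegral Y hYac f) := fun f => by
    rw [hc, InnerProductSpace.toDual_symm_apply, ← hφ]
    rfl
  have hY := hYs (operatorJ H Hh c)
  have hYloc := locMemL2_of_continuousOn hY.continuousOn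
  have hzero := (hloc.add hYloc).ae_eq_zero fun f hf => by
    have h1 := hℓ ⟨f, hf⟩
    rw [inner_kernelIntegral, eq_neg_iff_add_eq_zero] at h1
    rw [← h1]
    refine Eq.trans ?_ (integral_add (hloc.integrableOn_inner hf) (hYloc.integrableOn_inner hf))
    refine integral_congr_ae (Eventually.of_forall fun t => ?_)
    exact inner_add_left _ _ _
  set u := fun t => z t - Y t (operatorJ H Hh c) with hu
  have husol : S.Solves u fun t => S.Δ t (k'.1 t) :=
    (hz.sub hY).congr (Eventually.of_forall fun t => sub_zero _)
  have hΔ : ∀ᵐ t ∂volume.restrict S.I, S.Δ t (k.1 t) = S.Δ t (u t) := by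
    filter_upwards [hzero] with t ht
    rw [← sub_eq_zero, ← map_sub, ← ht]
    congr 1
    change k.1 t - (z t - Y t (operatorJ H Hh c)) = k.1 t - z t + Y t (operatorJ H Hh c)
    abel
  have huL2 : S.MemL2 u := by
    refine ⟨stronglyMeasurable_of_continuousOn husol.continuousOn, ?_⟩
    refine (MemL2.integrableOn_inner k.2 k.2).congr ?_
    filter_upwards [hΔ, S.Δ_pos] with t ht hpos
    rw [← ht, ← show inner ℂ (S.Δ t (u t)) (k.1 t) = inner ℂ (u t) (S.Δ t (k.1 t)) from
      hpos.isSymmetric _ _, ← ht]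
    exact (hpos.isSymmetric _ _).symm
  refine ⟨(L2Fun.mk u huL2, k'), husol, Prod.ext ?_ rfl⟩
  exact ((S.quot_eq_iff _ _).2 hΔ).symm

end SymmetricSystem

/-! ### Green's identity and boundary values -/

namespace SymmetricSystem

variable {H Hh Hb : Type*} [NormedAddCommGroup H] [InnerProductSpace ℂ H] [FiniteDimensional ℂ H]
  [NormedAddCommGroup Hh] [InnerProductSpace ℂ Hh] [FiniteDimensional ℂ Hh]
  [NormedAddCommGroup Hb] [InnerProductSpace ℂ Hb]
variable (S : SymmetricSystem H Hh)

instance : S.leftOfB.NeBot := by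
  refine comap_neBot fun s hs => ?_
  obtain ⟨l, hl, hs'⟩ := (mem_nhdsLT_iff_exists_Ioo_subset' S.a_lt_b).1 hs
  obtain ⟨t, ht, ht'⟩ := EReal.lt_iff_exists_real_btwn.1 hl
  exact ⟨t, hs' ⟨ht, ht'⟩⟩

instance : S.leftOfB.IsCountablyGenerated := by
  unfold leftOfB
  infer_instance

theorem tendsto_intervalIntegral {F : ℝ → ℂ} (hF : IntegrableOn F S.I) :
    Tendsto (fun t => ∫ s in S.a..t, F s) S.leftOfB (𝓝 (∫ s in S.I, F s)) := by
  have hcov : AECover (volume.restrict S.I) S.leftOfB fun t => Set.Iic t :=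
    { ae_eventually_mem := S.ae_restrict_I_of_forall_lt fun β hβ hβb => by
        rw [ae_restrict_iff' measurableSet_Icc]
        refine Eventually.of_forall fun x hx => ?_
        filter_upwards [S.leftOfB_eventually hβ hβb] with t ht
        exact hx.2.trans ht.2.le
      measurableSet := fun t => measurableSet_Iic }
  refine (hcov.integral_tendsto_of_countably_generated hF).congr' ?_
  filter_upwards [S.leftOfB_eventually le_rfl S.a_lt_b] with t ht
  rw [Measure.restrict_restrict measurableSet_Iic, intervalIntegral.integral_of_le ht.2.le,
    ← integral_Icc_eq_integral_Ioc]
  congr 2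
  ext s
  exact ⟨fun h => ⟨S.a_le h.2, h.1⟩, fun h => ⟨h.2, S.Icc_subset_I ht.1 h⟩⟩

variable {S}

/-- The boundary form `[y, z]_b` expressed by the boundary map. -/
def BoundaryMap.form (Γ : S.BoundaryMap Hb) (y z : S.domMax) : ℂ :=
  inner ℂ (Γ.Γ1 z) (Γ.Γ0 y) - inner ℂ (Γ.Γ0 z) (Γ.Γ1 y)
    + Complex.I * inner ℂ (Γ.Γhat z) (Γ.Γhat y)

/-- Green's identity on `I`. -/
theorem BoundaryMap.green (Γ : S.BoundaryMap Hb) {p q : S.L2Fun × S.L2Fun} (hp : p ∈ S.tmax)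
    (hq : q ∈ S.tmax) :
    inner ℂ (S.quot q.1) (S.quot p.2) - inner ℂ (S.quot q.2) (S.quot p.1) =
      Γ.form (S.fstDom p hp) (S.fstDom q hq) -
        inner ℂ (q.1.1 S.a) (operatorJ H Hh (p.1.1 S.a)) := by
  have hi1 := MemL2.integrableOn_inner q.1.2 p.2.2
  have hi2 := MemL2.integrableOn_inner q.2.2 p.1.2
  have e : (fun t => inner ℂ (q.1.1 t) (S.Δ t (p.2.1 t)) - inner ℂ (q.2.1 t) (S.Δ t (p.1.1 t)))
      =ᵐ[volume.restrict S.I]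
      fun t => inner ℂ (q.1.1 t) (S.Δ t (p.2.1 t)) - inner ℂ (S.Δ t (q.2.1 t)) (p.1.1 t) := by
    filter_upwards [S.Δ_pos] with t ht
    rw [show inner ℂ (S.Δ t (q.2.1 t)) (p.1.1 t) = inner ℂ (q.2.1 t) (S.Δ t (p.1.1 t)) from
      ht.isSymmetric _ _]
  have h1 := S.tendsto_intervalIntegral ((hi1.sub hi2).congr e)
  rw [inner_quot, inner_quot, ← integral_sub hi1 hi2, integral_congr_ae e]
  refine tendsto_nhds_unique h1 ?_
  refine ((Γ.form_eq (S.fstDom p hp) (S.fstDom q hq)).sub_const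
    (inner ℂ (q.1.1 S.a) (operatorJ H Hh (p.1.1 S.a)))).congr' ?_
  filter_upwards [S.leftOfB_eventually le_rfl S.a_lt_b] with t ht
  exact (Solves.green (show S.Solves p.1.1 _ from hp) (show S.Solves q.1.1 _ from hq) ht.1).2.symm

/-- The boundary form at `b` is non-degenerate on the boundary values. -/
theorem BoundaryMap.eq_zero_of_form_eq_zero (Γ : S.BoundaryMap Hb) {y : S.domMax}
    (h : ∀ z, Γ.form y z = 0) : Γ.Γ0 y = 0 ∧ Γ.Γhat y = 0 ∧ Γ.Γ1 y = 0 := by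
  have hs : ∀ u v w, ∃ z, Γ.Γ0 z = u ∧ Γ.Γhat z = v ∧ Γ.Γ1 z = w := fun u v w => by
    obtain ⟨z, hz⟩ := Γ.surjective (u, v, w)
    simp only [Prod.mk.injEq] at hz
    exact ⟨z, hz⟩
  refine ⟨?_, ?_, ?_⟩
  · obtain ⟨z, h0, h1, h2⟩ := hs 0 0 (Γ.Γ0 y)
    have := h z
    simpa [BoundaryMap.form, h0, h1, h2] using this
  · obtain ⟨z, h0, h1, h2⟩ := hs 0 (Γ.Γhat y) 0
    have := h z
    simpa [BoundaryMap.form, h0, h1, h2] using this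
  · obtain ⟨z, h0, h1, h2⟩ := hs (Γ.Γ1 y) 0 0
    have := h z
    simpa [BoundaryMap.form, h0, h1, h2] using this

theorem BoundaryMap.eq_zero_of_tendsto (Γ : S.BoundaryMap Hb) {y : S.domMax}
    (h : ∀ z : S.domMax, Tendsto (fun t => inner ℂ (S.val z t) (operatorJ H Hh (S.val y t)))
      S.leftOfB (𝓝 0)) : Γ.Γ0 y = 0 ∧ Γ.Γhat y = 0 ∧ Γ.Γ1 y = 0 :=
  Γ.eq_zero_of_form_eq_zero fun z => tendsto_nhds_unique (Γ.form_eq y z) (h z)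

/-- In a definite system the boundary values at `a` and `b` can be prescribed simultaneously. -/
theorem BoundaryMap.exists_boundary_values (hS : S.IsDefinite) (Γ : S.BoundaryMap Hb)
    (α : SpaceHH H Hh) (u : Hb) (v : Hh) (w : Hb) :
    ∃ y : S.domMax, S.evalA y = α ∧ Γ.Γ0 y = u ∧ Γ.Γhat y = v ∧ Γ.Γ1 y = w := by
  obtain ⟨y, hy⟩ := Γ.surjective (u, v, w)
  simp only [Prod.mk.injEq] at hy
  obtain ⟨x, hx, hxv, hxa⟩ := S.exists_initial_value hS (α - S.evalA y)
  obtain ⟨h0, h1, h2⟩ := Γ.eq_zero_of_tendsto (S.tendsto_form_of_vanishing (y := ⟨x, hx⟩) hxv)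
  refine ⟨⟨x, hx⟩ + y, ?_, ?_, ?_, ?_⟩
  · rw [map_add, show S.evalA ⟨x, hx⟩ = α - S.evalA y from hxa, sub_add_cancel]
  · rw [map_add, h0, hy.1, zero_add]
  · rw [map_add, h1, hy.2.1, zero_add]
  · rw [map_add, h2, hy.2.2, zero_add]

/-- In a definite system the first component of an element of the maximal relation is determined
on `I` by the image of the element in `L²_Δ`. -/
theorem eq_zero_of_quot_eq_zero (hS : S.IsDefinite) {p : S.L2Fun × S.L2Fun} (hp : p ∈ S.tmax)
    (h1 : S.quot p.1 = 0) (h2 : S.quot p.2 = 0) : ∀ t ∈ S.I, p.1.1 t = 0 := by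
  rw [← map_zero S.quot, quot_eq_iff] at h1 h2
  have hz : ∀ᵐ t ∂volume.restrict S.I, S.Δ t (p.1.1 t) = 0 := by
    filter_upwards [h1] with t ht
    exact ht.trans (map_zero _)
  refine hS 0 p.1.1 (Solves.congr (show S.Solves p.1.1 _ from hp) ?_) hz
  filter_upwards [h2] with t ht
  rw [zero_smul]
  exact ht.trans (map_zero _)

theorem BoundaryMap.eq_zero_of_quot_eq_zero (hS : S.IsDefinite) (Γ : S.BoundaryMap Hb)
    {p : S.L2Fun × S.L2Fun} (hp : p ∈ S.tmax) (h1 : S.quot p.1 = 0) (h2 : S.quot p.2 = 0) :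
    S.evalA (S.fstDom p hp) = 0 ∧ Γ.Γ0 (S.fstDom p hp) = 0 ∧ Γ.Γhat (S.fstDom p hp) = 0 ∧
      Γ.Γ1 (S.fstDom p hp) = 0 := by
  have h := SymmetricSystem.eq_zero_of_quot_eq_zero hS hp h1 h2
  refine ⟨h _ S.a_mem_I, Γ.eq_zero_of_tendsto fun z => ?_⟩
  refine S.tendsto_form_of_vanishing (y := S.fstDom p hp) ?_ z
  exact ⟨S.a, le_rfl, S.a_lt_b, fun t ht _ => h t ht⟩

/-! ### The relation `T̃` and its adjoint -/

theorem relOn_mono {L M : Submodule ℂ S.domMax} (h : L ≤ M) : S.relOn L ≤ S.relOn M := by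
  intro q hq
  obtain ⟨p, hp, hL, hpq⟩ := S.mem_relOn.1 hq
  exact S.mem_relOn.2 ⟨p, hp, h hL, hpq⟩

theorem exists_tmax (y : S.domMax) : ∃ (p : S.L2Fun × S.L2Fun) (hp : p ∈ S.tmax),
    S.fstDom p hp = y := by
  obtain ⟨p, hp, hpy⟩ := y.2
  exact ⟨p, hp, Subtype.ext hpy⟩

/-- The adjoint of a restriction of the maximal relation in terms of the boundary forms. -/
theorem BoundaryMap.quot_mem_adjoint_relOn_iff (Γ : S.BoundaryMap Hb) {L : Submodule ℂ S.domMax}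
    {p : S.L2Fun × S.L2Fun} (hp : p ∈ S.tmax) :
    (S.quot p.1, S.quot p.2) ∈ (S.relOn L).adjoint ↔ ∀ y ∈ L,
      Γ.form (S.fstDom p hp) y = inner ℂ (S.evalA y) (operatorJ H Hh (p.1.1 S.a)) := by
  rw [Submodule.mem_adjoint_iff]
  constructor
  · intro h y hy
    obtain ⟨q, hq, rfl⟩ := S.exists_tmax y
    have h1 := h _ _ (S.mem_relOn.2 ⟨q, hq, hy, rfl⟩)
    have h2 := Γ.green hp hq
    rw [← neg_sub, h1, neg_zero] at h2
    exact sub_eq_zero.1 h2.symm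
  · intro h a b hab
    obtain ⟨q, hq, hy, hqab⟩ := S.mem_relOn.1 hab
    obtain ⟨rfl, rfl⟩ := Prod.mk.inj hqab
    have h2 := Γ.green hp hq
    rw [h _ hy] at h2
    rw [← neg_sub, h2]
    exact neg_eq_zero.2 (sub_self _)

theorem BoundaryMap.Tmin_le_relOn (Γ : S.BoundaryMap Hb) {L : Submodule ℂ S.domMax}
    (hL : ∀ y, S.evalA y = 0 → Γ.Γ0 y = 0 → Γ.Γhat y = 0 → Γ.Γ1 y = 0 → y ∈ L) :
    S.Tmin ≤ S.relOn L := by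
  refine relOn_mono fun y hy => ?_
  obtain ⟨h0, h1, h2⟩ := Γ.eq_zero_of_tendsto hy.2
  exact hL y hy.1 h0 h1 h2

variable {Γ : S.BoundaryMap Hb} {C0 C1 : Hb →L[ℂ] Hb}

theorem mem_domTau {y : S.domMax} : y ∈ S.domTau Γ C0 C1 ↔ C0 (Γ.Γ0 y) + C1 (Γ.Γ1 y) = 0 :=
  Iff.rfl

theorem Tmin_le_Ttilde : S.Tmin ≤ S.Ttilde Γ C0 C1 :=
  Γ.Tmin_le_relOn fun y ha h0 h1 h2 =>
    ⟨⟨ha, h1⟩, mem_domTau.2 (by rw [h0, h2, map_zero, map_zero, add_zero])⟩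

theorem Ttilde_le : S.Ttilde Γ C0 C1 ≤ S.relOn (S.domTau Γ C0 C1) :=
  relOn_mono inf_le_right

/-- The adjoint lies in `T_max` because `T̃` extends `T_min`; the boundary values at `b` of an
element of the adjoint satisfy the condition given by `τ`, which is its own adjoint condition. -/
theorem adjoint_Ttilde [FiniteDimensional ℂ Hb] (hS : S.IsDefinite) (hτ : IsSelfAdjointPair C0 C1) :
    (S.Ttilde Γ C0 C1).adjoint = S.relOn (S.domTau Γ C0 C1) := by
  refine le_antisymm (fun q hq => ?_) fun q hq => ?_
  · obtain ⟨p, hp, rfl⟩ := S.adjoint_Tmin_le (Submodule.adjoint_anti Tmin_le_Ttilde hq)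
    refine S.mem_relOn.2 ⟨p, hp, mem_domTau.2 ?_, rfl⟩
    have h := (Γ.quot_mem_adjoint_relOn_iff hp).1 hq
    refine hτ.of_forall_inner_sub_inner_eq_zero fun x x' hx => ?_
    obtain ⟨y, ha, h0, h1, h2⟩ := Γ.exists_boundary_values hS 0 x 0 x'
    have h3 := h y ⟨⟨ha, h1⟩, mem_domTau.2 (by rw [h0, h2, hx])⟩
    rw [BoundaryMap.form, h0, h1, h2, ha, inner_zero_left, inner_zero_left, mul_zero,
      add_zero] at h3
    rw [← inner_conj_symm, ← inner_conj_symm (Γ.Γ0 _), ← map_sub, ← neg_sub, h3, neg_zero,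
      map_zero]
  · obtain ⟨p, hp, hτp, rfl⟩ := S.mem_relOn.1 hq
    refine (Γ.quot_mem_adjoint_relOn_iff hp).2 fun y hy => ?_
    rw [BoundaryMap.form, show S.evalA y = 0 from hy.1.1, show Γ.Γhat y = 0 from hy.1.2,
      inner_zero_left, inner_zero_left, mul_zero, add_zero]
    exact hτ.inner_sub_inner_eq_zero hτp hy.2

theorem isSymmetricRelation_Ttilde [FiniteDimensional ℂ Hb] (hS : S.IsDefinite)
    (hτ : IsSelfAdjointPair C0 C1) :
    IsSymmetricRelation (S.Ttilde Γ C0 C1) := by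
  rw [IsSymmetricRelation, adjoint_Ttilde hS hτ]
  exact Ttilde_le

/-- `T̃` is closed, since it is the adjoint of `T̃*`. -/
theorem isClosed_Ttilde [FiniteDimensional ℂ Hb] (hS : S.IsDefinite)
    (hτ : IsSelfAdjointPair C0 C1) :
    IsClosed (S.Ttilde Γ C0 C1 : Set (S.L2 × S.L2)) := by
  have e : S.Ttilde Γ C0 C1 = (S.relOn (S.domTau Γ C0 C1)).adjoint := by
    refine le_antisymm (fun q hq => ?_) fun q hq => ?_
    · rw [← adjoint_Ttilde hS hτ, Submodule.mem_adjoint_iff]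
      intro a b hab
      have := (Submodule.mem_adjoint_iff _ _).1 hab _ _ hq
      rw [← inner_conj_symm, ← inner_conj_symm a, ← map_sub, ← neg_sub, this, neg_zero, map_zero]
    · have hq' := Submodule.adjoint_anti Ttilde_le hq
      rw [adjoint_Ttilde hS hτ] at hq'
      obtain ⟨p, hp, hτp, rfl⟩ := S.mem_relOn.1 hq'
      have h := (Γ.quot_mem_adjoint_relOn_iff hp).1 hq
      refine S.mem_relOn.2 ⟨p, hp, ⟨⟨?_, ?_⟩, hτp⟩, rfl⟩
      · obtain ⟨y, ha, h0, h1, h2⟩ :=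
          Γ.exists_boundary_values hS (operatorJ H Hh (p.1.1 S.a)) 0 0 0
        have h3 := h y (mem_domTau.2 (by rw [h0, h2, map_zero, map_zero, add_zero]))
        rw [BoundaryMap.form, h0, h1, h2, ha] at h3
        simp only [inner_zero_left, mul_zero, sub_zero, add_zero] at h3
        have h4 : operatorJ H Hh (p.1.1 S.a) = 0 := inner_self_eq_zero.1 h3.symm
        change p.1.1 S.a = 0
        rw [← neg_neg (p.1.1 S.a), ← operatorJ_operatorJ (p.1.1 S.a), h4, map_zero, neg_zero]
      · obtain ⟨y, ha, h0, h1, h2⟩ :=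
          Γ.exists_boundary_values hS 0 0 (Γ.Γhat (S.fstDom p hp)) 0
        have h3 := h y (mem_domTau.2 (by rw [h0, h2, map_zero, map_zero, add_zero]))
        rw [BoundaryMap.form, h0, h1, h2, ha] at h3
        simp only [inner_zero_left, sub_zero, zero_add, mul_eq_zero, Complex.I_ne_zero,
          false_or] at h3
        exact inner_self_eq_zero.1 h3
  rw [e]
  exact Submodule.isClosed_adjoint _

/-! ### The boundary triplet for `T̃*` -/

variable {U : SpaceHH H Hh →L[ℂ] SpaceHH H Hh}

theorem surjective_of_isJUnitary (hU : IsJUnitary U) : Function.Surjective U := by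
  have hinj : Function.Injective U.toLinearMap := by
    rw [← LinearMap.ker_eq_bot, LinearMap.ker_eq_bot']
    intro d hd
    have h1 : (ContinuousLinearMap.adjoint U ∘L operatorJ H Hh ∘L U) d = operatorJ H Hh d := by
      rw [hU]
    have h2 : U d = 0 := hd
    simp only [ContinuousLinearMap.comp_apply, h2, map_zero] at h1
    rw [← neg_neg d, ← operatorJ_operatorJ d, ← h1, map_zero, neg_zero]
  exact LinearMap.injective_iff_surjective.1 hinj

theorem inner_evalA (hU : IsJUnitary U) (y z : S.domMax) :
    inner ℂ (S.evalA z) (operatorJ H Hh (S.evalA y)) =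
      inner ℂ (S.Γ1a U z) (S.Γ0a U y) - inner ℂ (S.Γ0a U z) (S.Γ1a U y)
        + Complex.I * inner ℂ (S.Γhata U z) (S.Γhata U y) := by
  have h : operatorJ H Hh (S.evalA y) =
      ContinuousLinearMap.adjoint U (operatorJ H Hh (U (S.evalA y))) := by
    conv_lhs => rw [← hU]
    rfl
  rw [h, ContinuousLinearMap.adjoint_inner_right, inner_operatorJ]
  rfl

variable (Γ) in
/-- The map `Γ̃₀` as a linear map on the domain of the maximal relation. -/
def Γtilde0Map (U : SpaceHH H Hh →L[ℂ] SpaceHH H Hh) : S.domMax →ₗ[ℂ] SpaceH0 H Hh where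
  toFun := S.Γtilde0 U Γ
  map_add' y z := WithLp.ofLp_injective 2 (Prod.ext
    (by simp only [Γtilde0, map_add]; exact neg_add _ _)
    (by simp only [Γtilde0, map_add]; rw [add_sub_add_comm]; exact smul_add _ _ _))
  map_smul' c y := WithLp.ofLp_injective 2 (Prod.ext
    (by simp only [Γtilde0, map_smul]; exact (smul_neg _ _).symm)
    (by simp only [Γtilde0, map_smul]; rw [← smul_sub]; exact smul_comm _ _ _))

variable (Γ) in
/-- The map `Γ̃₁` as a linear map on the domain of the maximal relation. -/
def Γtilde1Map (U : SpaceHH H Hh →L[ℂ] SpaceHH H Hh) : S.domMax →ₗ[ℂ] SpaceH0 H Hh where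
  toFun := S.Γtilde1 U Γ
  map_add' y z := WithLp.ofLp_injective 2 (Prod.ext
    (by simp only [Γtilde1, map_add]; rfl)
    (by simp only [Γtilde1, map_add]; rw [add_add_add_comm]; exact smul_add _ _ _))
  map_smul' c y := WithLp.ofLp_injective 2 (Prod.ext
    (by simp only [Γtilde1, map_smul]; rfl)
    (by simp only [Γtilde1, map_smul]; rw [← smul_add]; exact smul_comm _ _ _))

/-- Green's identity in terms of `Γ̃₀` and `Γ̃₁`. -/
theorem form_sub_inner_evalA [FiniteDimensional ℂ Hb] (hU : IsJUnitary U)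
    (hτ : IsSelfAdjointPair C0 C1) {y z : S.domMax} (hy : y ∈ S.domTau Γ C0 C1)
    (hz : z ∈ S.domTau Γ C0 C1) :
    Γ.form y z - inner ℂ (S.evalA z) (operatorJ H Hh (S.evalA y)) =
      inner ℂ (S.Γtilde0 U Γ z) (S.Γtilde1 U Γ y) -
        inner ℂ (S.Γtilde1 U Γ z) (S.Γtilde0 U Γ y) := by
  have h := hτ.inner_sub_inner_eq_zero hy hz
  rw [inner_evalA hU, BoundaryMap.form, h]
  have e1 : inner ℂ (S.Γtilde0 U Γ z) (S.Γtilde1 U Γ y) =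
      inner ℂ (-S.Γ1a U z) (S.Γ0a U y) + inner ℂ (Complex.I • (S.Γhata U z - Γ.Γhat z))
        ((1 / 2 : ℂ) • (S.Γhata U y + Γ.Γhat y)) := rfl
  have e2 : inner ℂ (S.Γtilde1 U Γ z) (S.Γtilde0 U Γ y) =
      inner ℂ (S.Γ0a U z) (-S.Γ1a U y) + inner ℂ ((1 / 2 : ℂ) • (S.Γhata U z + Γ.Γhat z))
        (Complex.I • (S.Γhata U y - Γ.Γhat y)) := rfl
  rw [e1, e2]
  simp only [inner_neg_left, inner_neg_right, inner_smul_left, inner_smul_right, inner_add_left,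
    inner_add_right, inner_sub_left, inner_sub_right, Complex.conj_I, map_div₀, map_one,
    Complex.conj_ofNat]
  ring

/-- In a definite system a linear map that depends only on the boundary values of `y` descends to
a linear map on a subspace of the maximal relation in `L²_Δ`. -/
theorem exists_descend {K : Type*} [AddCommGroup K] [Module ℂ K] {A : Submodule ℂ (S.L2 × S.L2)}
    (hA : A ≤ S.Tmax) (G : S.domMax →ₗ[ℂ] K)
    (hG : ∀ (p : S.L2Fun × S.L2Fun) (hp : p ∈ S.tmax), S.quot p.1 = 0 → S.quot p.2 = 0 →
      G (S.fstDom p hp) = 0) :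
    ∃ G' : A →ₗ[ℂ] K, ∀ (p : S.L2Fun × S.L2Fun) (hp : p ∈ S.tmax)
      (hp' : (S.quot p.1, S.quot p.2) ∈ A),
      G' ⟨(S.quot p.1, S.quot p.2), hp'⟩ = G (S.fstDom p hp) := by
  let Q : S.tmax →ₗ[ℂ] S.L2 × S.L2 := (S.quot.prodMap S.quot) ∘ₗ S.tmax.subtype
  let D : S.tmax →ₗ[ℂ] S.domMax :=
    { toFun := fun p => S.fstDom p.1 p.2
      map_add' := fun _ _ => rfl
      map_smul' := fun _ _ => rfl }
  let Q' : A.comap Q →ₗ[ℂ] A := Q.restrict fun _ h => h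
  have hQ' : Function.Surjective Q' := by
    rintro ⟨q, hq⟩
    obtain ⟨p, hp, rfl⟩ := hA hq
    exact ⟨⟨⟨p, hp⟩, hq⟩, rfl⟩
  obtain ⟨s, hs⟩ := LinearMap.exists_rightInverse_of_surjective Q' (LinearMap.range_eq_top.2 hQ')
  refine ⟨G ∘ₗ D ∘ₗ (A.comap Q).subtype ∘ₗ s, fun p hp hp' => ?_⟩
  set r := (s ⟨(S.quot p.1, S.quot p.2), hp'⟩ : S.tmax) with hr
  have h1 : Q r = (S.quot p.1, S.quot p.2) :=
    congrArg Subtype.val (LinearMap.congr_fun hs ⟨(S.quot p.1, S.quot p.2), hp'⟩)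
  obtain ⟨h2, h3⟩ := Prod.mk.inj (show (S.quot r.1.1, S.quot r.1.2) = _ from h1)
  have h4 := hG (r.1 - p) (S.tmax.sub_mem r.2 hp)
    (by rw [Prod.fst_sub, map_sub, h2, sub_self]) (by rw [Prod.snd_sub, map_sub, h3, sub_self])
  have h5 : S.fstDom (r.1 - p) (S.tmax.sub_mem r.2 hp) = D r - S.fstDom p hp := rfl
  rw [h5, map_sub, sub_eq_zero] at h4
  exact h4

theorem Γtilde0_eq_zero (U : SpaceHH H Hh →L[ℂ] SpaceHH H Hh) {y : S.domMax}
    (h0 : S.evalA y = 0) (h1 : Γ.Γhat y = 0) : S.Γtilde0 U Γ y = 0 := by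
  have e1 : S.Γ1a U y = 0 := by
    simp only [Γ1a, LinearMap.comp_apply, h0, map_zero]
  have e2 : S.Γhata U y = 0 := by
    simp only [Γhata, LinearMap.comp_apply, h0, map_zero]
  simp only [Γtilde0, e1, e2, h1, neg_zero, sub_zero, smul_zero]
  rfl

theorem Γtilde1_eq_zero (U : SpaceHH H Hh →L[ℂ] SpaceHH H Hh) {y : S.domMax}
    (h0 : S.evalA y = 0) (h1 : Γ.Γhat y = 0) : S.Γtilde1 U Γ y = 0 := by
  have e1 : S.Γ0a U y = 0 := by
    simp only [Γ0a, LinearMap.comp_apply, h0, map_zero]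
  have e2 : S.Γhata U y = 0 := by
    simp only [Γhata, LinearMap.comp_apply, h0, map_zero]
  simp only [Γtilde1, e1, e2, h1, add_zero, smul_zero]
  rfl

/-- The maps `Γ̃₀` and `Γ̃₁` descend to `T̃*`. -/
theorem exists_triplet_maps (hS : S.IsDefinite) (U : SpaceHH H Hh →L[ℂ] SpaceHH H Hh)
    (Γ : S.BoundaryMap Hb) (C0 C1 : Hb →L[ℂ] Hb) :
    ∃ G0 G1 : (S.Ttilde Γ C0 C1).adjoint →ₗ[ℂ] SpaceH0 H Hh,
      ∀ (p : S.L2Fun × S.L2Fun) (hp : p ∈ S.tmax)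
          (hp' : (S.quot p.1, S.quot p.2) ∈ (S.Ttilde Γ C0 C1).adjoint),
        G0 ⟨(S.quot p.1, S.quot p.2), hp'⟩ = S.Γtilde0 U Γ (S.fstDom p hp) ∧
        G1 ⟨(S.quot p.1, S.quot p.2), hp'⟩ = S.Γtilde1 U Γ (S.fstDom p hp) := by
  have hA : (S.Ttilde Γ C0 C1).adjoint ≤ S.Tmax :=
    (Submodule.adjoint_anti Tmin_le_Ttilde).trans S.adjoint_Tmin_le
  obtain ⟨G0, hG0⟩ := exists_descend hA (Γtilde0Map Γ U) fun p hp h1 h2 => by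
    obtain ⟨ha, -, hb, -⟩ := Γ.eq_zero_of_quot_eq_zero hS hp h1 h2
    exact Γtilde0_eq_zero U ha hb
  obtain ⟨G1, hG1⟩ := exists_descend hA (Γtilde1Map Γ U) fun p hp h1 h2 => by
    obtain ⟨ha, -, hb, -⟩ := Γ.eq_zero_of_quot_eq_zero hS hp h1 h2
    exact Γtilde1_eq_zero U ha hb
  exact ⟨G0, G1, fun p hp hp' => ⟨hG0 p hp hp', hG1 p hp hp'⟩⟩

theorem isOrdinaryBoundaryTriplet [FiniteDimensional ℂ Hb] (hS : S.IsDefinite) (hU : IsJUnitary U)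
    (hτ : IsSelfAdjointPair C0 C1) {G0 G1 : (S.Ttilde Γ C0 C1).adjoint →ₗ[ℂ] SpaceH0 H Hh}
    (hG : ∀ (p : S.L2Fun × S.L2Fun) (hp : p ∈ S.tmax)
          (hp' : (S.quot p.1, S.quot p.2) ∈ (S.Ttilde Γ C0 C1).adjoint),
        G0 ⟨(S.quot p.1, S.quot p.2), hp'⟩ = S.Γtilde0 U Γ (S.fstDom p hp) ∧
        G1 ⟨(S.quot p.1, S.quot p.2), hp'⟩ = S.Γtilde1 U Γ (S.fstDom p hp)) :
    IsOrdinaryBoundaryTriplet (S.Ttilde Γ C0 C1) G0 G1 where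
  isClosed := isClosed_Ttilde hS hτ
  symmetric := isSymmetricRelation_Ttilde hS hτ
  surjective := by
    rintro ⟨h, k⟩
    -- `Γ̂_a` and `Γ̂_b` are prescribed so that `i (Γ̂_a - Γ̂_b) = ĥ` and `(Γ̂_a + Γ̂_b) / 2 = k̂`
    obtain ⟨α, hα⟩ := surjective_of_isJUnitary hU (WithLp.toLp 2 (WithLp.toLp 2
      (k.fst, k.snd - (Complex.I / 2) • h.snd), -h.fst))
    obtain ⟨y, ha, h0, h1, h2⟩ :=
      Γ.exists_boundary_values hS α 0 (k.snd + (Complex.I / 2) • h.snd) 0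
    obtain ⟨p, hp, rfl⟩ := S.exists_tmax y
    have hmem : (S.quot p.1, S.quot p.2) ∈ (S.Ttilde Γ C0 C1).adjoint := by
      rw [adjoint_Ttilde hS hτ]
      exact S.mem_relOn.2 ⟨p, hp, mem_domTau.2 (by rw [h0, h2, map_zero, map_zero, add_zero]), rfl⟩
    refine ⟨⟨_, hmem⟩, ?_⟩
    have e0 : S.Γ0a U (S.fstDom p hp) = k.fst := by
      change (U (S.evalA (S.fstDom p hp))).fst.fst = _
      rw [ha, hα]
      rfl
    have e1 : S.Γhata U (S.fstDom p hp) = k.snd - (Complex.I / 2) • h.snd := by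
      change (U (S.evalA (S.fstDom p hp))).fst.snd = _
      rw [ha, hα]
      rfl
    have e2 : S.Γ1a U (S.fstDom p hp) = -h.fst := by
      change (U (S.evalA (S.fstDom p hp))).snd = _
      rw [ha, hα]
      rfl
    simp only [(hG p hp hmem).1, (hG p hp hmem).2]
    rw [Γtilde0, Γtilde1, e0, e1, e2, h1]
    refine Prod.ext (WithLp.ofLp_injective 2 (Prod.ext (neg_neg _) ?_))
      (WithLp.ofLp_injective 2 (Prod.ext rfl ?_))
    · change Complex.I • (k.snd - (Complex.I / 2) • h.snd - (k.snd + (Complex.I / 2) • h.snd)) =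
        h.snd
      have e : k.snd - (Complex.I / 2) • h.snd - (k.snd + (Complex.I / 2) • h.snd) =
          (-Complex.I) • h.snd := by module
      rw [e, smul_smul, mul_neg, Complex.I_mul_I, neg_neg, one_smul]
    · change (1 / 2 : ℂ) • (k.snd - (Complex.I / 2) • h.snd + (k.snd + (Complex.I / 2) • h.snd)) =
        k.snd
      module
  green := by
    rintro ⟨f, hf⟩ ⟨g, hg⟩
    have hf' := hf
    have hg' := hg
    rw [adjoint_Ttilde hS hτ] at hf' hg'
    obtain ⟨p, hp, hpτ, rfl⟩ := S.mem_relOn.1 hf'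
    obtain ⟨q, hq, hqτ, rfl⟩ := S.mem_relOn.1 hg'
    rw [(hG p hp hf).1, (hG p hp hf).2, (hG q hq hg).1, (hG q hq hg).2,
      ← form_sub_inner_evalA hU hτ hpτ hqτ]
    exact Γ.green hp hq

end SymmetricSystem

/-! ### The operator solution `v_τ` and the Weyl function -/

section Abstract

variable {E K : Type*} [NormedAddCommGroup E] [InnerProductSpace ℂ E]
  [NormedAddCommGroup K] [InnerProductSpace ℂ K]
  {A : Submodule ℂ (E × E)} {G0 G1 : A.adjoint →ₗ[ℂ] K}

theorem IsOrdinaryBoundaryTriplet.eq_zero_of_eigenvector (hA : IsOrdinaryBoundaryTriplet A G0 G1)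
    {z : ℂ} (hz : z.im ≠ 0) {x : E} (hx : (x, z • x) ∈ A.adjoint)
    (h : G0 ⟨(x, z • x), hx⟩ = 0) : x = 0 := by
  have hsymm : IsSymmetricRelation ((LinearMap.ker G0).map A.adjoint.subtype) := hA.adjoint_ker.ge
  have h1 := hsymm.norm_le z (p := (x, z • x)) ⟨⟨(x, z • x), hx⟩, h, rfl⟩
  rw [sub_self, norm_zero] at h1
  refine norm_le_zero_iff.1 (le_of_mul_le_mul_left (h1.trans ?_) (abs_pos.2 hz))
  rw [mul_zero]

/-- A right inverse of `Γ₀` on `{{x, z x} ∈ A*}` is the `γ`-field, because `Γ₀` is injective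
there. -/
theorem IsOrdinaryBoundaryTriplet.isGammaFieldAt (hA : IsOrdinaryBoundaryTriplet A G0 G1)
    {z : ℂ} (hz : z.im ≠ 0) {γ : K →ₗ[ℂ] E}
    (h : ∀ h : K, ∃ hm : (γ h, z • γ h) ∈ A.adjoint, G0 ⟨(γ h, z • γ h), hm⟩ = h) :
    IsGammaFieldAt A G0 z γ := by
  refine ⟨h, fun x hx => ?_⟩
  obtain ⟨hm, he⟩ := h (G0 ⟨(x, z • x), hx⟩)
  set y := γ (G0 ⟨(x, z • x), hx⟩) with hy
  have hmem : (y - x, z • (y - x)) ∈ A.adjoint := by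
    rw [smul_sub]
    exact A.adjoint.sub_mem hm hx
  refine sub_eq_zero.1 (hA.eq_zero_of_eigenvector hz hmem ?_)
  have e : (⟨(y - x, z • (y - x)), hmem⟩ : A.adjoint) =
      ⟨(y, z • y), hm⟩ - ⟨(x, z • x), hx⟩ := by
    refine Subtype.ext (Prod.ext rfl ?_)
    exact smul_sub _ _ _
  rw [e, map_sub, he, sub_self]

theorem integrable_sum_sum_smul {α ι κ V : Type*} {mα : MeasurableSpace α} {μ : Measure α}
    [Fintype ι] [Fintype κ] [NormedAddCommGroup V] [NormedSpace ℂ V] (f : ι → κ → α → ℂ)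
    (c : ι → κ → V) (h : ∀ i j, Integrable (f i j) μ) :
    Integrable (fun t => ∑ i, ∑ j, f i j t • c i j) μ :=
  integrable_finsetSum _ fun i _ => integrable_finsetSum _ fun j _ => (h i j).smul_const (c i j)

/-- In finite dimensions weak integrability of an operator function implies integrability. -/
theorem ContinuousLinearMap.integrable_of_inner {α : Type*} {mα : MeasurableSpace α}
    {μ : Measure α} [FiniteDimensional ℂ E] [FiniteDimensional ℂ K] {F : α → E →L[ℂ] K}
    (h : ∀ x y, Integrable (fun t => inner ℂ y (F t x)) μ) : Integrable F μ := by
  let b := stdOrthonormalBasis ℂ E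
  let c := stdOrthonormalBasis ℂ K
  have e : F = fun t => ∑ i, ∑ j, inner ℂ (c j) (F t (b i)) •
      (innerSL ℂ (b i)).smulRight (c j) := by
    funext t
    ext x
    conv_lhs => rw [← b.sum_repr' x, map_sum]
    simp only [sum_apply, smul_apply,
      ContinuousLinearMap.smulRight_apply, innerSL_apply_apply, map_smul]
    refine Finset.sum_congr rfl fun i _ => ?_
    conv_lhs => rw [← c.sum_repr' (F t (b i)), Finset.smul_sum]
    exact Finset.sum_congr rfl fun j _ => smul_comm _ _ _
  rw [e]
  exact integrable_sum_sum_smul (fun i j t => inner ℂ (c j) (F t (b i)))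
    (fun i j => (innerSL ℂ (b i)).smulRight (c j)) fun i j => h (b i) (c j)

theorem ContinuousLinearMap.inner_integral_apply {α : Type*} {mα : MeasurableSpace α}
    {μ : Measure α} [CompleteSpace K] {F : α → E →L[ℂ] K} (hF : Integrable F μ) (x : E) (y : K) :
    inner ℂ y ((∫ t, F t ∂μ) x) = ∫ t, inner ℂ y (F t x) ∂μ := by
  rw [ContinuousLinearMap.integral_apply hF, integral_inner (hF.apply_continuousLinearMap x)]

end Abstract

namespace SymmetricSystem

variable {H Hh Hb : Type*} [NormedAddCommGroup H] [InnerProductSpace ℂ H] [FiniteDimensional ℂ H]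
  [NormedAddCommGroup Hh] [InnerProductSpace ℂ Hh] [FiniteDimensional ℂ Hh]
  [NormedAddCommGroup Hb] [InnerProductSpace ℂ Hb]
  {S : SymmetricSystem H Hh} {Γ : S.BoundaryMap Hb} {C0 C1 : Hb →L[ℂ] Hb}
  {U : SpaceHH H Hh →L[ℂ] SpaceHH H Hh} {z w : ℂ}
  {v v' : ℝ → SpaceH0 H Hh →L[ℂ] SpaceHH H Hh}

theorem IsL2OperatorSolution.mem_tmax {K : Type*} [NormedAddCommGroup K] [InnerProductSpace ℂ K]
    {Y : ℝ → K →L[ℂ] SpaceHH H Hh} (hY : S.IsL2OperatorSolution z Y) (h : K) :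
    ((hY.toMap h).1, z • (hY.toMap h).1) ∈ S.tmax := by
  refine Solves.congr (show S.Solves _ _ from hY.isSolution h) ?_
  exact Eventually.of_forall fun t => (map_smul (S.Δ t) z (Y t h)).symm

theorem isSolution_iff_mem_tmax {y : S.L2Fun} : S.IsSolution z y.1 ↔ (y, z • y) ∈ S.tmax := by
  have e : ∀ᵐ t ∂volume.restrict S.I, z • S.Δ t (y.1 t) = S.Δ t (z • y.1 t) :=
    Eventually.of_forall fun t => (map_smul (S.Δ t) z (y.1 t)).symm
  exact ⟨fun h => Solves.congr h e, fun h => Solves.congr h (e.mono fun t ht => ht.symm)⟩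

theorem IsVTau.Γtilde0_eq (hv : S.IsVTau U Γ C0 C1 z v) (h : SpaceH0 H Hh) :
    S.Γtilde0 U Γ (hv.sol.toMap h) = h := by
  rw [Γtilde0, hv.Γ1a_eq, hv.hat_eq, neg_neg]
  rfl

theorem IsVTau.Γtilde1_eq (hv : S.IsVTau U Γ C0 C1 z v) (h : SpaceH0 H Hh) :
    S.Γtilde1 U Γ (hv.sol.toMap h) = hv.m h := by
  have e : Γ.Γhat (hv.sol.toMap h) = S.Γhata U (hv.sol.toMap h) + Complex.I • h.snd := by
    rw [← hv.hat_eq h, smul_smul, Complex.I_mul_I]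
    module
  refine WithLp.ofLp_injective 2 (Prod.ext rfl ?_)
  change (1 / 2 : ℂ) • (S.Γhata U (hv.sol.toMap h) + Γ.Γhat (hv.sol.toMap h)) =
    S.Γhata U (hv.sol.toMap h) + (Complex.I / 2) • h.snd
  rw [e]
  module

theorem IsVTau.integrableOn (hv : S.IsVTau U Γ C0 C1 z v) (hv' : S.IsVTau U Γ C0 C1 w v') :
    IntegrableOn (fun t => ContinuousLinearMap.adjoint (v t) ∘L S.Δ t ∘L v' t) S.I := by
  refine ContinuousLinearMap.integrable_of_inner fun h k => ?_
  refine (MemL2.integrableOn_inner (hv.sol.memL2 k) (hv'.sol.memL2 h)).congr ?_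
  exact Eventually.of_forall fun t => (ContinuousLinearMap.adjoint_inner_right _ _ _).symm

variable [FiniteDimensional ℂ Hb]

theorem IsVTau.mem_adjoint (hS : S.IsDefinite) (hτ : IsSelfAdjointPair C0 C1)
    (hv : S.IsVTau U Γ C0 C1 z v) (h : SpaceH0 H Hh) :
    (S.quot (hv.sol.toMap h).1, S.quot (z • (hv.sol.toMap h).1)) ∈
      (S.Ttilde Γ C0 C1).adjoint := by
  rw [adjoint_Ttilde hS hτ]
  exact S.mem_relOn.2 ⟨_, hv.sol.mem_tmax h, mem_domTau.2 (hv.tau_eq h), rfl⟩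

section Triplet

variable {G0 G1 : (S.Ttilde Γ C0 C1).adjoint →ₗ[ℂ] SpaceH0 H Hh}

theorem IsVTau.isGammaFieldAt (hS : S.IsDefinite) (hτ : IsSelfAdjointPair C0 C1) (hz : z.im ≠ 0)
    (hT : IsOrdinaryBoundaryTriplet (S.Ttilde Γ C0 C1) G0 G1)
    (hG0 : ∀ (p : S.L2Fun × S.L2Fun) (hp : p ∈ S.tmax)
      (hp' : (S.quot p.1, S.quot p.2) ∈ (S.Ttilde Γ C0 C1).adjoint),
      G0 ⟨(S.quot p.1, S.quot p.2), hp'⟩ = S.Γtilde0 U Γ (S.fstDom p hp))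
    (hv : S.IsVTau U Γ C0 C1 z v) : IsGammaFieldAt (S.Ttilde Γ C0 C1) G0 z hv.sol.toL2 :=
  hT.isGammaFieldAt hz fun h => ⟨hv.mem_adjoint hS hτ h,
    (hG0 _ (hv.sol.mem_tmax h) (hv.mem_adjoint hS hτ h)).trans (hv.Γtilde0_eq h)⟩

/-- The Weyl function of the triplet is `m_τ`. -/
theorem IsVTau.Γ1_eigenvector (hS : S.IsDefinite) (hτ : IsSelfAdjointPair C0 C1)
    (hG1 : ∀ (p : S.L2Fun × S.L2Fun) (hp : p ∈ S.tmax)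
      (hp' : (S.quot p.1, S.quot p.2) ∈ (S.Ttilde Γ C0 C1).adjoint),
      G1 ⟨(S.quot p.1, S.quot p.2), hp'⟩ = S.Γtilde1 U Γ (S.fstDom p hp))
    (hv : S.IsVTau U Γ C0 C1 z v) (h : SpaceH0 H Hh)
    (hm : (hv.sol.toL2 h, z • hv.sol.toL2 h) ∈ (S.Ttilde Γ C0 C1).adjoint) :
    G1 ⟨(hv.sol.toL2 h, z • hv.sol.toL2 h), hm⟩ = hv.m h :=
  (hG1 _ (hv.sol.mem_tmax h) (hv.mem_adjoint hS hτ h)).trans (hv.Γtilde1_eq h)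

theorem fstDom_congr {p q : S.L2Fun × S.L2Fun} (hp : p ∈ S.tmax) (hq : q ∈ S.tmax)
    (h : p.1 = q.1) : S.fstDom p hp = S.fstDom q hq :=
  Subtype.ext h

/-- An eigenvector of `T̃*` is the class of a solution of the homogeneous system. -/
theorem exists_solution_of_eigenvector (hS : S.IsDefinite) (hτ : IsSelfAdjointPair C0 C1)
    {x : S.L2} (hx : (x, z • x) ∈ (S.Ttilde Γ C0 C1).adjoint) :
    ∃ (y : S.L2Fun) (hy : (y, z • y) ∈ S.tmax), S.fstDom _ hy ∈ S.domTau Γ C0 C1 ∧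
      S.quot y = x := by
  rw [adjoint_Ttilde hS hτ] at hx
  obtain ⟨p, hp, hpτ, hpx⟩ := S.mem_relOn.1 hx
  obtain ⟨h1, h2⟩ := Prod.mk.inj hpx
  rw [← h1, ← map_smul, quot_eq_iff] at h2
  have hsol : S.Solves p.1.1 fun t => S.Δ t ((z • p.1).1 t) :=
    Solves.congr (show S.Solves p.1.1 fun t => S.Δ t (p.2.1 t) from hp) h2
  have hmem : (p.1, z • p.1) ∈ S.tmax := hsol
  refine ⟨p.1, hmem, ?_, h1⟩
  rw [fstDom_congr hmem hp rfl]
  exact hpτ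

/-- The solution operator is a linear right inverse of `Γ̃₀` on the square integrable solutions
that satisfy the boundary condition given by `τ`. -/
theorem exists_isVTau (hS : S.IsDefinite) (hτ : IsSelfAdjointPair C0 C1) (hz : z.im ≠ 0)
    (hT : IsOrdinaryBoundaryTriplet (S.Ttilde Γ C0 C1) G0 G1)
    (hG0 : ∀ (p : S.L2Fun × S.L2Fun) (hp : p ∈ S.tmax)
      (hp' : (S.quot p.1, S.quot p.2) ∈ (S.Ttilde Γ C0 C1).adjoint),
      G0 ⟨(S.quot p.1, S.quot p.2), hp'⟩ = S.Γtilde0 U Γ (S.fstDom p hp)) :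
    ∃ v, S.IsVTau U Γ C0 C1 z v := by
  let N : Submodule ℂ S.domMax :=
    S.tmax.comap (LinearMap.prod S.domMax.subtype (z • S.domMax.subtype)) ⊓ S.domTau Γ C0 C1
  have hsurj : Function.Surjective ((Γtilde0Map Γ U).domRestrict N) := fun h => by
    obtain ⟨x, hx, hxh⟩ := hT.exists_eigenvector hz h
    obtain ⟨y, hy, hyτ, rfl⟩ := exists_solution_of_eigenvector hS hτ hx
    exact ⟨⟨S.fstDom _ hy, hy, hyτ⟩, (hG0 _ hy hx).symm.trans hxh⟩
  obtain ⟨s, hs⟩ := LinearMap.exists_rightInverse_of_surjective _ (LinearMap.range_eq_top.2 hsurj)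
  let v : ℝ → SpaceH0 H Hh →L[ℂ] SpaceHH H Hh := fun t => LinearMap.toContinuousLinearMap
    { toFun := fun h => S.val (s h).1 t
      map_add' := fun h k => by rw [map_add]; rfl
      map_smul' := fun c h => by rw [map_smul]; rfl }
  have hsol : S.IsL2OperatorSolution z v :=
    { isSolution := fun h => isSolution_iff_mem_tmax.2 (s h).2.1
      memL2 := fun h => (s h).1.1.2 }
  have hmap : ∀ h, hsol.toMap h = (s h).1 := fun h => rfl
  have h0 : ∀ h, S.Γtilde0 U Γ (s h).1 = h := fun h => LinearMap.congr_fun hs h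
  refine ⟨v, hsol, fun h => ?_, fun h => ?_, fun h => ?_⟩
  · rw [hmap]
    exact neg_eq_iff_eq_neg.1 (congrArg (fun k : SpaceH0 H Hh => k.fst) (h0 h))
  · rw [hmap]
    exact congrArg (fun k : SpaceH0 H Hh => k.snd) (h0 h)
  · rw [hmap]
    exact (s h).2.2

/-- The `γ`-field determines the class of `v h` in `L²_Δ`, and definiteness determines the
solution by its class. -/
theorem IsVTau.eq_on (hS : S.IsDefinite) (hτ : IsSelfAdjointPair C0 C1) (hz : z.im ≠ 0)
    (hT : IsOrdinaryBoundaryTriplet (S.Ttilde Γ C0 C1) G0 G1)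
    (hG0 : ∀ (p : S.L2Fun × S.L2Fun) (hp : p ∈ S.tmax)
      (hp' : (S.quot p.1, S.quot p.2) ∈ (S.Ttilde Γ C0 C1).adjoint),
      G0 ⟨(S.quot p.1, S.quot p.2), hp'⟩ = S.Γtilde0 U Γ (S.fstDom p hp))
    (hv : S.IsVTau U Γ C0 C1 z v) (hv' : S.IsVTau U Γ C0 C1 z v') : ∀ t ∈ S.I, v t = v' t := by
  intro t ht
  ext1 h
  obtain ⟨hm, he⟩ := (hv'.isGammaFieldAt hS hτ hz hT hG0).1 h
  have h1 : hv.sol.toL2 h = hv'.sol.toL2 h := by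
    have := (hv.isGammaFieldAt hS hτ hz hT hG0).2 _ hm
    rwa [he] at this
  have h2 := S.tmax.sub_mem (hv.sol.mem_tmax h) (hv'.sol.mem_tmax h)
  have h3 : S.quot ((hv.sol.toMap h).1 - (hv'.sol.toMap h).1) = 0 := by
    rw [map_sub]
    exact sub_eq_zero.2 h1
  have h4 : S.quot (z • (hv.sol.toMap h).1 - z • (hv'.sol.toMap h).1) = 0 := by
    rw [← smul_sub, map_smul, h3, smul_zero]
  exact sub_eq_zero.1 (eq_zero_of_quot_eq_zero hS h2 h3 h4 t ht)

/-- The integral formula is Green's identity of the triplet for the eigenvectors given by the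
`γ`-field. -/
theorem IsVTau.m_sub_adjoint_m (hS : S.IsDefinite) (hτ : IsSelfAdjointPair C0 C1)
    (hz : z.im ≠ 0) (hw : w.im ≠ 0)
    (hT : IsOrdinaryBoundaryTriplet (S.Ttilde Γ C0 C1) G0 G1)
    (hG : ∀ (p : S.L2Fun × S.L2Fun) (hp : p ∈ S.tmax)
      (hp' : (S.quot p.1, S.quot p.2) ∈ (S.Ttilde Γ C0 C1).adjoint),
      G0 ⟨(S.quot p.1, S.quot p.2), hp'⟩ = S.Γtilde0 U Γ (S.fstDom p hp) ∧
      G1 ⟨(S.quot p.1, S.quot p.2), hp'⟩ = S.Γtilde1 U Γ (S.fstDom p hp))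
    (hv : S.IsVTau U Γ C0 C1 z v) (hv' : S.IsVTau U Γ C0 C1 w v') :
    hv'.m - ContinuousLinearMap.adjoint hv.m =
      (w - conj z) • ∫ t in S.I, ContinuousLinearMap.adjoint (v t) ∘L S.Δ t ∘L v' t := by
  have hG0 := fun p hp hp' => (hG p hp hp').1
  have hG1 := fun p hp hp' => (hG p hp hp').2
  ext1 h
  refine ext_inner_left ℂ fun k => ?_
  obtain ⟨hm, he⟩ := (hv.isGammaFieldAt hS hτ hz hT hG0).1 k
  obtain ⟨hm', he'⟩ := (hv'.isGammaFieldAt hS hτ hw hT hG0).1 h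
  have hgreen := hT.green ⟨_, hm'⟩ ⟨_, hm⟩
  rw [he, he', hv.Γ1_eigenvector hS hτ hG1, hv'.Γ1_eigenvector hS hτ hG1] at hgreen
  simp only [inner_smul_left, inner_smul_right] at hgreen
  have hint := hv.integrableOn hv'
  have e : inner ℂ k ((∫ t in S.I, ContinuousLinearMap.adjoint (v t) ∘L S.Δ t ∘L v' t) h) =
      inner ℂ (hv.sol.toL2 k) (hv'.sol.toL2 h) := by
    rw [ContinuousLinearMap.inner_integral_apply hint]
    exact integral_congr_ae (Eventually.of_forall fun t =>
      ContinuousLinearMap.adjoint_inner_right (v t) k (S.Δ t (v' t h)))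
  rw [smul_apply, inner_smul_right, e, sub_apply,
    inner_sub_right, ContinuousLinearMap.adjoint_inner_right, ← hgreen]
  ring

end Triplet

end SymmetricSystem

end

theorem proposition5p7 {H Hh Hb : Type*}
    [NormedAddCommGroup H] [InnerProductSpace ℂ H] [FiniteDimensional ℂ H]
    [NormedAddCommGroup Hh] [InnerProductSpace ℂ Hh] [FiniteDimensional ℂ Hh]
    [NormedAddCommGroup Hb] [InnerProductSpace ℂ Hb] [FiniteDimensional ℂ Hb]
    (S : SymmetricSystem H Hh) (hS : S.IsDefinite)
    (hn : deficiencyIndexPlus S.Tmin = deficiencyIndexMinus S.Tmin)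
    (U : SpaceHH H Hh →L[ℂ] SpaceHH H Hh) (hU : IsJUnitary U)
    (Γ : S.BoundaryMap Hb)
    (C0 C1 : Hb →L[ℂ] Hb) (hτ : IsSelfAdjointPair C0 C1) :
    -- for every non-real `z` the operator solution `v_τ(·, z)` exists and is unique
    (∀ z : ℂ, z.im ≠ 0 → ∃ v, S.IsVTau U Γ C0 C1 z v ∧
      ∀ w, S.IsVTau U Γ C0 C1 z w → ∀ t ∈ S.I, w t = v t) ∧
    -- (1)
    (S.Tmin ≤ S.Ttilde Γ C0 C1 ∧
      IsClosed (S.Ttilde Γ C0 C1 : Set (S.L2 × S.L2)) ∧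
      IsSymmetricRelation (S.Ttilde Γ C0 C1) ∧
      (S.Ttilde Γ C0 C1).adjoint = S.relOn (S.domTau Γ C0 C1)) ∧
    -- (2)
    (∃ G0 G1 : (S.Ttilde Γ C0 C1).adjoint →ₗ[ℂ] SpaceH0 H Hh,
      (∀ (p : S.L2Fun × S.L2Fun) (hp : p ∈ S.tmax)
          (hp' : (S.quot p.1, S.quot p.2) ∈ (S.Ttilde Γ C0 C1).adjoint),
        G0 ⟨(S.quot p.1, S.quot p.2), hp'⟩ = S.Γtilde0 U Γ (S.fstDom p hp) ∧
        G1 ⟨(S.quot p.1, S.quot p.2), hp'⟩ = S.Γtilde1 U Γ (S.fstDom p hp)) ∧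
      IsOrdinaryBoundaryTriplet (S.Ttilde Γ C0 C1) G0 G1 ∧
      ∀ (z : ℂ), z.im ≠ 0 → ∀ v (hv : S.IsVTau U Γ C0 C1 z v),
        IsGammaFieldAt (S.Ttilde Γ C0 C1) G0 z hv.sol.toL2 ∧
        IsWeylFunctionAt (S.Ttilde Γ C0 C1) G0 G1 z hv.m.toLinearMap) ∧
    -- (3)
    (∀ (z w : ℂ), z.im ≠ 0 → w.im ≠ 0 →
      ∀ v (hv : S.IsVTau U Γ C0 C1 z v) v' (hv' : S.IsVTau U Γ C0 C1 w v'),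
        IntegrableOn (fun t => ContinuousLinearMap.adjoint (v t) ∘L S.Δ t ∘L v' t) S.I ∧
        hv'.m - ContinuousLinearMap.adjoint hv.m =
          (w - conj z) • ∫ t in S.I, ContinuousLinearMap.adjoint (v t) ∘L S.Δ t ∘L v' t) ∧
    (∀ (z : ℂ), z.im ≠ 0 → ∀ v (hv : S.IsVTau U Γ C0 C1 z v),
      ((z.im : ℂ)⁻¹) • ((2 * Complex.I)⁻¹ • (hv.m - ContinuousLinearMap.adjoint hv.m)) =
        ∫ t in S.I, ContinuousLinearMap.adjoint (v t) ∘L S.Δ t ∘L v t) := by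

  obtain ⟨G0, G1, hG⟩ := SymmetricSystem.exists_triplet_maps hS U Γ C0 C1
  have hT := SymmetricSystem.isOrdinaryBoundaryTriplet hS hU hτ hG
  have hG0 := fun p hp hp' => (hG p hp hp').1
  have hG1 := fun p hp hp' => (hG p hp hp').2
  refine ⟨fun z hz => ?_, ⟨SymmetricSystem.Tmin_le_Ttilde, SymmetricSystem.isClosed_Ttilde hS hτ,
    SymmetricSystem.isSymmetricRelation_Ttilde hS hτ, SymmetricSystem.adjoint_Ttilde hS hτ⟩,
    ⟨G0, G1, hG, hT, fun z hz v hv => ?_⟩, fun z w hz hw v hv v' hv' => ⟨hv.integrableOn hv',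
      hv.m_sub_adjoint_m hS hτ hz hw hT hG hv'⟩, fun z hz v hv => ?_⟩
  · obtain ⟨v, hv⟩ := SymmetricSystem.exists_isVTau hS hτ hz hT hG0
    exact ⟨v, hv, fun w hw => hw.eq_on hS hτ hz hT hG0 hv⟩
  · have hγ := hv.isGammaFieldAt hS hτ hz hT hG0
    exact ⟨hγ, _, hγ, fun h hm => hv.Γ1_eigenvector hS hτ hG1 h hm⟩
  · have h2 : (z.im : ℂ) ≠ 0 := Complex.ofReal_ne_zero.2 hz
    rw [hv.m_sub_adjoint_m hS hτ hz hz hT hG hv, smul_smul, smul_smul, Complex.sub_conj]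
    have e : (z.im : ℂ)⁻¹ * (2 * Complex.I)⁻¹ * ((2 * z.im : ℝ) * Complex.I) = 1 := by
      have := Complex.I_ne_zero
      push_cast
      field_simp
    rw [e, one_smul]
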